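/- Let $X$ be a complex manifold of dimension $n$ and let $D=\bigcup_i D_i\subset X$ be a simple normal crossing divisor: the $D_i$ are smooth hypersurfaces, and near each point $x$ there are holomorphic coordinates in which the $D_i$ through $x$ are given by the vanishing of pairwise different coordinates, no other $D_i$ occurring. For $x\in X$ let $k(x)$ be the number of $D_i$ through $x$. Manifolds of arrows and total spaces of families of groups need not be Hausdorff. Let $\mathcal O_X^*(*D)$ be the sheaf of invertible meromorphic functions with zeros and poles only on $D$, and let $T_X(-\log D)$ be the Lie algebroid whose sections are the holomorphic vector fields tangent to all $D_i$; the sections of its dual are $\Omega^1_X(\log D)$. Let $\mathrm{Pair}(X,D)\rightrightarrows X$ be the groupoid that has arrows $x\to y$ if and only if $x$ and $y$ lie on the same $D_i$'s, an arrow $g$ then consisting of linear isomorphisms $T_xX/T_xD_i\to T_yX/T_yD_i$ for all $D_i$ containing $x$. If $h$ and $h'$ are local defining functions of $D_i$ at $x$ and at $y$, the scale $a\in\mathbb C^*$ of $g$ along $D_i$ is the factor of this isomorphism in the trivializations $dh$, $dh'$ of the normal lines if $x\in D_i$, and $a=h'(y)/h(x)$ if $x\notin D_i$. (Locally, with $D=\{x_1\cdots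 x_k=0\}$, the arrows have coordinates $(a_1,\dots,a_k,x,y_{k+1},\dots,y_n)$, where the $a_j\in\mathbb C^*$ are the scales, with source $x$ and target $(a_1x_1,\dots,a_kx_k,y_{k+1},\dots,y_n)$.) Then the following hold. 1. $\mathrm{Pair}(X,D)$ has a $2n$-dimensional complex manifold structure for which the scales are holomorphic and it is a holomorphic Lie groupoid; it integrates $T_X(-\log D)$, that is, its anchor identifies the sheaf of sections of its Lie algebroid with that of $T_X(-\log D)$. 2. There is a holomorphic family of abelian groups $\mathbb C_X^*(*D)\xrightarrow{\pi}X$ (a complex manifold with a holomorphic submersion to $X$ whose fibres are abelian groups, with holomorphic unit section, inverse and product) whose sheaf of holomorphic sections is isomorphic to $\mathcal O_X^*(*D)$. Its fibre over $x$ is isomorphic to $\mathbb C^*\times\mathbb Z^{k(x)}$, and it is not locally trivial at any point of $D$: every neighbourhood of such a point contains a point whose fibre is a non-isomorphic group. Its Lie algebroid $\mathfrak m$ is the trivial line bundle $\mathbb C_X$, with exponential map $g\mapsto e^g\in\mathcal O_X^*\subset\mathcal O_X^*(*D)$. 3. There is a $T_X(-\log D)$-module structure on $\mathbb C_X^*(*D)$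 (a representation $L$ on $\mathfrak m$ and a morphism of sheaves $\tilde L:T_X(-\log D)\otimes_{\mathbb Z}\mathcal O(\mathbb C_X^*(*D))\to\mathcal O(\mathfrak m)$ with $\tilde L_{gV}s=g\tilde L_Vs$, $\tilde L_{[V,W]}s=L_V\tilde L_Ws-L_W\tilde L_Vs$ and $\tilde L_V(\exp\sigma)=L_V\sigma$) that is given by $\mathrm{dlog}:\mathcal O_X^*(*D)\to\Omega_X^1(\log D)$, that is, $\tilde L_Vf=\mathrm{dlog}f\,(V)$. 4. There is a canonical action of $\mathrm{Pair}(X,D)$ on $\mathbb C_X^*(*D)$ that makes it a (holomorphic) $\mathrm{Pair}(X,D)$-module: an arrow $g:x\to y$ takes the value at $x$ of the section given by a constant to the value at $y$ of the same constant, and, for $h$, $h'$ and $a$ as above, it takes the value of $h$ at $x$ to the value of $a^{-1}h'$ at $y$. This module integrates the $T_X(-\log D)$-module of 3: if $\gamma$ is a holomorphic curve in the source fibre of $x$ with $\gamma(0)=\mathrm{id}_x$ whose velocity at $0$ is the value at $x$ of the section of the Lie algebroid of $\mathrm{Pair}(X,D)$ corresponding to $V$, then $$\tilde L_Vs\,(x)=\frac{d}{d\varepsilon}\Big|_{\varepsilon=0}\,s(x)^{-1}\bigl[\gamma(\varepsilon)^{-1}\cdot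 s(t(\gamma(\varepsilon)))\bigr]$$ for every local holomorphic section $s$ of $\mathbb C_X^*(*D)$ near $x$, where $t$ is the target map. -/

import Mathlib

open scoped Manifold ContDiff Topology
open TopologicalSpace Filter CategoryTheory

universe u v w

noncomputable section

namespace LogPair

/-! ### Holomorphic Lie groupoids, families of abelian groups and modules -/

section General

variable {E : Type*} [NormedAddCommGroup E] [NormedSpace ℂ E]
  {EG : Type*} [NormedAddCommGroup EG] [NormedSpace ℂ EG]
  {EM : Type*} [NormedAddCommGroup EM] [NormedSpace ℂ EM]
  {X : Type u} [TopologicalSpace X] [ChartedSpace E X]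

/-- The space of arrows `x ⟶ y` of a groupoid with object set `X`, written `⟨x, y, g⟩`. -/
abbrev Arr {X : Type u} (𝒢 : Groupoid.{v} X) : Type max u v :=
  Σ x y : X, 𝒢.Hom x y

/-- The identity arrow at `x`. -/
abbrev idArr {X : Type u} (𝒢 : Groupoid.{v} X) (x : X) : Arr 𝒢 := ⟨x, x, 𝒢.id x⟩

/-- The complex manifold structure on the space of arrows makes the groupoid `𝒢` over the complex
manifold `X` a holomorphic Lie groupoid: source and target are holomorphic submersions; identity,
inversion and composition are holomorphic. The composition is defined on the submanifold of
composable pairs of `Arr 𝒢 × Arr 𝒢`, where holomorphic means locally the restriction of a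
holomorphic map (`ContMDiffOn`); the values of `m` elsewhere are irrelevant. -/
structure IsLieGroupoid [IsManifold 𝓘(ℂ, E) ω X] (𝒢 : Groupoid.{v} X) [TopologicalSpace (Arr 𝒢)]
    [ChartedSpace EG (Arr 𝒢)] [IsManifold 𝓘(ℂ, EG) ω (Arr 𝒢)] : Prop where
  source_submersion :
    Manifold.IsSubmersion 𝓘(ℂ, EG) 𝓘(ℂ, E) ω (fun g : Arr 𝒢 => g.1)
  target_submersion :
    Manifold.IsSubmersion 𝓘(ℂ, EG) 𝓘(ℂ, E) ω (fun g : Arr 𝒢 => g.2.1)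
  id_holomorphic : ContMDiff 𝓘(ℂ, E) 𝓘(ℂ, EG) ω (fun x : X => idArr 𝒢 x)
  inv_holomorphic :
    ContMDiff 𝓘(ℂ, EG) 𝓘(ℂ, EG) ω (fun g : Arr 𝒢 => (⟨g.2.1, g.1, 𝒢.inv g.2.2⟩ : Arr 𝒢))
  comp_holomorphic : ∃ m : Arr 𝒢 × Arr 𝒢 → Arr 𝒢,
    (∀ (x y z : X) (f : 𝒢.Hom x y) (g : 𝒢.Hom y z),
      m (⟨x, y, f⟩, ⟨y, z, g⟩) = ⟨x, z, 𝒢.comp f g⟩) ∧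
    ContMDiffOn (𝓘(ℂ, EG).prod 𝓘(ℂ, EG)) 𝓘(ℂ, EG) ω m {p | p.1.2.1 = p.2.1}

/-- The total space of the groups `F x`, `x : X`, with the given complex manifold structure, is a
holomorphic family of abelian groups over `X`: a holomorphic Lie groupoid whose source and target
are the same map, the projection to `X`, and whose fibres are abelian groups. -/
structure IsFamilyOfAbelianGroups [IsManifold 𝓘(ℂ, E) ω X] (F : X → Type w)
    [∀ x, CommGroup (F x)] [TopologicalSpace (Σ x, F x)] [ChartedSpace EM (Σ x, F x)]
    [IsManifold 𝓘(ℂ, EM) ω (Σ x, F x)] : Prop where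
  proj_submersion :
    Manifold.IsSubmersion 𝓘(ℂ, EM) 𝓘(ℂ, E) ω (fun m : Σ x, F x => m.1)
  one_holomorphic :
    ContMDiff 𝓘(ℂ, E) 𝓘(ℂ, EM) ω (fun x : X => (⟨x, 1⟩ : Σ x, F x))
  inv_holomorphic :
    ContMDiff 𝓘(ℂ, EM) 𝓘(ℂ, EM) ω (fun m : Σ x, F x => (⟨m.1, m.2⁻¹⟩ : Σ x, F x))
  mul_holomorphic : ∃ μ : (Σ x, F x) × (Σ x, F x) → Σ x, F x,
    (∀ (x : X) (a b : F x), μ (⟨x, a⟩, ⟨x, b⟩) = ⟨x, a * b⟩) ∧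
    ContMDiffOn (𝓘(ℂ, EM).prod 𝓘(ℂ, EM)) 𝓘(ℂ, EM) ω μ {p | p.1.1 = p.2.1}

/-- An action of the Lie groupoid `𝒢` on the family `F`, an arrow `x ⟶ y` acting by a group
homomorphism `F x → F y`, makes `F` a (holomorphic) `𝒢`-module. -/
structure IsGroupoidModule (𝒢 : Groupoid.{v} X) [TopologicalSpace (Arr 𝒢)]
    [ChartedSpace EG (Arr 𝒢)] (F : X → Type w) [∀ x, CommGroup (F x)]
    [TopologicalSpace (Σ x, F x)] [ChartedSpace EM (Σ x, F x)]
    (act : ∀ x y : X, 𝒢.Hom x y → (F x →* F y)) : Prop where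
  act_id : ∀ (x : X) (m : F x), act x x (𝒢.id x) m = m
  act_comp : ∀ (x y z : X) (f : 𝒢.Hom x y) (g : 𝒢.Hom y z) (m : F x),
    act x z (𝒢.comp f g) m = act y z g (act x y f m)
  act_holomorphic : ∃ a : Arr 𝒢 × (Σ x, F x) → Σ x, F x,
    (∀ (x y : X) (g : 𝒢.Hom x y) (m : F x), a (⟨x, y, g⟩, ⟨x, m⟩) = ⟨y, act x y g m⟩) ∧
    ContMDiffOn (𝓘(ℂ, EG).prod 𝓘(ℂ, EM)) 𝓘(ℂ, EM) ω a {p | p.1.1 = p.2.1}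

/-- `s` is (on `U`) a holomorphic section over `U` of the family `F`. As everywhere below, a
section over `U` is written as a function on `X` whose values outside `U` are irrelevant. -/
def IsSection (F : X → Type w) [TopologicalSpace (Σ x, F x)] [ChartedSpace EM (Σ x, F x)]
    (U : Opens X) (s : ∀ x, F x) : Prop :=
  ContMDiffOn 𝓘(ℂ, E) 𝓘(ℂ, EM) ω (fun x => (⟨x, s x⟩ : Σ x, F x)) U

/-- `g` is a holomorphic function on `U`. -/
def IsHol (U : Opens X) (g : X → ℂ) : Prop := ContMDiffOn 𝓘(ℂ, E) 𝓘(ℂ, ℂ) ω g U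

/-- The fibre at `x` of the Lie algebroid `Lie(𝒢)`: the tangent vectors at the identity arrow of
`x` that are tangent to the source fibre. -/
def AlgebroidFibre (𝒢 : Groupoid.{v} X) [TopologicalSpace (Arr 𝒢)] [ChartedSpace EG (Arr 𝒢)]
    (x : X) : Submodule ℂ (TangentSpace 𝓘(ℂ, EG) (idArr 𝒢 x)) :=
  LinearMap.ker (mfderiv 𝓘(ℂ, EG) 𝓘(ℂ, E) (fun g : Arr 𝒢 => g.1) (idArr 𝒢 x)).toLinearMap

/-- The anchor `Lie(𝒢)_x → T_x X`: the differential of the target map. -/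
def anchor (𝒢 : Groupoid.{v} X) [TopologicalSpace (Arr 𝒢)] [ChartedSpace EG (Arr 𝒢)]
    (x : X) (ξ : AlgebroidFibre (E := E) (EG := EG) 𝒢 x) : TangentSpace 𝓘(ℂ, E) x :=
  mfderiv 𝓘(ℂ, EG) 𝓘(ℂ, E) (fun g : Arr 𝒢 => g.2.1) (idArr 𝒢 x)
    (ξ : TangentSpace 𝓘(ℂ, EG) (idArr 𝒢 x))

/-- `ξ` is a holomorphic section over `U` of the Lie algebroid `Lie(𝒢)`. -/
def IsAlgebroidSection (𝒢 : Groupoid.{v} X) [TopologicalSpace (Arr 𝒢)]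
    [ChartedSpace EG (Arr 𝒢)] [IsManifold 𝓘(ℂ, EG) ω (Arr 𝒢)] (U : Opens X)
    (ξ : ∀ x, AlgebroidFibre (E := E) (EG := EG) 𝒢 x) : Prop :=
  ContMDiffOn 𝓘(ℂ, E) 𝓘(ℂ, EG).tangent ω
    (fun x => (⟨idArr 𝒢 x, (ξ x : TangentSpace 𝓘(ℂ, EG) (idArr 𝒢 x))⟩ :
      TangentBundle 𝓘(ℂ, EG) (Arr 𝒢))) U

/-- The fibre at `x` of the Lie algebroid `𝔪` of a family of abelian groups: the tangent space at
the unit of the group `F x`. -/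
def LieFibre (F : X → Type w) [∀ x, CommGroup (F x)] [TopologicalSpace (Σ x, F x)]
    [ChartedSpace EM (Σ x, F x)] (x : X) :
    Submodule ℂ (TangentSpace 𝓘(ℂ, EM) (⟨x, 1⟩ : Σ x, F x)) :=
  LinearMap.ker
    (mfderiv 𝓘(ℂ, EM) 𝓘(ℂ, E) (fun m : Σ x, F x => m.1) (⟨x, 1⟩ : Σ x, F x)).toLinearMap

/-- `σ` is a holomorphic section over `U` of the vector bundle `𝔪`. -/
def IsLieSection (F : X → Type w) [∀ x, CommGroup (F x)] [TopologicalSpace (Σ x, F x)]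
    [ChartedSpace EM (Σ x, F x)] [IsManifold 𝓘(ℂ, EM) ω (Σ x, F x)] (U : Opens X)
    (σ : ∀ x, LieFibre (E := E) (EM := EM) F x) : Prop :=
  ContMDiffOn 𝓘(ℂ, E) 𝓘(ℂ, EM).tangent ω
    (fun x => (⟨⟨x, 1⟩, (σ x : TangentSpace 𝓘(ℂ, EM) (⟨x, 1⟩ : Σ x, F x))⟩ :
      TangentBundle 𝓘(ℂ, EM) (Σ x, F x))) U

/-- The curve `c` in the group `F x` passes at time `0` through the unit, with velocity `a`. -/
def HasVelocity (F : X → Type w) [∀ x, CommGroup (F x)] [TopologicalSpace (Σ x, F x)]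
    [ChartedSpace EM (Σ x, F x)] {x : X} (c : ℂ → F x)
    (a : LieFibre (E := E) (EM := EM) F x) : Prop :=
  c 0 = 1 ∧
  HasMFDerivAt 𝓘(ℂ, ℂ) 𝓘(ℂ, EM) (fun ε => (⟨x, c ε⟩ : Σ x, F x)) 0
    (ContinuousLinearMap.toSpanSingleton ℂ (a.1 : EM))

/-- `b = exp a` for the exponential map of the group `F x`: `b` is the value at time `1` of the
one-parameter subgroup with velocity `a`. -/
def IsExp (F : X → Type w) [∀ x, CommGroup (F x)] [TopologicalSpace (Σ x, F x)]
    [ChartedSpace EM (Σ x, F x)] {x : X} (a : LieFibre (E := E) (EM := EM) F x)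
    (b : F x) : Prop :=
  ∃ φ : Multiplicative ℂ →* F x,
    HasVelocity F (fun t => φ (Multiplicative.ofAdd t)) a ∧ φ (Multiplicative.ofAdd 1) = b

end General

/-! ### Simple normal crossing divisors, `𝒪^*(*D)`, `T_X(-log D)` and `Pair(X, D)` -/

/-- A (reduced) simple normal crossing divisor `D = ⋃ i, comp i` on an `n`-dimensional complex
manifold `X`: near each point `x` there are holomorphic coordinates `z` such that the `D i` through
`x` are given by the vanishing of pairwise different coordinates, and no other `D i` occurs.
So each `D i` is a smooth closed hypersurface; it may be disconnected. -/
structure SNCDivisor (n : ℕ) (X : Type u) [TopologicalSpace X] [ChartedSpace (Fin n → ℂ) X] where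
  ι : Type v
  comp : ι → Set X
  exists_chart : ∀ x : X, ∃ z ∈ IsManifold.maximalAtlas 𝓘(ℂ, Fin n → ℂ) ω X, x ∈ z.source ∧
    ∃ c : {i // x ∈ comp i} → Fin n, Function.Injective c ∧
      ∀ i, ∀ y ∈ z.source, y ∈ comp i ↔ ∃ h : x ∈ comp i, z y (c ⟨i, h⟩) = 0

namespace SNCDivisor

variable {n : ℕ} {X : Type u} [TopologicalSpace X] [ChartedSpace (Fin n → ℂ) X]
  (D : SNCDivisor.{u, v} n X)

/-- The underlying set of `D`. -/
def support : Set X := ⋃ i, D.comp i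

/-- `f` is a section over `U` of `𝒪^*(*D)`, the sheaf of invertible meromorphic functions with
zeros and poles only on `D`: it is holomorphic without zeros on `U \ D`, and near every point
of `U` it is a quotient of holomorphic functions with a denominator that vanishes only on `D`.
The values of `f` outside `U \ D` are irrelevant. -/
structure IsMerUnit (U : Opens X) (f : X → ℂ) : Prop where
  holomorphic : ContMDiffOn 𝓘(ℂ, Fin n → ℂ) 𝓘(ℂ, ℂ) ω f ((U : Set X) \ D.support)
  ne_zero : ∀ x ∈ (U : Set X) \ D.support, f x ≠ 0
  meromorphic : ∀ x ∈ U, ∃ p q : X → ℂ,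
    ContMDiffAt 𝓘(ℂ, Fin n → ℂ) 𝓘(ℂ, ℂ) ω p x ∧ ContMDiffAt 𝓘(ℂ, Fin n → ℂ) 𝓘(ℂ, ℂ) ω q x ∧
    ∀ᶠ y in 𝓝 x, y ∉ D.support → q y ≠ 0 ∧ f y = p y / q y

/-- `h` is a holomorphic defining function of the hypersurface `D i` on `U`. -/
structure IsDefiningFunction (i : D.ι) (U : Opens X) (h : X → ℂ) : Prop where
  holomorphic : ContMDiffOn 𝓘(ℂ, Fin n → ℂ) 𝓘(ℂ, ℂ) ω h U
  zero_iff : ∀ x ∈ U, h x = 0 ↔ x ∈ D.comp i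
  mfderiv_ne_zero : ∀ x ∈ U, x ∈ D.comp i → mfderiv 𝓘(ℂ, Fin n → ℂ) 𝓘(ℂ, ℂ) h x ≠ 0

/-- The tangent space at `x` of the hypersurface `D i` (for `x` in `D i`): the vectors killed by
the differentials of all germs of holomorphic functions that vanish on `D i`. -/
def tangentTo (i : D.ι) (x : X) : Submodule ℂ (TangentSpace 𝓘(ℂ, Fin n → ℂ) x) :=
  ⨅ (f : X → ℂ) (_ : ContMDiffAt 𝓘(ℂ, Fin n → ℂ) 𝓘(ℂ, ℂ) ω f x)
    (_ : ∀ᶠ y in 𝓝 x, y ∈ D.comp i → f y = 0),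
    LinearMap.ker (mfderiv 𝓘(ℂ, Fin n → ℂ) 𝓘(ℂ, ℂ) f x).toLinearMap

/-- The normal space `T_x X / T_x (D i)`. -/
abbrev Normal (i : D.ι) (x : X) : Type :=
  TangentSpace 𝓘(ℂ, Fin n → ℂ) x ⧸ D.tangentTo i x

/-- `V` is a section over `U` of `T_X(-log D)`: a holomorphic vector field on `U` that is tangent
to all components of `D`. The anchor of this Lie algebroid is the inclusion into `T_X`, its
bracket is that of vector fields. -/
structure IsLogField [IsManifold 𝓘(ℂ, Fin n → ℂ) ω X] (U : Opens X)
    (V : ∀ x : X, TangentSpace 𝓘(ℂ, Fin n → ℂ) x) : Prop where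
  holomorphic : ContMDiffOn 𝓘(ℂ, Fin n → ℂ) 𝓘(ℂ, Fin n → ℂ).tangent ω
    (fun x => (⟨x, V x⟩ : TangentBundle 𝓘(ℂ, Fin n → ℂ) X)) U
  tangent : ∀ x ∈ U, ∀ i, x ∈ D.comp i → V x ∈ D.tangentTo i x

/-- The value `dg(ξ)` of the differential of the function `g` at the tangent vector `ξ`. -/
def differential (g : X → ℂ) (x : X) (ξ : TangentSpace 𝓘(ℂ, Fin n → ℂ) x) : ℂ :=
  mfderiv 𝓘(ℂ, Fin n → ℂ) 𝓘(ℂ, ℂ) g x ξ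

/-- The derivative `V g` of a function along a vector field. -/
def lieDeriv (V : ∀ x : X, TangentSpace 𝓘(ℂ, Fin n → ℂ) x) (g : X → ℂ) (x : X) : ℂ :=
  differential g x (V x)

/-- `h = dlog f (V)` on `U`, for `f` in `𝒪^*(*D)(U)` and `V` in `T_X(-log D)(U)`: the holomorphic
function on `U` that is equal to `(V f) / f` off `D`. (As `Ω¹(log D)` is the dual of
`T_X(-log D)`, the logarithmic form `dlog f` is determined by these values.) -/
def IsDlog (U : Opens X) (f : X → ℂ) (V : ∀ x : X, TangentSpace 𝓘(ℂ, Fin n → ℂ) x)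
    (h : X → ℂ) : Prop :=
  IsHol (E := Fin n → ℂ) U h ∧ ∀ x ∈ (U : Set X) \ D.support, h x = lieDeriv V f x / f x

/-- An arrow `x ⟶ y` of `Pair(X, D)`: it exists if `x` and `y` lie on the same components of `D`,
and consists of a linear isomorphism of normal spaces for each of these components. -/
@[ext]
structure PairHom (x y : X) where
  mem_iff : ∀ i, x ∈ D.comp i ↔ y ∈ D.comp i
  iso : ∀ i, x ∈ D.comp i → (D.Normal i x ≃ₗ[ℂ] D.Normal i y)

/-- The groupoid `Pair(X, D)` with object set `X`. (Restricting to the open subgroupoid formed by the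
identity components of the source fibres gives the source-connected version.) -/
@[reducible]
def pair : Groupoid.{v} X where
  Hom x y := D.PairHom x y
  id x := ⟨fun _ => Iff.rfl, fun _ _ => LinearEquiv.refl ℂ _⟩
  comp f g := ⟨fun i => (f.mem_iff i).trans (g.mem_iff i),
    fun i hi => (f.iso i hi).trans (g.iso i ((f.mem_iff i).1 hi))⟩
  inv f := ⟨fun i => (f.mem_iff i).symm, fun i hi => (f.iso i ((f.mem_iff i).2 hi)).symm⟩
  id_comp _ := by ext; rfl
  comp_id _ := by ext; rfl
  assoc _ _ _ := by ext; rfl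
  inv_comp f := by
    ext i hi v
    exact (f.iso i ((f.mem_iff i).2 hi)).apply_symm_apply v
  comp_inv f := by
    ext i hi v
    exact (f.iso i hi).symm_apply_apply v

/-- `a` is the scale of the arrow `g : x ⟶ y` along `D i`, with respect to local defining functions
`h` of `D i` at `x` and `k` at `y`: off `D i` it is `k y / h x`, and on `D i` it is the factor of
the isomorphism of normal lines, which are identified with `ℂ` through `dh` and `dk`. -/
structure IsScale (i : D.ι) (h k : X → ℂ) {x y : X} (g : D.PairHom x y) (a : ℂ) : Prop where
  off : x ∉ D.comp i → k y = a * h x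
  on : ∀ (hx : x ∈ D.comp i) (ξ : TangentSpace 𝓘(ℂ, Fin n → ℂ) x)
    (η : TangentSpace 𝓘(ℂ, Fin n → ℂ) y),
    g.iso i hx (Submodule.Quotient.mk ξ) = Submodule.Quotient.mk η →
      differential k y η = a * differential h x ξ

variable {EG : Type*} [NormedAddCommGroup EG] [NormedSpace ℂ EG]
  {EM : Type*} [NormedAddCommGroup EM] [NormedSpace ℂ EM]

/-- The scales are holomorphic functions on the arrows of `Pair(X, D)`. Near an arrow, the scales
along the `D i` through its ends, the coordinates of the source, and those coordinates of the
target that do not define one of these `D i`, are `2n` functions that separate arrows: they are the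
usual coordinates on `Pair(X, D)`, where the target has the coordinates `(a₁x₁, …, aₖxₖ, y')` if
the source is `x` and the scales are `a₁, …, aₖ`. Hence this property determines the `2n`-dimensional
complex manifold structure for which source and target are holomorphic. -/
def ScalesHolomorphic [TopologicalSpace (Arr D.pair)] [ChartedSpace EG (Arr D.pair)] : Prop :=
  ∀ (i : D.ι) (U W : Opens X) (h k : X → ℂ),
    D.IsDefiningFunction i U h → D.IsDefiningFunction i W k →
    ∃ a : Arr D.pair → ℂ,
      (∀ (x y : X) (g : D.PairHom x y), x ∈ U → y ∈ W → D.IsScale i h k g (a ⟨x, y, g⟩)) ∧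
      ContMDiffOn 𝓘(ℂ, EG) 𝓘(ℂ, ℂ) ω a {g : Arr D.pair | g.1 ∈ U ∧ g.2.1 ∈ W}

/-- `Pair(X, D)` integrates `T_X(-log D)`: over every open set the anchor maps the holomorphic
sections of `Lie(Pair(X, D))` bijectively to those of `T_X(-log D)`. (Anchors preserve brackets, so
this is an isomorphism of Lie algebroids.) -/
structure IntegratesLogTangent [IsManifold 𝓘(ℂ, Fin n → ℂ) ω X] [TopologicalSpace (Arr D.pair)]
    [ChartedSpace EG (Arr D.pair)] [IsManifold 𝓘(ℂ, EG) ω (Arr D.pair)] : Prop where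
  anchor_mem : ∀ (U : Opens X) (ξ : ∀ x, AlgebroidFibre (E := Fin n → ℂ) (EG := EG) D.pair x),
    IsAlgebroidSection D.pair U ξ → D.IsLogField U (fun x => anchor D.pair x (ξ x))
  anchor_injective : ∀ (U : Opens X)
    (ξ ξ' : ∀ x, AlgebroidFibre (E := Fin n → ℂ) (EG := EG) D.pair x),
    IsAlgebroidSection D.pair U ξ → IsAlgebroidSection D.pair U ξ' →
    (∀ x ∈ U, anchor D.pair x (ξ x) = anchor D.pair x (ξ' x)) → ∀ x ∈ U, ξ x = ξ' x
  anchor_surjective : ∀ (U : Opens X) (V : ∀ x : X, TangentSpace 𝓘(ℂ, Fin n → ℂ) x),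
    D.IsLogField U V → ∃ ξ : ∀ x, AlgebroidFibre (E := Fin n → ℂ) (EG := EG) D.pair x,
      IsAlgebroidSection D.pair U ξ ∧ ∀ x ∈ U, anchor D.pair x (ξ x) = V x

/-- An isomorphism of sheaves of abelian groups from `𝒪^*(*D)` to the sheaf `𝒪(F)` of holomorphic
sections of the family `F`; `Φ U` maps the sections over `U`. -/
structure IsSheafIso (F : X → Type w) [∀ x, CommGroup (F x)] [TopologicalSpace (Σ x, F x)]
    [ChartedSpace EM (Σ x, F x)] (Φ : Opens X → (X → ℂ) → ∀ x, F x) : Prop where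
  isSection : ∀ U f, D.IsMerUnit U f → IsSection (E := Fin n → ℂ) (EM := EM) F U (Φ U f)
  map_mul : ∀ U f g, D.IsMerUnit U f → D.IsMerUnit U g →
    ∀ x ∈ U, Φ U (fun y => f y * g y) x = Φ U f x * Φ U g x
  map_restrict : ∀ U W f g, W ≤ U → D.IsMerUnit U f → D.IsMerUnit W g →
    (∀ x ∈ (W : Set X) \ D.support, f x = g x) → ∀ x ∈ W, Φ U f x = Φ W g x
  injective : ∀ U f g, D.IsMerUnit U f → D.IsMerUnit U g →
    (∀ x ∈ U, Φ U f x = Φ U g x) → ∀ x ∈ (U : Set X) \ D.support, f x = g x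
  surjective : ∀ U s, IsSection (E := Fin n → ℂ) (EM := EM) F U s →
    ∃ f, D.IsMerUnit U f ∧ ∀ x ∈ U, Φ U f x = s x

/-- A `T_X(-log D)`-module structure on the family of abelian groups `F` with Lie algebroid `𝔪`:
a representation `L` of `T_X(-log D)` on `𝔪` and a morphism of sheaves `Lt` from
`T_X(-log D) ⊗ 𝒪(F)` to `𝒪(𝔪)`, with the compatibilities. -/
structure LogModule [IsManifold 𝓘(ℂ, Fin n → ℂ) ω X] (F : X → Type w) [∀ x, CommGroup (F x)]
    [TopologicalSpace (Σ x, F x)] [ChartedSpace EM (Σ x, F x)]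
    [IsManifold 𝓘(ℂ, EM) ω (Σ x, F x)] where
  L : Opens X → (∀ x : X, TangentSpace 𝓘(ℂ, Fin n → ℂ) x) →
    (∀ x, LieFibre (E := Fin n → ℂ) (EM := EM) F x) →
    ∀ x, LieFibre (E := Fin n → ℂ) (EM := EM) F x
  Lt : Opens X → (∀ x : X, TangentSpace 𝓘(ℂ, Fin n → ℂ) x) → (∀ x, F x) →
    ∀ x, LieFibre (E := Fin n → ℂ) (EM := EM) F x
  L_section : ∀ U V σ, D.IsLogField U V → IsLieSection F U σ → IsLieSection F U (L U V σ)
  L_restrict : ∀ U W V V' σ σ', W ≤ U → D.IsLogField U V → D.IsLogField W V' →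
    IsLieSection F U σ → IsLieSection F W σ' → (∀ x ∈ W, V x = V' x) → (∀ x ∈ W, σ x = σ' x) →
    ∀ x ∈ W, L U V σ x = L W V' σ' x
  L_add_left : ∀ U V V' σ, D.IsLogField U V → D.IsLogField U V' → IsLieSection F U σ →
    ∀ x ∈ U, L U (fun y => V y + V' y) σ x = L U V σ x + L U V' σ x
  L_add_right : ∀ U V σ σ', D.IsLogField U V → IsLieSection F U σ → IsLieSection F U σ' →
    ∀ x ∈ U, L U V (fun y => σ y + σ' y) x = L U V σ x + L U V σ' x
  L_smul : ∀ U V σ g, D.IsLogField U V → IsLieSection F U σ → IsHol (E := Fin n → ℂ) U g →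
    ∀ x ∈ U, L U (fun y => g y • V y) σ x = g x • L U V σ x
  L_leibniz : ∀ U V σ g, D.IsLogField U V → IsLieSection F U σ → IsHol (E := Fin n → ℂ) U g →
    ∀ x ∈ U, L U V (fun y => g y • σ y) x = g x • L U V σ x + lieDeriv V g x • σ x
  L_bracket : ∀ U V V' σ, D.IsLogField U V → D.IsLogField U V' → IsLieSection F U σ →
    ∀ x ∈ U, L U (fun y => VectorField.mlieBracket 𝓘(ℂ, Fin n → ℂ) V V' y) σ x =
      L U V (L U V' σ) x - L U V' (L U V σ) x
  Lt_section : ∀ U V s, D.IsLogField U V → IsSection (E := Fin n → ℂ) (EM := EM) F U s →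
    IsLieSection F U (Lt U V s)
  Lt_restrict : ∀ U W V V' s s', W ≤ U → D.IsLogField U V → D.IsLogField W V' →
    IsSection (E := Fin n → ℂ) (EM := EM) F U s → IsSection (E := Fin n → ℂ) (EM := EM) F W s' →
    (∀ x ∈ W, V x = V' x) → (∀ x ∈ W, s x = s' x) → ∀ x ∈ W, Lt U V s x = Lt W V' s' x
  Lt_add : ∀ U V V' s, D.IsLogField U V → D.IsLogField U V' →
    IsSection (E := Fin n → ℂ) (EM := EM) F U s →
    ∀ x ∈ U, Lt U (fun y => V y + V' y) s x = Lt U V s x + Lt U V' s x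
  Lt_mul : ∀ U V s s', D.IsLogField U V → IsSection (E := Fin n → ℂ) (EM := EM) F U s →
    IsSection (E := Fin n → ℂ) (EM := EM) F U s' →
    ∀ x ∈ U, Lt U V (fun y => s y * s' y) x = Lt U V s x + Lt U V s' x
  Lt_smul : ∀ U V s g, D.IsLogField U V → IsSection (E := Fin n → ℂ) (EM := EM) F U s →
    IsHol (E := Fin n → ℂ) U g → ∀ x ∈ U, Lt U (fun y => g y • V y) s x = g x • Lt U V s x
  Lt_bracket : ∀ U V V' s, D.IsLogField U V → D.IsLogField U V' →
    IsSection (E := Fin n → ℂ) (EM := EM) F U s →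
    ∀ x ∈ U, Lt U (fun y => VectorField.mlieBracket 𝓘(ℂ, Fin n → ℂ) V V' y) s x =
      L U V (Lt U V' s) x - L U V' (Lt U V s) x
  Lt_exp : ∀ U V σ s, D.IsLogField U V → IsLieSection F U σ →
    IsSection (E := Fin n → ℂ) (EM := EM) F U s → (∀ x ∈ U, IsExp F (σ x) (s x)) →
    ∀ x ∈ U, Lt U V s x = L U V σ x

/-- The action `act` of `Pair(X, D)` on a family `F` with sheaf of sections `𝒪^*(*D)` (through `Φ`)
is the canonical one: an arrow `g : x ⟶ y` takes the value at `x` of a constant to its value at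
`y`; and if `h`, `k` are local defining functions of `D i` at `x` and `y`, and `a` is the scale of
`g`, then `g` takes the value of `h` at `x` to that of `a⁻¹ k` at `y`. -/
structure IsCanonicalAction {F : X → Type w} [∀ x, CommGroup (F x)]
    (Φ : Opens X → (X → ℂ) → ∀ x, F x)
    (act : ∀ x y : X, D.pair.Hom x y → (F x →* F y)) : Prop where
  act_const : ∀ (x y : X) (g : D.pair.Hom x y) (c : ℂ), c ≠ 0 →
    act x y g (Φ ⊤ (fun _ => c) x) = Φ ⊤ (fun _ => c) y
  act_defining : ∀ (i : D.ι) (U W : Opens X) (h k : X → ℂ),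
    D.IsDefiningFunction i U h → D.IsDefiningFunction i W k →
    ∀ (x y : X) (g : D.pair.Hom x y) (a : ℂ), x ∈ U → y ∈ W → D.IsScale i h k g a →
      act x y g (Φ U h x) = Φ W (fun z => a⁻¹ * k z) y

/-- The `Pair(X, D)`-module `F` with action `act` differentiates to the `T_X(-log D)`-module `𝓛`:
`Lt_V s (x)` is the velocity at `ε = 0` of `s(x)⁻¹ (γ(ε)⁻¹ · s(t(γ(ε))))`, whenever `γ` is a curve
in the source fibre of `x`, starting at the identity, whose velocity is the value at `x` of the
section of `Lie(Pair(X, D))` that corresponds to `V`. -/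
def Integrates [IsManifold 𝓘(ℂ, Fin n → ℂ) ω X] [TopologicalSpace (Arr D.pair)]
    [ChartedSpace EG (Arr D.pair)] [IsManifold 𝓘(ℂ, EG) ω (Arr D.pair)]
    {F : X → Type w} [∀ x, CommGroup (F x)] [TopologicalSpace (Σ x, F x)]
    [ChartedSpace EM (Σ x, F x)] [IsManifold 𝓘(ℂ, EM) ω (Σ x, F x)]
    (act : ∀ x y : X, D.pair.Hom x y → (F x →* F y)) (𝓛 : D.LogModule (EM := EM) F) : Prop :=
  ∀ (U : Opens X) (V : ∀ x : X, TangentSpace 𝓘(ℂ, Fin n → ℂ) x) (s : ∀ x, F x)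
    (ξ : ∀ x, AlgebroidFibre (E := Fin n → ℂ) (EG := EG) D.pair x),
    D.IsLogField U V → IsSection (E := Fin n → ℂ) (EM := EM) F U s →
    IsAlgebroidSection D.pair U ξ → (∀ x ∈ U, anchor D.pair x (ξ x) = V x) →
    ∀ x ∈ U, ∀ γ : ℂ → Σ y, D.pair.Hom x y, γ 0 = ⟨x, D.pair.id x⟩ →
      HasMFDerivAt 𝓘(ℂ, ℂ) 𝓘(ℂ, EG) (fun ε => (⟨x, γ ε⟩ : Arr D.pair)) 0
        (ContinuousLinearMap.toSpanSingleton ℂ ((ξ x).1 : EG)) →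
      HasVelocity F (fun ε => (s x)⁻¹ * act (γ ε).1 x (D.pair.inv (γ ε).2) (s (γ ε).1)) (𝓛.Lt U V s x)

end SNCDivisor

end LogPair

end

/-!
The argument rests on one local fact: near a point `x` with adapted coordinates `z`, every
invertible meromorphic function with zeros and poles only on `D` is a nowhere vanishing
holomorphic function times a monomial in the coordinates that define the components of `D`
through `x` (`IsMerUnit.exists_eq_mul_mono`). It comes from dividing a holomorphic function by a
coordinate along whose zero set it vanishes (`exists_analyticAt_eq_mul`), and from the fact that a
holomorphic function which vanishes at a point but nowhere off the coordinate hyperplanes vanishes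
along a whole hyperplane (`exists_forall_eq_zero_of_ne_zero_off`).

*The family of groups.* The value at `x` of a unit `f` is the pair of the value of its holomorphic
factor and its exponents, taken in a chosen adapted chart (`Fib`, `value`). Hence the fibre is
`ℂˣ × ℤ^{k(x)}`. The constant multiples of a fixed monomial sweep out a chart of the total space,
and two such charts differ by multiplication by a nowhere vanishing holomorphic function
(`fibChart_transition`), so the total space is a complex manifold. Its holomorphic sections are
exactly the values of units (`isSheafIso_value`). The fibres off `D` are divisible by two and the
others are not, and the complement of `D` is dense, so the family is not locally trivial at any
point of `D` (`exists_isEmpty_mulEquiv`).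

*The groupoid.* An arrow is charted by the adapted coordinates of its source, its scales along the
components of `D` at the chart centre, and the remaining coordinates of its target; the other
coordinates of the target are products of scales and source coordinates. The scales in other
adapted charts differ by factors holomorphic in these data, so that a map into the manifold of
arrows is holomorphic as soon as its source, target and scales are (`contMDiffWithinAt_arr`).
Composition multiplies scales and inversion inverts them (`isLieGroupoid_pair`). A logarithmic
field `V` lifts to the Lie algebroid by letting the scale along a component `z = 0` grow at the
rate `V z / z`, which is holomorphic because `V` is tangent to the component
(`exists_algebroidSection`). The lift is unique because it is so off `D`, where the anchor is
injective, and the complement of `D` is dense (`eq_of_anchor_eq`, `integratesLogTangent`).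

*The module over logarithmic fields.* The function `V f / f` extends holomorphically across `D`
for the same reason (`IsLogField.exists_lieDeriv_zeta`), which defines `dlogAlong`. Its algebraic
identities need to be checked only off `D`, where they are the rules for the logarithmic
derivative (`logModule`).

*The action.* An arrow acts on the value of a unit by keeping constants and dividing each defining
function by the scale along its component (`act`, `act_value_of_isDefiningFunction`); this respects
composition because scales multiply, and it is holomorphic because the scales are
(`isGroupoidModule_act`). For a unit `s`, comparing `s` at the target, transported back along an
arrow, with `s` at the source gives a holomorphic nowhere vanishing function on arrows near the
identities. Its derivative along the Lie algebroid lift of `V` is `V s / s` off `D`, where an arrow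
is just the pair of its ends, and hence everywhere by density (`integrates_act`).
-/

noncomputable section

namespace LogPair

/-! ### Holomorphic functions of several variables -/

section SeveralVariables

variable {V : Type*} [NormedAddCommGroup V] [NormedSpace ℂ V]

/-- An average of an analytic function along a continuous family of linear contractions towards `a`
is analytic: its power series is obtained by averaging the coefficients. -/
theorem analyticAt_intervalIntegral_comp_linear {F : V → ℂ} {a : V} (hF : AnalyticAt ℂ F a)
    {T : ℝ → V →L[ℂ] V} (hT : Continuous T) :
    AnalyticAt ℂ (fun y => ∫ t in (0 : ℝ)..1, F (a + T t (y - a))) a := by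
  obtain ⟨p, r, hp⟩ := hF
  obtain ⟨C, hC⟩ := isCompact_Icc.exists_bound_of_continuousOn (s := Set.Icc (0 : ℝ) 1)
    hT.continuousOn
  set K : NNReal := max 1 C.toNNReal with hK
  have hK1 : (1 : NNReal) ≤ K := le_max_left _ _
  have hTK : ∀ t ∈ Set.Icc (0 : ℝ) 1, ‖T t‖ ≤ K := fun t ht =>
    (hC t ht).trans ((Real.le_coe_toNNReal C).trans (by exact_mod_cast le_max_right _ _))
  obtain ⟨ρ, hρ0, hρr⟩ := ENNReal.lt_iff_exists_nnreal_btwn.1 hp.r_pos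
  have hρpos : 0 < ρ := by exact_mod_cast hρ0
  -- the maps `T t` have norm at most `K`, so the new series converges on the ball of radius `ρ / K`
  set r' : NNReal := ρ / K with hr'
  have hK0 : (0 : NNReal) < K := lt_of_lt_of_le one_pos hK1
  have hKr : K * r' = ρ := by rw [hr']; field_simp
  have hr'pos : 0 < r' := by rw [hr']; positivity
  have hsum : Summable fun n => ‖p n‖ * (ρ : ℝ) ^ n :=
    p.summable_norm_mul_pow (lt_of_lt_of_le hρr hp.r_le)
  -- the coefficients of the expansion of `F (a + T t (y - a))`
  let G : ∀ n, ℝ → ContinuousMultilinearMap ℂ (fun _ : Fin n => V) ℂ := fun n t =>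
    (p n).compContinuousLinearMap (fun _ => T t)
  have hGc : ∀ n, Continuous (G n) := fun n => by
    have h1 : Continuous fun t : ℝ =>
        ContinuousMultilinearMap.compContinuousLinearMapContinuousMultilinear ℂ
          (fun _ : Fin n => V) (fun _ : Fin n => V) ℂ (fun _ => T t) :=
      (ContinuousMultilinearMap.cont _).comp (continuous_pi fun _ => hT)
    exact h1.clm_apply continuous_const
  have hGn : ∀ n, ∀ t ∈ Set.Icc (0 : ℝ) 1, ‖G n t‖ ≤ ‖p n‖ * (K : ℝ) ^ n := fun n t ht => by
    refine ((p n).norm_compContinuousLinearMap_le _).trans ?_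
    rw [Finset.prod_const, Finset.card_univ, Fintype.card_fin]
    gcongr
    exact hTK t ht
  have hsub : Set.uIoc (0 : ℝ) 1 ⊆ Set.Icc 0 1 := by
    rw [Set.uIoc_of_le zero_le_one]; exact Set.Ioc_subset_Icc_self
  let Q : FormalMultilinearSeries ℂ V ℂ := fun n => ∫ t in (0 : ℝ)..1, G n t
  refine ⟨Q, r', ?_, by exact_mod_cast hr'pos, ?_⟩
  · obtain ⟨B, hB⟩ := hsum.tendsto_atTop_zero.bddAbove_range
    refine Q.le_radius_of_bound B fun n => ?_
    have h1 : ‖Q n‖ ≤ ‖p n‖ * (K : ℝ) ^ n := by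
      have := intervalIntegral.norm_integral_le_of_norm_le_const (a := (0 : ℝ)) (b := 1)
        (f := G n) (C := ‖p n‖ * (K : ℝ) ^ n) fun t ht => hGn n t (hsub ht)
      simpa using this
    have h2 : ‖Q n‖ * (r' : ℝ) ^ n ≤ ‖p n‖ * (ρ : ℝ) ^ n := by
      rw [← hKr]
      push_cast
      rw [mul_pow, ← mul_assoc]
      gcongr
    exact h2.trans (hB ⟨n, rfl⟩)
  · intro y hy
    have hy' : ‖y‖ < r' := by simpa [enorm, ← NNReal.coe_lt_coe] using hy
    have hQ : ∀ n, Q n (fun _ => y) = ∫ t in (0 : ℝ)..1, G n t (fun _ => y) := fun n => by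
      simp only [Q, intervalIntegral.integral_of_le zero_le_one]
      exact ContinuousMultilinearMap.integral_apply
        ((hGc n).intervalIntegrable 0 1).1 _
    simp only [hQ, add_sub_cancel_left]
    have hbd : ∀ n, ∀ t ∈ Set.Icc (0 : ℝ) 1, ‖G n t fun _ => y‖ ≤ ‖p n‖ * (ρ : ℝ) ^ n :=
      fun n t ht => by
        refine ((G n t).le_opNorm _).trans ?_
        rw [Finset.prod_const, Finset.card_univ, Fintype.card_fin, ← hKr]
        push_cast
        rw [mul_pow, ← mul_assoc]
        gcongr
        exact hGn n t ht
    refine intervalIntegral.hasSum_integral_of_dominated_convergence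
      (fun n _ => ‖p n‖ * (ρ : ℝ) ^ n) (fun n => ?_) (fun n => ?_) ?_ ?_ ?_
    · exact ((ContinuousMultilinearMap.apply ℂ (fun _ : Fin n => V) ℂ
        (fun _ => y)).continuous.comp (hGc n)).aestronglyMeasurable
    · exact Eventually.of_forall fun t ht => hbd n t (hsub ht)
    · exact Eventually.of_forall fun t _ => hsum
    · exact continuous_const.intervalIntegrable _ _
    · refine Eventually.of_forall fun t ht => ?_
      have h1 : T t y ∈ Metric.eball (0 : V) r := by
        have h2 : ‖T t y‖ < ρ := by
          calc ‖T t y‖ ≤ ‖T t‖ * ‖y‖ := (T t).le_opNorm y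
            _ ≤ K * ‖y‖ := by gcongr; exact hTK t (hsub ht)
            _ < K * r' := by gcongr
            _ = ρ := by exact_mod_cast hKr
        have h3 : (‖T t y‖₊ : ENNReal) < ρ := by exact_mod_cast h2
        simpa [enorm] using h3.trans hρr
      exact hp.hasSum h1

/-- An analytic function that vanishes on the hyperplane `ℓ = 0` is divisible by `ℓ`; the quotient
is `∫₀¹ Df(y - t ℓ(y) e) e dt`. -/
theorem exists_analyticAt_eq_mul {f : V → ℂ} {a : V} (hf : AnalyticAt ℂ f a) (ℓ : V →L[ℂ] ℂ)
    {e : V} (he : ℓ e = 1) (ha : ℓ a = 0) (h0 : ∀ᶠ y in 𝓝 a, ℓ y = 0 → f y = 0) :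
    ∃ q : V → ℂ, AnalyticAt ℂ q a ∧ ∀ᶠ y in 𝓝 a, f y = ℓ y * q y := by
  let T : ℝ → V →L[ℂ] V := fun t =>
    ContinuousLinearMap.id ℂ V - (t : ℂ) • ℓ.smulRight e
  have hT : Continuous T := by fun_prop
  have hTa : ∀ t y, a + T t (y - a) = y - ((t : ℂ) * ℓ y) • e := fun t y => by
    simp only [T, sub_apply, ContinuousLinearMap.id_apply,
      smul_apply, ContinuousLinearMap.smulRight_apply, map_sub, ha,
      smul_smul, zero_smul, smul_zero, sub_zero]
    abel
  let F : V → ℂ := fun y => fderiv ℂ f y e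
  have hF : AnalyticAt ℂ F a :=
    (ContinuousLinearMap.apply ℂ ℂ e).analyticAt _ |>.comp hf.fderiv
  refine ⟨fun y => ∫ t in (0 : ℝ)..1, F (a + T t (y - a)),
    analyticAt_intervalIntegral_comp_linear hF hT, ?_⟩
  have hev : ∀ᶠ y in 𝓝 a, AnalyticAt ℂ f y ∧ AnalyticAt ℂ F y ∧ (ℓ y = 0 → f y = 0) := by
    filter_upwards [hf.eventually_analyticAt, hF.eventually_analyticAt, h0] with y h1 h2 h3
    exact ⟨h1, h2, h3⟩
  -- the whole segment from `y` to its projection to the hyperplane stays in this neighbourhood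
  have hseg : ∀ᶠ y in 𝓝 a, ∀ t ∈ Set.Icc (0 : ℝ) 1, AnalyticAt ℂ f (y - ((t : ℂ) * ℓ y) • e) ∧
      AnalyticAt ℂ F (y - ((t : ℂ) * ℓ y) • e) ∧
      (ℓ (y - ((t : ℂ) * ℓ y) • e) = 0 → f (y - ((t : ℂ) * ℓ y) • e) = 0) := by
    refine isCompact_Icc.eventually_forall_of_forall_eventually fun t _ => ?_
    have hc : ContinuousAt (fun z : V × ℝ => z.1 - ((z.2 : ℂ) * ℓ z.1) • e) (a, t) := by fun_prop
    have h1 : (fun z : V × ℝ => z.1 - ((z.2 : ℂ) * ℓ z.1) • e) (a, t) = a := by simp [ha]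
    exact hc.eventually (by rw [h1]; exact hev)
  filter_upwards [hseg] with y hy
  simp only [hTa]
  have hd : ∀ t ∈ Set.uIcc (0 : ℝ) 1, HasDerivAt (fun t : ℝ => f (y - ((t : ℂ) * ℓ y) • e))
      (-(ℓ y * F (y - ((t : ℂ) * ℓ y) • e))) t := fun t ht => by
    rw [Set.uIcc_of_le zero_le_one] at ht
    have h1 : HasDerivAt (fun t : ℂ => y - (t * ℓ y) • e) (-(ℓ y • e)) (t : ℂ) := by
      have := (((hasDerivAt_id (t : ℂ)).mul_const (ℓ y)).smul_const e).const_sub y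
      simpa using this
    have h2 := ((hy t ht).1.differentiableAt.hasFDerivAt.comp_hasDerivAt (t : ℂ) h1).comp_ofReal
    simpa [F] using h2
  have hcont : IntervalIntegrable (fun t : ℝ => -(ℓ y * F (y - ((t : ℂ) * ℓ y) • e)))
      MeasureTheory.volume 0 1 := by
    refine ContinuousOn.intervalIntegrable fun t ht => ?_
    rw [Set.uIcc_of_le zero_le_one] at ht
    have h1 : ContinuousAt (fun t : ℝ => y - ((t : ℂ) * ℓ y) • e) t := by fun_prop
    exact ((continuousAt_const.mul
      (ContinuousAt.comp (g := F) (f := fun t : ℝ => y - ((t : ℂ) * ℓ y) • e)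
        (hy t ht).2.1.continuousAt h1)).neg).continuousWithinAt
  -- integrate the derivative from `f y` to the value `0` at the projection of `y`
  have hint := intervalIntegral.integral_eq_sub_of_hasDerivAt hd hcont
  have h1 := (hy 1 ⟨zero_le_one, le_rfl⟩).2.2 (by simp [he])
  rw [intervalIntegral.integral_neg, intervalIntegral.integral_const_mul, h1] at hint
  simp only [Complex.ofReal_zero, zero_mul, zero_smul, sub_zero, zero_sub, neg_inj] at hint
  exact hint.symm

/-- The ring of germs of analytic functions is a domain. -/
theorem exists_eventuallyEq_zero_of_prod {ι : Type*} (s : Finset ι) {f : ι → V → ℂ} {a : V}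
    (hf : ∀ i ∈ s, AnalyticAt ℂ (f i) a) (h : ∀ᶠ y in 𝓝 a, ∏ i ∈ s, f i y = 0) :
    ∃ i ∈ s, ∀ᶠ y in 𝓝 a, f i y = 0 := by
  classical
  induction s using Finset.induction_on with
  | empty => simpa using h.self_of_nhds
  | insert j s hj ih =>
    have hfj := hf j (Finset.mem_insert_self _ _)
    have hfs : AnalyticAt ℂ (fun y => ∏ i ∈ s, f i y) a :=
      Finset.analyticAt_fun_prod _ fun i hi => hf i (Finset.mem_insert_of_mem hi)
    obtain ⟨ε, hε, hball⟩ := Metric.eventually_nhds_iff_ball.1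
      ((hfj.eventually_analyticAt.and hfs.eventually_analyticAt).and h)
    by_cases h0 : ∀ y ∈ Metric.ball a ε, f j y = 0
    · exact ⟨j, Finset.mem_insert_self _ _,
        Filter.eventually_of_mem (Metric.ball_mem_nhds a hε) h0⟩
    · push Not at h0
      obtain ⟨w, hw, hw0⟩ := h0
      have h1 : ∀ᶠ y in 𝓝 w, ∏ i ∈ s, f i y = 0 := by
        filter_upwards [(hball w hw).1.1.continuousAt.eventually_ne hw0,
          Metric.isOpen_ball.mem_nhds hw] with y hy hyb
        have := (hball y hyb).2
        rw [Finset.prod_insert hj] at this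
        exact (mul_eq_zero.1 this).resolve_left hy
      have h2 := AnalyticOnNhd.eqOn_zero_of_preconnected_of_eventuallyEq_zero
        (f := fun y => ∏ i ∈ s, f i y) (U := Metric.ball a ε)
        (fun y hy => (hball y hy).1.2) (convex_ball a ε).isPreconnected hw h1
      obtain ⟨i, hi, hi'⟩ := ih (fun i hi => hf i (Finset.mem_insert_of_mem hi))
        (Filter.eventually_of_mem (Metric.ball_mem_nhds a hε) h2)
      exact ⟨i, Finset.mem_insert_of_mem hi, hi'⟩

end SeveralVariables

section Coordinates

variable {n : ℕ}

/-- If `p` vanishes at `a`, but not off the coordinate hyperplanes `y j = 0`, `j ∈ J`, then it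
vanishes on one of them. Otherwise `p` would have no zero on some line `w + t (1, …, 1)` with `w`
close to `a`, and the maximum principle for `1 / p` on a disc in this line would bound `p w` away
from `0`. -/
theorem exists_forall_eq_zero_of_ne_zero_off {p : (Fin n → ℂ) → ℂ} {a : Fin n → ℂ}
    (hp : AnalyticAt ℂ p a) (J : Finset (Fin n)) (hJ : ∀ j ∈ J, a j = 0)
    (hne : ∀ᶠ y in 𝓝 a, (∀ j ∈ J, y j ≠ 0) → p y ≠ 0) (h0 : p a = 0) :
    ∃ j ∈ J, ∀ᶠ y in 𝓝 a, y j = 0 → p y = 0 := by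
  -- the projection to the hyperplane `y j = 0` in the direction `(1, …, 1)`
  let π : Fin n → (Fin n → ℂ) → Fin n → ℂ := fun j y => y - y j • 1
  have hπa : ∀ j ∈ J, π j a = a := fun j hj => by simp [π, hJ j hj]
  have hπ : ∀ j ∈ J, AnalyticAt ℂ (fun y => p (π j y)) a := fun j hj => by
    have h1 : AnalyticAt ℂ (π j) a :=
      (ContinuousLinearMap.id ℂ (Fin n → ℂ) -
        (ContinuousLinearMap.proj (R := ℂ) (φ := fun _ : Fin n => ℂ) j).smulRight 1).analyticAt a
    exact AnalyticAt.comp (by rw [hπa j hj]; exact hp) h1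
  suffices h : ∀ᶠ w in 𝓝 a, ∏ j ∈ J, p (π j w) = 0 by
    obtain ⟨j, hj, hj'⟩ := exists_eventuallyEq_zero_of_prod J hπ h
    refine ⟨j, hj, ?_⟩
    filter_upwards [hj'] with y hy hyj
    simpa [π, hyj] using hy
  obtain ⟨ε, hε, hball⟩ := Metric.eventually_nhds_iff_ball.1 (hp.eventually_analyticAt.and hne)
  have hline : ∀ r : ℝ, 0 ≤ r → ∀ w ∈ Metric.ball a (ε - r), ∀ t : ℂ, ‖t‖ ≤ r →
      w + t • 1 ∈ Metric.ball a ε := fun r hr w hw t ht => by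
    rw [Metric.mem_ball, dist_eq_norm] at hw ⊢
    have h1 : ‖t • (1 : Fin n → ℂ)‖ ≤ r := by
      refine (pi_norm_le_iff_of_nonneg hr).2 fun i => by simpa using ht
    calc ‖w + t • 1 - a‖ = ‖(w - a) + t • 1‖ := by congr 1; abel
      _ ≤ ‖w - a‖ + ‖t • (1 : Fin n → ℂ)‖ := norm_add_le _ _
      _ < ε := by linarith
  set r := ε / 2 with hr
  have hr0 : 0 < r := by positivity
  have hεr : ε - r = r := by rw [hr]; ring
  have hcirc : ∀ t ∈ Metric.sphere (0 : ℂ) r, p (a + t • 1) ≠ 0 := fun t ht => by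
    have ht' : ‖t‖ = r := by simpa using ht
    refine (hball _ (hline r hr0.le a (Metric.mem_ball_self (by rw [hεr]; exact hr0)) t ht'.le)).2
      fun j hj => ?_
    have : t ≠ 0 := by rintro rfl; simp at ht'; linarith
    simpa [hJ j hj] using this
  have hpc : ∀ t : ℂ, ‖t‖ ≤ r → ∀ w ∈ Metric.ball a r,
      ContinuousAt (fun z : (Fin n → ℂ) × ℂ => p (z.1 + z.2 • 1)) (w, t) := fun t ht w hw => by
    refine ContinuousAt.comp (g := p) (f := fun z : (Fin n → ℂ) × ℂ => z.1 + z.2 • 1) ?_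
      (by fun_prop)
    exact (hball _ (hline r hr0.le w (by rw [hεr]; exact hw) t ht)).1.continuousAt
  have haball : a ∈ Metric.ball a r := Metric.mem_ball_self hr0
  obtain ⟨δ, hδ, hδ'⟩ : ∃ δ > 0, ∀ t ∈ Metric.sphere (0 : ℂ) r, δ < ‖p (a + t • 1)‖ := by
    have hcn : ContinuousOn (fun t : ℂ => ‖p (a + t • 1)‖) (Metric.sphere 0 r) := fun t ht => by
      have ht' : ‖t‖ = r := by simpa using ht
      exact (((hpc t ht'.le a haball).comp (f := fun t : ℂ => (a, t))
        (by fun_prop)).norm).continuousWithinAt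
    obtain ⟨t₀, ht₀, hmin⟩ := (isCompact_sphere (0 : ℂ) r).exists_isMinOn
      (NormedSpace.sphere_nonempty.2 hr0.le) hcn
    refine ⟨‖p (a + t₀ • 1)‖ / 2, half_pos (norm_pos_iff.2 (hcirc t₀ ht₀)), fun t ht => ?_⟩
    have h1 : ‖p (a + t₀ • 1)‖ ≤ ‖p (a + t • 1)‖ := hmin ht
    have h2 := norm_pos_iff.2 (hcirc t₀ ht₀)
    linarith
  have hunif : ∀ᶠ w in 𝓝 a, ∀ t ∈ Metric.sphere (0 : ℂ) r, δ < ‖p (w + t • 1)‖ := by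
    refine (isCompact_sphere (0 : ℂ) r).eventually_forall_of_forall_eventually fun t ht => ?_
    have ht' : ‖t‖ = r := by simpa using ht
    exact (hpc t ht'.le a haball).norm.eventually (lt_mem_nhds (hδ' t ht))
  have hsmall : ∀ᶠ w in 𝓝 a, ‖p w‖ < δ :=
    hp.continuousAt.norm.eventually (gt_mem_nhds (by simpa [h0] using hδ))
  filter_upwards [hunif, hsmall, Metric.ball_mem_nhds a hr0] with w hw hws hwb
  -- if no `p (π j w)` vanishes, then `p` has no zero on the disc of radius `r` in the line through
  -- `w`
  by_contra hprod
  have hnz : ∀ t : ℂ, ‖t‖ ≤ r → p (w + t • 1) ≠ 0 := fun t ht hzero => by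
    have hb := (hball _ (hline r hr0.le w (by rw [hεr]; exact hwb) t ht)).2
    by_cases hall : ∀ j ∈ J, (w + t • (1 : Fin n → ℂ)) j ≠ 0
    · exact hb hall hzero
    · push Not at hall
      obtain ⟨j, hj, hj0⟩ := hall
      have htj : t = -w j := by
        simp only [Pi.add_apply, Pi.smul_apply, Pi.one_apply, smul_eq_mul, mul_one] at hj0
        linear_combination hj0
      refine hprod (Finset.prod_eq_zero hj ?_)
      rw [← hzero, htj]
      simp [π, sub_eq_add_neg]
  have hd : DiffContOnCl ℂ (fun t : ℂ => (p (w + t • 1))⁻¹) (Metric.ball 0 r) := by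
    refine DifferentiableOn.diffContOnCl fun t ht => ?_
    rw [closure_ball _ hr0.ne', mem_closedBall_zero_iff] at ht
    have hpd := (hball _ (hline r hr0.le w (by rw [hεr]; exact hwb) t ht)).1.differentiableAt
    exact ((hpd.comp (f := fun t : ℂ => w + t • (1 : Fin n → ℂ)) t (by fun_prop)).inv
      (hnz t ht)).differentiableWithinAt
  have hmax := Complex.norm_le_of_forall_mem_frontier_norm_le Metric.isBounded_ball hd
    (C := δ⁻¹) (fun t ht => ?_) (subset_closure (Metric.mem_ball_self hr0))
  · simp only [zero_smul, add_zero, norm_inv] at hmax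
    have hw0 : 0 < ‖p w‖ := norm_pos_iff.2 (by simpa using hnz 0 (by simpa using hr0.le))
    rw [inv_le_inv₀ hw0 hδ] at hmax
    linarith
  · rw [frontier_ball _ hr0.ne'] at ht
    rw [norm_inv]
    exact inv_anti₀ hδ (hw t ht).le

/-- An analytic germ without zeros off the coordinate hyperplanes `y j = 0`, `j ∈ J`, is a unit
times a monomial in the coordinates `y j`, `j ∈ J`. -/
theorem exists_eq_mul_prod_pow {p : (Fin n → ℂ) → ℂ} {a : Fin n → ℂ}
    (hp : AnalyticAt ℂ p a) (J : Finset (Fin n)) (hJ : ∀ j ∈ J, a j = 0)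
    (hne : ∀ᶠ y in 𝓝 a, (∀ j ∈ J, y j ≠ 0) → p y ≠ 0) :
    ∃ (m : Fin n → ℕ) (u : (Fin n → ℂ) → ℂ), AnalyticAt ℂ u a ∧ u a ≠ 0 ∧
      ∀ᶠ y in 𝓝 a, p y = u y * ∏ j ∈ J, y j ^ m j := by
  classical
  let d : ℂ → Fin n → ℂ := fun t => a + t • 1
  have hd : AnalyticAt ℂ d 0 := by fun_prop
  have hd0 : d 0 = a := by simp [d]
  have hdc : Tendsto d (𝓝[≠] 0) (𝓝 a) := by
    have := hd.continuousAt.tendsto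
    rw [hd0] at this
    exact this.mono_left nhdsWithin_le_nhds
  -- induction on the order of vanishing of `p` along the diagonal line through `a`
  have hfin : analyticOrderAt (p ∘ d) 0 ≠ ⊤ := fun htop => by
    have h1 := (analyticOrderAt_eq_top.1 htop).filter_mono (nhdsWithin_le_nhds (s := {0}ᶜ))
    obtain ⟨t, h1, h2, h3⟩ :=
      (h1.and ((hdc.eventually hne).and (self_mem_nhdsWithin (s := {(0 : ℂ)}ᶜ)))).exists
    exact h2 (fun j hj => by simpa [d, hJ j hj] using h3) h1
  obtain ⟨N, hN⟩ := ENat.ne_top_iff_exists.1 hfin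
  induction N generalizing p with
  | zero =>
    have h1 : p a ≠ 0 := by
      have h2 : AnalyticAt ℂ (p ∘ d) 0 := AnalyticAt.comp (by rwa [hd0]) hd
      have := h2.analyticOrderAt_eq_zero.1 hN.symm
      rwa [Function.comp_apply, hd0] at this
    exact ⟨0, p, hp, h1, by simp⟩
  | succ N ih =>
    have h0 : p a = 0 := by
      by_contra h0
      have h2 : AnalyticAt ℂ (p ∘ d) 0 := AnalyticAt.comp (by rwa [hd0]) hd
      rw [h2.analyticOrderAt_eq_zero.2 (by rwa [Function.comp_apply, hd0])] at hN
      simp at hN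
    obtain ⟨j, hj, hj0⟩ := exists_forall_eq_zero_of_ne_zero_off hp J hJ hne h0
    obtain ⟨q, hq, hpq⟩ := exists_analyticAt_eq_mul hp
      (ContinuousLinearMap.proj (R := ℂ) (φ := fun _ : Fin n => ℂ) j) (e := Pi.single j 1)
      (by simp) (hJ j hj) (by simpa using hj0)
    simp only [ContinuousLinearMap.proj_apply] at hpq
    have hqd : AnalyticAt ℂ (q ∘ d) 0 := AnalyticAt.comp (by rwa [hd0]) hd
    have hord : analyticOrderAt (p ∘ d) 0 = 1 + analyticOrderAt (q ∘ d) 0 := by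
      have h1 : p ∘ d =ᶠ[𝓝 0] id * (q ∘ d) := by
        have h2 := hd.continuousAt.tendsto
        rw [hd0] at h2
        filter_upwards [h2.eventually hpq] with t ht
        simp [ht, d, hJ j hj]
      rw [analyticOrderAt_congr h1, analyticOrderAt_mul analyticAt_id hqd]
      congr 1
      exact analyticOrderAt_id
    obtain ⟨m, u, hu, hua, hqu⟩ := ih hq
      (by
        filter_upwards [hne, hpq] with y h1 h2 h3 h4
        exact h1 h3 (by rw [h2, h4, mul_zero]))
      (fun h => hfin (by rw [hord, h]; rfl))
      (by
        rw [hord] at hN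
        push_cast at hN
        rw [add_comm] at hN
        exact (ENat.add_right_injective_of_ne_top ENat.one_ne_top) hN)
    refine ⟨m + (Pi.single j 1 : Fin n → ℕ), u, hu, hua, ?_⟩
    filter_upwards [hpq, hqu] with y h1 h2
    have h3 : ∏ i ∈ J, y i ^ (m + (Pi.single j 1 : Fin n → ℕ)) i = (∏ i ∈ J, y i ^ m i) * y j := by
      simp only [Pi.add_apply, pow_add, Finset.prod_mul_distrib]
      congr 1
      rw [Finset.prod_eq_single_of_mem j hj fun i _ hij => by simp [Pi.single_eq_of_ne hij]]
      simp
    rw [h1, h2, h3]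
    ring

end Coordinates

/-! ### Adapted coordinates -/

/-- `f` is holomorphic near `x`. -/
abbrev HolAt (n : ℕ) {X : Type*} [TopologicalSpace X] [ChartedSpace (Fin n → ℂ) X]
    (f : X → ℂ) (x : X) : Prop :=
  ContMDiffAt 𝓘(ℂ, Fin n → ℂ) 𝓘(ℂ, ℂ) ω f x

namespace SNCDivisor

variable {n : ℕ} {X : Type u} [TopologicalSpace X] [ChartedSpace (Fin n → ℂ) X]
  (D : SNCDivisor.{u, v} n X)

/-- The components of `D` through `p`. -/
abbrev Through (p : X) : Type v := {i // p ∈ D.comp i}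

/-- A chart at `p` in which the components of `D` through `p` are coordinate hyperplanes. -/
def loc (p : X) : OpenPartialHomeomorph X (Fin n → ℂ) := (D.exists_chart p).choose

/-- The coordinates of `D.loc p` that define the components of `D` through `p`. -/
def idx (p : X) : D.Through p → Fin n := (D.exists_chart p).choose_spec.2.2.choose

theorem loc_mem_maximalAtlas (p : X) :
    D.loc p ∈ IsManifold.maximalAtlas 𝓘(ℂ, Fin n → ℂ) ω X :=
  (D.exists_chart p).choose_spec.1

theorem mem_loc_source (p : X) : p ∈ (D.loc p).source := (D.exists_chart p).choose_spec.2.1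

theorem idx_injective (p : X) : Function.Injective (D.idx p) :=
  (D.exists_chart p).choose_spec.2.2.choose_spec.1

theorem mem_comp_iff_loc (p : X) (i : D.ι) (y : X) (hy : y ∈ (D.loc p).source) :
    y ∈ D.comp i ↔ ∃ h : p ∈ D.comp i, D.loc p y (D.idx p ⟨i, h⟩) = 0 :=
  (D.exists_chart p).choose_spec.2.2.choose_spec.2 i y hy

instance finite_comp (p : X) : Finite (D.Through p) :=
  Finite.of_injective _ (D.idx_injective p)

instance fintypeComp (p : X) : Fintype (D.Through p) := Fintype.ofFinite _

/-- The domain of the chart `D.loc p`. -/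
def dom (p : X) : Opens X := ⟨(D.loc p).source, (D.loc p).open_source⟩

theorem mem_dom_self (p : X) : p ∈ D.dom p := D.mem_loc_source p

theorem mem_of_mem_dom {p y : X} (hy : y ∈ D.dom p) {i : D.ι} (hi : y ∈ D.comp i) :
    p ∈ D.comp i :=
  ((D.mem_comp_iff_loc p i y hy).1 hi).1

open Classical in
/-- The coordinate of `D.loc p` that defines `D i`, or `1` if `p` is not in `D i`: in either case
a defining function of `D i` on `D.dom p`. -/
def zeta (p : X) (i : D.ι) (x : X) : ℂ :=
  if h : p ∈ D.comp i then D.loc p x (D.idx p ⟨i, h⟩) else 1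

theorem zeta_of_mem {p : X} {i : D.ι} (h : p ∈ D.comp i) (x : X) :
    D.zeta p i x = D.loc p x (D.idx p ⟨i, h⟩) := dif_pos h

theorem zeta_of_notMem {p : X} {i : D.ι} (h : p ∉ D.comp i) (x : X) : D.zeta p i x = 1 :=
  dif_neg h

theorem zeta_eq_zero_iff {p y : X} (hy : y ∈ D.dom p) (i : D.ι) :
    D.zeta p i y = 0 ↔ y ∈ D.comp i := by
  rw [D.mem_comp_iff_loc p i y hy]
  by_cases h : p ∈ D.comp i
  · simp [D.zeta_of_mem h, h]
  · simp [D.zeta_of_notMem h, h]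

theorem notMem_support {x : X} : x ∉ D.support ↔ ∀ i, x ∉ D.comp i := by
  simp [support]

/-- The monomial with exponents `m` in the coordinates that define `D` on `D.dom p`. -/
def mono (p : X) (m : D.Through p → ℤ) (x : X) : ℂ := ∏ i : D.Through p, D.zeta p i x ^ m i

theorem mono_ne_zero {p y : X} (hy : y ∈ D.dom p) (hD : y ∉ D.support)
    (m : D.Through p → ℤ) : D.mono p m y ≠ 0 :=
  Finset.prod_ne_zero_iff.2 fun i _ => zpow_ne_zero _ fun h =>
    D.notMem_support.1 hD i ((D.zeta_eq_zero_iff hy i).1 h)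

theorem mono_add {p y : X} (hy : y ∈ D.dom p) (hD : y ∉ D.support)
    (m m' : D.Through p → ℤ) : D.mono p (m + m') y = D.mono p m y * D.mono p m' y := by
  simp only [mono, ← Finset.prod_mul_distrib]
  refine Finset.prod_congr rfl fun i _ => zpow_add₀ (fun h => ?_) (m i) (m' i)
  exact D.notMem_support.1 hD i ((D.zeta_eq_zero_iff hy i).1 h)

theorem mono_neg (p y : X) (m : D.Through p → ℤ) :
    D.mono p (-m) y = (D.mono p m y)⁻¹ := by
  simp [mono, Finset.prod_inv_distrib]

@[simp] theorem mono_zero (p y : X) : D.mono p 0 y = 1 := by simp [mono]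

/-- The line through `x` with direction `v`, in the chart `D.loc x`. -/
def line (x : X) (v : Fin n → ℂ) (t : ℂ) : X := (D.loc x).symm (D.loc x x + t • v)

theorem tendsto_line_aux (x : X) (v : Fin n → ℂ) :
    Tendsto (D.line x v) (𝓝 0) (𝓝 x) ∧
      ∀ᶠ t in 𝓝 (0 : ℂ), D.line x v t ∈ D.dom x ∧ D.loc x (D.line x v t) = D.loc x x + t • v := by
  have h1 : ContinuousAt (fun t : ℂ => D.loc x x + t • v) 0 := by fun_prop
  have h1' : Tendsto (fun t : ℂ => D.loc x x + t • v) (𝓝 0) (𝓝 (D.loc x x)) := by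
    simpa using h1.tendsto
  have h2 := (D.loc x).continuousAt_symm ((D.loc x).map_source (D.mem_loc_source x))
  refine ⟨?_, ?_⟩
  · have h3 := h2.tendsto.comp h1'
    rwa [(D.loc x).left_inv (D.mem_loc_source x)] at h3
  · filter_upwards [h1'.eventually ((D.loc x).open_target.mem_nhds
      ((D.loc x).map_source (D.mem_loc_source x)))] with t ht
    exact ⟨(D.loc x).map_target ht, (D.loc x).right_inv ht⟩

/-- Along a line through `x`, the coordinates that define `D` are linear in the parameter. -/
theorem zeta_line (x : X) (v : Fin n → ℂ) :
    ∀ᶠ t in 𝓝 (0 : ℂ), D.line x v t ∈ D.dom x ∧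
      ∀ i : D.Through x, D.zeta x i (D.line x v t) = t * v (D.idx x i) := by
  filter_upwards [(D.tendsto_line_aux x v).2] with t ht
  refine ⟨ht.1, fun i => ?_⟩
  have h0 : D.loc x x (D.idx x i) = 0 := by
    rw [← D.zeta_of_mem i.2, D.zeta_eq_zero_iff (D.mem_dom_self x)]
    exact i.2
  rw [D.zeta_of_mem i.2, ht.2]
  simp [h0]

/-- A line with a generic direction leaves `D` at once. -/
theorem tendsto_line (x : X) {v : Fin n → ℂ} (hv : ∀ j, v j ≠ 0) :
    Tendsto (D.line x v) (𝓝[≠] 0) (𝓝[D.supportᶜ] x) := by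
  refine tendsto_nhdsWithin_iff.2
    ⟨(D.tendsto_line_aux x v).1.mono_left nhdsWithin_le_nhds, ?_⟩
  filter_upwards [(D.zeta_line x v).filter_mono nhdsWithin_le_nhds,
    self_mem_nhdsWithin (s := {(0 : ℂ)}ᶜ)] with t ht ht0
  refine D.notMem_support.2 fun i hi => ?_
  have h1 := D.mem_of_mem_dom ht.1 hi
  have h2 := ht.2 ⟨i, h1⟩
  rw [(D.zeta_eq_zero_iff ht.1 i).2 hi] at h2
  exact mul_ne_zero ht0 (hv _) h2.symm

/-- The complement of `D` is dense. -/
instance neBot_compl_support (x : X) : (𝓝[D.supportᶜ] x).NeBot :=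
  (D.tendsto_line x (v := 1) (fun _ => one_ne_zero)).neBot

/-- If a monomial has a nonzero limit at `x` then it is trivial. To find the exponent at one
coordinate, compare two lines whose directions differ by a factor `2` in this coordinate. -/
theorem eq_zero_of_tendsto_mono {x : X} {m : D.Through x → ℤ} {c : ℂ} (hc : c ≠ 0)
    (h : Tendsto (D.mono x m) (𝓝[D.supportᶜ] x) (𝓝 c)) : m = 0 := by
  classical
  funext i
  let v : Fin n → ℂ := Function.update 1 (D.idx x i) 2
  have hv : ∀ j, v j ≠ 0 := fun j => by
    by_cases hj : j = D.idx x i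
    · subst hj; simp [v]
    · simp [v, Function.update_of_ne hj]
  have h1 := h.comp (D.tendsto_line x (v := 1) (fun _ => one_ne_zero))
  have h2 := h.comp (D.tendsto_line x hv)
  have h3 := h2.div h1 hc
  rw [div_self hc] at h3
  have h4 : ∀ᶠ t in 𝓝[≠] (0 : ℂ),
      (2 : ℂ) ^ m i = (D.mono x m ∘ D.line x v) t / (D.mono x m ∘ D.line x 1) t := by
    filter_upwards [(D.zeta_line x v).filter_mono nhdsWithin_le_nhds,
      (D.zeta_line x 1).filter_mono nhdsWithin_le_nhds,
      self_mem_nhdsWithin (s := {(0 : ℂ)}ᶜ)] with t hv1 h11 ht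
    have ht0 : t ≠ 0 := ht
    simp only [Function.comp_apply, mono, ← Finset.prod_div_distrib]
    rw [Finset.prod_eq_single_of_mem i (Finset.mem_univ _)]
    · rw [hv1.2, h11.2, ← div_zpow]
      simp [v, ht0]
    · intro j _ hj
      have hij : D.idx x j ≠ D.idx x i := fun h => hj (D.idx_injective x h)
      rw [hv1.2, h11.2, ← div_zpow]
      simp [v, Function.update_of_ne hij, ht0]
  have h5 : (2 : ℂ) ^ m i = 1 := tendsto_nhds_unique
    ((tendsto_congr' h4).1 tendsto_const_nhds) h3
  -- compare absolute values, as the complex number `2` is not ordered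
  have h6 : (2 : ℝ) ^ m i = 1 := by
    have := congrArg norm h5
    simpa using this
  simpa using (zpow_eq_one_iff_right₀ (zero_le_two (α := ℝ)) (by norm_num)).1 h6

/-! ### Divisibility along the components of `D` -/

theorem holAt_comp_loc {p x : X} (hx : x ∈ D.dom p) {g : (Fin n → ℂ) → ℂ}
    (hg : AnalyticAt ℂ g (D.loc p x)) : HolAt n (fun y => g (D.loc p y)) x := by
  have h1 := contMDiffAt_of_mem_maximalAtlas (D.loc_mem_maximalAtlas p) hx
  exact (ContMDiffAt.comp (g := g) x hg.contDiffAt.contMDiffAt h1)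

theorem analyticAt_comp_loc_symm {p x : X} (hx : x ∈ D.dom p) {f : X → ℂ} (hf : HolAt n f x) :
    AnalyticAt ℂ (fun z => f ((D.loc p).symm z)) (D.loc p x) := by
  have h1 := contMDiffAt_symm_of_mem_maximalAtlas (D.loc_mem_maximalAtlas p)
    ((D.loc p).map_source hx)
  have h2 : HolAt n f ((D.loc p).symm (D.loc p x)) := by rwa [(D.loc p).left_inv hx]
  exact (contMDiffAt_iff_contDiffAt.1 (ContMDiffAt.comp (D.loc p x) h2 h1)).analyticAt

theorem eventually_loc {p x : X} (hx : x ∈ D.dom p) {P : (Fin n → ℂ) → Prop}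
    (h : ∀ᶠ z in 𝓝 (D.loc p x), P z) : ∀ᶠ y in 𝓝 x, y ∈ D.dom p ∧ P (D.loc p y) :=
  Filter.Eventually.and ((D.dom p).isOpen.mem_nhds hx) (((D.loc p).continuousAt hx).eventually h)

theorem eventually_loc_symm {p x : X} (hx : x ∈ D.dom p) {P : X → Prop}
    (h : ∀ᶠ y in 𝓝 x, P y) :
    ∀ᶠ z in 𝓝 (D.loc p x), z ∈ (D.loc p).target ∧ P ((D.loc p).symm z) := by
  have h1 := (D.loc p).continuousAt_symm ((D.loc p).map_source hx)
  rw [ContinuousAt, (D.loc p).left_inv hx] at h1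
  exact Filter.Eventually.and
    ((D.loc p).open_target.mem_nhds ((D.loc p).map_source hx)) (h1.eventually h)

theorem holAt_zeta {p x : X} (hx : x ∈ D.dom p) (i : D.ι) : HolAt n (D.zeta p i) x := by
  by_cases h : p ∈ D.comp i
  · have h1 : D.zeta p i = fun y => (fun z : Fin n → ℂ => z (D.idx p ⟨i, h⟩)) (D.loc p y) :=
      funext fun y => D.zeta_of_mem h y
    rw [h1]
    exact D.holAt_comp_loc hx
      ((ContinuousLinearMap.proj (R := ℂ) (φ := fun _ : Fin n => ℂ) _).analyticAt _)
  · have h1 : D.zeta p i = fun _ => 1 := funext fun y => D.zeta_of_notMem h y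
    rw [h1]
    exact contMDiffAt_const

/-- A holomorphic germ that vanishes on `D i` is divisible by the equation of `D i`. -/
theorem exists_eq_zeta_mul {f : X → ℂ} {x : X} {i : D.ι} (hf : HolAt n f x) (hx : x ∈ D.comp i)
    (h0 : ∀ᶠ y in 𝓝 x, y ∈ D.comp i → f y = 0) :
    ∃ q : X → ℂ, HolAt n q x ∧ ∀ᶠ y in 𝓝 x, f y = D.zeta x i y * q y := by
  have hxd := D.mem_dom_self x
  obtain ⟨q, hq, hfq⟩ := exists_analyticAt_eq_mul (D.analyticAt_comp_loc_symm hxd hf)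
    (ContinuousLinearMap.proj (R := ℂ) (φ := fun _ : Fin n => ℂ) (D.idx x ⟨i, hx⟩))
    (e := Pi.single (D.idx x ⟨i, hx⟩) 1) (by simp)
    (by
      rw [ContinuousLinearMap.proj_apply, ← D.zeta_of_mem hx, D.zeta_eq_zero_iff hxd]
      exact hx)
    (by
      filter_upwards [D.eventually_loc_symm hxd h0] with z hz hz0
      refine hz.2 ((D.zeta_eq_zero_iff ((D.loc x).map_target hz.1) i).1 ?_)
      rw [D.zeta_of_mem hx, (D.loc x).right_inv hz.1]
      exact hz0)
  refine ⟨fun y => q (D.loc x y), D.holAt_comp_loc hxd hq, ?_⟩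
  filter_upwards [D.eventually_loc hxd hfq] with y hy
  have h1 := hy.2
  rw [(D.loc x).left_inv hy.1] at h1
  rw [h1, D.zeta_of_mem hx]
  rfl

theorem holAt_mono_nat {p x : X} (hx : x ∈ D.dom p) (m : D.Through p → ℕ) :
    HolAt n (fun y => ∏ i : D.Through p, D.zeta p i y ^ m i) x :=
  contMDiffAt_finsetProd fun i _ => (D.holAt_zeta hx i).pow _

/-- A holomorphic germ without zeros off `D` is a unit times a monomial in the coordinates that
define `D`. -/
theorem exists_eq_mul_mono_of_holAt {f : X → ℂ} {x : X} (hf : HolAt n f x)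
    (h0 : ∀ᶠ y in 𝓝 x, y ∉ D.support → f y ≠ 0) :
    ∃ (m : D.Through x → ℤ) (u : X → ℂ), HolAt n u x ∧ u x ≠ 0 ∧
      ∀ᶠ y in 𝓝 x, f y = u y * D.mono x m y := by
  classical
  have hxd := D.mem_dom_self x
  obtain ⟨m, u, hu, hu0, hfu⟩ := exists_eq_mul_prod_pow (D.analyticAt_comp_loc_symm hxd hf)
    (Finset.univ.image (D.idx x))
    (by
      simp only [Finset.mem_image, Finset.mem_univ, true_and, forall_exists_index]
      rintro _ i rfl
      rw [← D.zeta_of_mem i.2, D.zeta_eq_zero_iff hxd]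
      exact i.2)
    (by
      filter_upwards [D.eventually_loc_symm hxd h0] with z hz hz0
      refine hz.2 (D.notMem_support.2 fun i hi => ?_)
      have hd := (D.loc x).map_target hz.1
      have h1 := D.mem_of_mem_dom hd hi
      refine hz0 (D.idx x ⟨i, h1⟩) (Finset.mem_image_of_mem _ (Finset.mem_univ _)) ?_
      have h2 := (D.zeta_eq_zero_iff hd i).2 hi
      rwa [D.zeta_of_mem h1, (D.loc x).right_inv hz.1] at h2)
  refine ⟨fun i => m (D.idx x i), fun y => u (D.loc x y), D.holAt_comp_loc hxd hu, hu0, ?_⟩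
  filter_upwards [D.eventually_loc hxd hfu] with y hy
  have h1 := hy.2
  rw [(D.loc x).left_inv hy.1] at h1
  rw [h1, Finset.prod_image fun i _ j _ h => D.idx_injective x h, mono]
  congr 1
  exact Finset.prod_congr rfl fun i _ => by rw [D.zeta_of_mem i.2, zpow_natCast]

/-- Local structure of the sections of `𝒪^*(*D)`: a unit times a monomial. -/
theorem IsMerUnit.exists_eq_mul_mono {D : SNCDivisor.{u, v} n X} {U : Opens X} {f : X → ℂ}
    (hf : D.IsMerUnit U f) {x : X} (hx : x ∈ U) :
    ∃ (m : D.Through x → ℤ) (u : X → ℂ), HolAt n u x ∧ u x ≠ 0 ∧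
      ∀ᶠ y in 𝓝 x, y ∉ D.support → f y = u y * D.mono x m y := by
  obtain ⟨p, q, hp, hq, hpq⟩ := hf.meromorphic x hx
  have hU := U.isOpen.mem_nhds hx
  obtain ⟨m, u, hu, hu0, hpu⟩ := D.exists_eq_mul_mono_of_holAt hp (by
    filter_upwards [hpq, hU] with y h1 h2 h3 h4
    exact hf.ne_zero y ⟨h2, h3⟩ (by rw [(h1 h3).2, h4, zero_div]))
  obtain ⟨m', u', hu', hu'0, hpu'⟩ := D.exists_eq_mul_mono_of_holAt hq (by
    filter_upwards [hpq] with y h1 h3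
    exact (h1 h3).1)
  refine ⟨m - m', fun y => u y / u' y, hu.div₀ hu' hu'0, div_ne_zero hu0 hu'0, ?_⟩
  filter_upwards [hpq, hpu, hpu', (D.dom x).isOpen.mem_nhds (D.mem_dom_self x)]
    with y h1 h2 h3 hd hD
  rw [(h1 hD).2, h2, h3, sub_eq_add_neg, D.mono_add hd hD, mono_neg]
  field_simp

end SNCDivisor

namespace SNCDivisor

variable {n : ℕ} {X : Type u} [TopologicalSpace X] [ChartedSpace (Fin n → ℂ) X]
  (D : SNCDivisor.{u, v} n X)

/-! ### Differentials and defining functions -/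

theorem _root_.LogPair.HolAt.mdifferentiableAt {f : X → ℂ} {x : X} (hf : HolAt n f x) :
    MDifferentiableAt 𝓘(ℂ, Fin n → ℂ) 𝓘(ℂ, ℂ) f x :=
  ContMDiffAt.mdifferentiableAt hf (by simp)

theorem differential_congr {f g : X → ℂ} {x : X} (h : f =ᶠ[𝓝 x] g)
    (ξ : TangentSpace 𝓘(ℂ, Fin n → ℂ) x) : differential f x ξ = differential g x ξ := by
  rw [differential, differential, h.mfderiv_eq]
  rfl

theorem differential_mul {f g : X → ℂ} {x : X} (hf : HolAt n f x) (hg : HolAt n g x)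
    (ξ : TangentSpace 𝓘(ℂ, Fin n → ℂ) x) :
    differential (fun y => f y * g y) x ξ =
      f x * differential g x ξ + g x * differential f x ξ := by
  have h := hf.mdifferentiableAt.hasMFDerivAt.mul hg.mdifferentiableAt.hasMFDerivAt
  have h1 : mfderiv 𝓘(ℂ, Fin n → ℂ) 𝓘(ℂ, ℂ) (fun y => f y * g y) x = _ := h.mfderiv
  rw [differential, h1]
  rfl

theorem differential_const (c : ℂ) (x : X) (ξ : TangentSpace 𝓘(ℂ, Fin n → ℂ) x) :
    differential (fun _ : X => c) x ξ = 0 := by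
  rw [differential, mfderiv_const]
  rfl

/-- In the chart, `zeta` is a linear coordinate. -/
theorem exists_differential_zeta_ne_zero {p y : X} (hy : y ∈ D.dom p) {i : D.ι}
    (hi : p ∈ D.comp i) :
    ∃ ξ : TangentSpace 𝓘(ℂ, Fin n → ℂ) y, differential (D.zeta p i) y ξ ≠ 0 := by
  have hs := (contMDiffAt_symm_of_mem_maximalAtlas (D.loc_mem_maximalAtlas p)
    ((D.loc p).map_source hy)).mdifferentiableAt (by simp)
  have hz : MDifferentiableAt 𝓘(ℂ, Fin n → ℂ) 𝓘(ℂ, ℂ) (D.zeta p i)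
      ((D.loc p).symm (D.loc p y)) := by
    rw [(D.loc p).left_inv hy]; exact (D.holAt_zeta hy i).mdifferentiableAt
  have hcomp := hz.hasMFDerivAt.comp (D.loc p y) hs.hasMFDerivAt
  let π := ContinuousLinearMap.proj (R := ℂ) (φ := fun _ : Fin n => ℂ) (D.idx p ⟨i, hi⟩)
  have heq : π =ᶠ[𝓝 (D.loc p y)] D.zeta p i ∘ (D.loc p).symm := by
    filter_upwards [(D.loc p).open_target.mem_nhds ((D.loc p).map_source hy)] with z hz
    rw [Function.comp_apply, D.zeta_of_mem hi, (D.loc p).right_inv hz]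
    rfl
  have h1 := (hcomp.congr_of_eventuallyEq heq).mfderiv
  have h2 : mfderiv 𝓘(ℂ, Fin n → ℂ) 𝓘(ℂ, ℂ) π (D.loc p y) = π := by
    rw [mfderiv_eq_fderiv]
    exact π.hasFDerivAt.fderiv
  rw [h2] at h1
  have h3 := DFunLike.congr_fun h1 (Pi.single (D.idx p ⟨i, hi⟩) (1 : ℂ) : Fin n → ℂ)
  have h4 : π (Pi.single (D.idx p ⟨i, hi⟩) (1 : ℂ) : Fin n → ℂ) = 1 := by simp [π]
  have h5 : ∃ ξ : TangentSpace 𝓘(ℂ, Fin n → ℂ) ((D.loc p).symm (D.loc p y)),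
      differential (D.zeta p i) _ ξ ≠ 0 :=
    ⟨mfderiv 𝓘(ℂ, Fin n → ℂ) 𝓘(ℂ, Fin n → ℂ) (D.loc p).symm (D.loc p y)
      (Pi.single (D.idx p ⟨i, hi⟩) (1 : ℂ) : Fin n → ℂ), by
      intro h6
      have : (1 : ℂ) = 0 := h4.symm.trans (h3.trans h6)
      exact one_ne_zero this⟩
  rwa [(D.loc p).left_inv hy] at h5

theorem isDefiningFunction_zeta (p : X) (i : D.ι) :
    D.IsDefiningFunction i (D.dom p) (D.zeta p i) where
  holomorphic x hx := (D.holAt_zeta hx i).contMDiffWithinAt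
  zero_iff x hx := D.zeta_eq_zero_iff hx i
  mfderiv_ne_zero x hx hi h := by
    obtain ⟨ξ, hξ⟩ := D.exists_differential_zeta_ne_zero hx (D.mem_of_mem_dom hx hi)
    exact hξ (by rw [differential, h]; rfl)

variable {D}

theorem IsDefiningFunction.holAt {i : D.ι} {U : Opens X} {h : X → ℂ}
    (hh : D.IsDefiningFunction i U h) {x : X} (hx : x ∈ U) : HolAt n h x :=
  hh.holomorphic.contMDiffAt (U.isOpen.mem_nhds hx)

theorem IsDefiningFunction.ne_zero {i : D.ι} {U : Opens X} {h : X → ℂ}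
    (hh : D.IsDefiningFunction i U h) {x : X} (hx : x ∈ U) (hi : x ∉ D.comp i) : h x ≠ 0 :=
  fun h0 => hi ((hh.zero_iff x hx).1 h0)

theorem IsDefiningFunction.isMerUnit {i : D.ι} {U : Opens X} {h : X → ℂ}
    (hh : D.IsDefiningFunction i U h) : D.IsMerUnit U h where
  holomorphic := hh.holomorphic.mono Set.sdiff_subset
  ne_zero x hx := hh.ne_zero hx.1 (D.notMem_support.1 hx.2 i)
  meromorphic x hx := ⟨h, fun _ => 1, hh.holAt hx, contMDiffAt_const, by simp⟩

/-- A defining function is a unit times the coordinate that defines the component. -/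
theorem IsDefiningFunction.exists_eq_mul_zeta {i : D.ι} {U : Opens X} {h : X → ℂ}
    (hh : D.IsDefiningFunction i U h) {x : X} (hx : x ∈ U) :
    ∃ q : X → ℂ, HolAt n q x ∧ q x ≠ 0 ∧ ∀ᶠ y in 𝓝 x, h y = q y * D.zeta x i y := by
  by_cases hi : x ∈ D.comp i
  · obtain ⟨q, hq, hhq⟩ := D.exists_eq_zeta_mul (hh.holAt hx) hi (by
      filter_upwards [U.isOpen.mem_nhds hx] with y hy
      exact (hh.zero_iff y hy).2)
    refine ⟨q, hq, fun h0 => hh.mfderiv_ne_zero x hx hi ?_, ?_⟩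
    · ext ξ
      have h1 := differential_congr hhq ξ
      rw [differential_mul (D.holAt_zeta (D.mem_dom_self x) i) hq, h0,
        (D.zeta_eq_zero_iff (D.mem_dom_self x) i).2 hi, zero_mul, zero_mul, add_zero] at h1
      exact h1
    · filter_upwards [hhq] with y hy
      rw [hy, mul_comm]
  · exact ⟨h, hh.holAt hx, hh.ne_zero hx hi, by simp [D.zeta_of_notMem hi]⟩

/-- Two defining functions of the same component differ by a unit. -/
theorem IsDefiningFunction.exists_eq_mul {i : D.ι} {U W : Opens X} {h k : X → ℂ}
    (hh : D.IsDefiningFunction i U h) (hk : D.IsDefiningFunction i W k) {x : X} (hx : x ∈ U)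
    (hx' : x ∈ W) :
    ∃ q : X → ℂ, HolAt n q x ∧ q x ≠ 0 ∧ ∀ᶠ y in 𝓝 x, h y = q y * k y := by
  obtain ⟨q, hq, hq0, h1⟩ := hh.exists_eq_mul_zeta hx
  obtain ⟨r, hr, hr0, h2⟩ := hk.exists_eq_mul_zeta hx'
  refine ⟨fun y => q y / r y, hq.div₀ hr hr0, div_ne_zero hq0 hr0, ?_⟩
  filter_upwards [h1, h2, hr.continuousAt.eventually_ne hr0] with y h1 h2 h3
  rw [h1, h2]
  field_simp

/-- The hypersurface is smooth: its tangent space is the kernel of the differential of a defining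
function, as every germ that vanishes on it is divisible by this function. -/
theorem IsDefiningFunction.mem_tangentTo_iff {i : D.ι} {U : Opens X} {h : X → ℂ}
    (hh : D.IsDefiningFunction i U h) {x : X} (hx : x ∈ U) (hi : x ∈ D.comp i)
    (ξ : TangentSpace 𝓘(ℂ, Fin n → ℂ) x) : ξ ∈ D.tangentTo i x ↔ differential h x ξ = 0 := by
  simp only [tangentTo, Submodule.mem_iInf]
  constructor
  · intro hξ
    exact hξ h (hh.holAt hx) (by
      filter_upwards [U.isOpen.mem_nhds hx] with y hy
      exact (hh.zero_iff y hy).2)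
  · intro hξ f hf hf0
    obtain ⟨q, hq, hhq⟩ := D.exists_eq_zeta_mul hf hi hf0
    obtain ⟨r, hr, hr0, hhr⟩ := hh.exists_eq_mul_zeta hx
    have hz := D.holAt_zeta (D.mem_dom_self x) i
    have hz0 := (D.zeta_eq_zero_iff (D.mem_dom_self x) i).2 hi
    rw [differential_congr hhr, differential_mul hr hz, hz0, zero_mul, add_zero] at hξ
    have h1 : differential f x ξ = 0 := by
      rw [differential_congr hhq, differential_mul hz hq, hz0, zero_mul, zero_add,
        (mul_eq_zero.1 hξ).resolve_left hr0, mul_zero]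
    exact h1

/-- The differential of a defining function identifies the normal line with `ℂ`. -/
theorem IsDefiningFunction.exists_normalEquiv {i : D.ι} {U : Opens X} {h : X → ℂ}
    (hh : D.IsDefiningFunction i U h) {x : X} (hx : x ∈ U) (hi : x ∈ D.comp i) :
    ∃ N : D.Normal i x ≃ₗ[ℂ] ℂ, ∀ ξ : TangentSpace 𝓘(ℂ, Fin n → ℂ) x,
      N (Submodule.Quotient.mk ξ) = differential h x ξ := by
  let f : TangentSpace 𝓘(ℂ, Fin n → ℂ) x →ₗ[ℂ] ℂ :=
    (mfderiv 𝓘(ℂ, Fin n → ℂ) 𝓘(ℂ, ℂ) h x).toLinearMap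
  have hf0 : f ≠ 0 := fun h0 => hh.mfderiv_ne_zero x hx hi (by
    ext ξ
    exact LinearMap.congr_fun h0 ξ)
  have hker : D.tangentTo i x = LinearMap.ker f := by
    ext ξ
    rw [hh.mem_tangentTo_iff hx hi]
    rfl
  exact ⟨(Submodule.quotEquivOfEq _ _ hker).trans
    (f.quotKerEquivOfSurjective (LinearMap.surjective hf0)), fun ξ => rfl⟩

/-! ### Scales -/

section Scale

variable {i : D.ι} {U W : Opens X} {h k : X → ℂ} {x y : X}

theorem isScale_iff_off (hi : x ∉ D.comp i) {g : D.PairHom x y} {a : ℂ} :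
    D.IsScale i h k g a ↔ k y = a * h x :=
  ⟨fun hs => hs.off hi, fun hs => ⟨fun _ => hs, fun hi' => absurd hi' hi⟩⟩

theorem isScale_iff_on (hi : x ∈ D.comp i) {g : D.PairHom x y} {a : ℂ}
    {N : D.Normal i x ≃ₗ[ℂ] ℂ} {N' : D.Normal i y ≃ₗ[ℂ] ℂ}
    (hN : ∀ ξ : TangentSpace 𝓘(ℂ, Fin n → ℂ) x, N (Submodule.Quotient.mk ξ) = differential h x ξ)
    (hN' : ∀ ξ : TangentSpace 𝓘(ℂ, Fin n → ℂ) y,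
      N' (Submodule.Quotient.mk ξ) = differential k y ξ) :
    D.IsScale i h k g a ↔ ∀ v, N' (g.iso i hi v) = a * N v := by
  constructor
  · intro hs v
    obtain ⟨ξ, rfl⟩ := Submodule.Quotient.mk_surjective _ v
    obtain ⟨η, hη⟩ := Submodule.Quotient.mk_surjective _ (g.iso i hi (Submodule.Quotient.mk ξ))
    rw [← hη, hN', hN, hs.on hi ξ η hη.symm]
  · intro hs
    refine ⟨fun hi' => absurd hi hi', fun _ ξ η hη => ?_⟩
    have := hs (Submodule.Quotient.mk ξ)
    rwa [hη, hN, hN'] at this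

theorem existsUnique_isScale (hh : D.IsDefiningFunction i U h) (hk : D.IsDefiningFunction i W k)
    (hx : x ∈ U) (hy : y ∈ W) (g : D.PairHom x y) : ∃! a, D.IsScale i h k g a := by
  by_cases hi : x ∈ D.comp i
  · obtain ⟨N, hN⟩ := hh.exists_normalEquiv hx hi
    obtain ⟨N', hN'⟩ := hk.exists_normalEquiv hy ((g.mem_iff i).1 hi)
    simp only [isScale_iff_on hi hN hN']
    refine ⟨N' (g.iso i hi (N.symm 1)), fun v => ?_, fun a ha => ?_⟩
    · have : v = N v • N.symm 1 := by
        rw [← map_smul, smul_eq_mul, mul_one, N.symm_apply_apply]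
      conv_lhs => rw [this]
      rw [map_smul, map_smul, smul_eq_mul, mul_comm]
    · simp [ha]
  · simp only [isScale_iff_off hi]
    have h0 := hh.ne_zero hx hi
    exact ⟨k y / h x, by field_simp, fun a ha => by rw [ha]; field_simp⟩

theorem IsScale.ne_zero (hh : D.IsDefiningFunction i U h) (hk : D.IsDefiningFunction i W k)
    (hx : x ∈ U) (hy : y ∈ W) {g : D.PairHom x y} {a : ℂ} (hs : D.IsScale i h k g a) : a ≠ 0 := by
  rintro rfl
  by_cases hi : x ∈ D.comp i
  · obtain ⟨N, hN⟩ := hh.exists_normalEquiv hx hi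
    obtain ⟨N', hN'⟩ := hk.exists_normalEquiv hy ((g.mem_iff i).1 hi)
    have := (isScale_iff_on hi hN hN').1 hs (N.symm 1)
    simp at this
  · refine hk.ne_zero hy (fun h => hi ((g.mem_iff i).2 h)) ?_
    rw [hs.off hi, zero_mul]

/-- The scale after a change of the defining functions by units `q` and `r`. -/
theorem IsScale.change {h' k' q r : X → ℂ} {g : D.PairHom x y} {a : ℂ}
    (hs : D.IsScale i h k g a) (hh : D.IsDefiningFunction i U h) (hk : D.IsDefiningFunction i W k)
    (hx : x ∈ U) (hy : y ∈ W) (hq : HolAt n q x) (hr : HolAt n r y) (hq0 : q x ≠ 0)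
    (hh' : ∀ᶠ z in 𝓝 x, h' z = q z * h z) (hk' : ∀ᶠ z in 𝓝 y, k' z = r z * k z) :
    D.IsScale i h' k' g (a * r y / q x) := by
  refine ⟨fun hi => ?_, fun hi ξ η hξη => ?_⟩
  · rw [hh'.self_of_nhds, hk'.self_of_nhds, hs.off hi]
    field_simp
  · have h1 := (hh.zero_iff x hx).2 hi
    have h2 := (hk.zero_iff y hy).2 ((g.mem_iff i).1 hi)
    rw [differential_congr hh', differential_congr hk', differential_mul hq (hh.holAt hx),
      differential_mul hr (hk.holAt hy), h1, h2, zero_mul, zero_mul, add_zero, add_zero,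
      hs.on hi ξ η hξη]
    field_simp

theorem isScale_id (hh : D.IsDefiningFunction i U h) (hx : x ∈ U) :
    D.IsScale i h h (D.pair.id x) 1 :=
  ⟨fun _ => (one_mul _).symm, fun hi ξ η hξη => by
    have h1 : ξ - η ∈ D.tangentTo i x := (Submodule.Quotient.eq _).1 hξη
    have h2 : differential h x ξ - differential h x η = 0 :=
      (map_sub (mfderiv 𝓘(ℂ, Fin n → ℂ) 𝓘(ℂ, ℂ) h x) ξ η).symm.trans
        ((hh.mem_tangentTo_iff hx hi _).1 h1)
    rw [one_mul, sub_eq_zero.1 h2]⟩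

theorem IsScale.comp {z : X} {l : X → ℂ} {f : D.pair.Hom x y} {g : D.pair.Hom y z}
    {a b : ℂ} (hf : D.IsScale i h k f a) (hg : D.IsScale i k l g b) :
    D.IsScale i h l (D.pair.comp f g) (b * a) := by
  refine ⟨fun hi => ?_, fun hi ξ η hξη => ?_⟩
  · rw [hg.off (fun h => hi ((f.mem_iff i).2 h)), hf.off hi, mul_assoc]
  · obtain ⟨ζ, hζ⟩ := Submodule.Quotient.mk_surjective _ (f.iso i hi (Submodule.Quotient.mk ξ))
    rw [hg.on ((f.mem_iff i).1 hi) ζ η (by rw [hζ]; exact hξη), hf.on hi ξ ζ hζ.symm, mul_assoc]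

theorem IsScale.inv {f : D.pair.Hom x y} {a : ℂ} (hf : D.IsScale i h k f a) (ha : a ≠ 0) :
    D.IsScale i k h (D.pair.inv f) a⁻¹ := by
  refine ⟨fun hi => ?_, fun hi ξ η hξη => ?_⟩
  · rw [hf.off (fun h => hi ((f.mem_iff i).1 h))]
    field_simp
  · rw [hf.on ((f.mem_iff i).2 hi) η ξ ?_]
    · field_simp
    · rw [← hξη]
      exact (f.iso i _).apply_symm_apply _

/-- Arrows are determined by their scales along the components through the source. -/
theorem pairHom_ext {g g' : D.PairHom x y} (h k : D.ι → X → ℂ) (U W : D.ι → Opens X)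
    (hh : ∀ i, D.IsDefiningFunction i (U i) (h i)) (hk : ∀ i, D.IsDefiningFunction i (W i) (k i))
    (hx : ∀ i, x ∈ U i) (hy : ∀ i, y ∈ W i)
    (H : ∀ i, x ∈ D.comp i → ∃ a, D.IsScale i (h i) (k i) g a ∧ D.IsScale i (h i) (k i) g' a) :
    g = g' := by
  ext i hi v
  obtain ⟨a, ha, ha'⟩ := H i hi
  obtain ⟨N, hN⟩ := (hh i).exists_normalEquiv (hx i) hi
  obtain ⟨N', hN'⟩ := (hk i).exists_normalEquiv (hy i) ((g.mem_iff i).1 hi)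
  apply N'.injective
  rw [(isScale_iff_on hi hN hN').1 ha, (isScale_iff_on hi hN hN').1 ha']

/-- There are arrows with arbitrary scales. -/
theorem exists_pairHom (hxy : ∀ i, x ∈ D.comp i ↔ y ∈ D.comp i) (h k : D.ι → X → ℂ)
    (U W : D.ι → Opens X) (hh : ∀ i, D.IsDefiningFunction i (U i) (h i))
    (hk : ∀ i, D.IsDefiningFunction i (W i) (k i)) (hx : ∀ i, x ∈ U i) (hy : ∀ i, y ∈ W i)
    (a : D.ι → ℂ) (ha : ∀ i, x ∈ D.comp i → a i ≠ 0) :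
    ∃ g : D.PairHom x y, ∀ i, x ∈ D.comp i → D.IsScale i (h i) (k i) g (a i) := by
  choose N hN using fun i hi => (hh i).exists_normalEquiv (hx i) hi
  choose N' hN' using fun i hi => (hk i).exists_normalEquiv (hy i) hi
  refine ⟨⟨hxy, fun i hi => ((N i hi).trans (LinearEquiv.smulOfNeZero ℂ ℂ (a i) (ha i hi))).trans
    (N' i ((hxy i).1 hi)).symm⟩, fun i hi => ?_⟩
  rw [isScale_iff_on hi (hN i hi) (hN' i ((hxy i).1 hi))]
  intro v
  simp

/-- The scale of an arrow, as a function on the space of arrows. It is meaningful at the arrows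
whose ends are in the domains of the defining functions `h` and `k`. -/
def scale (i : D.ι) (h k : X → ℂ) (g : Arr D.pair) : ℂ :=
  Classical.epsilon fun a => D.IsScale i h k g.2.2 a

theorem isScale_scale (hh : D.IsDefiningFunction i U h) (hk : D.IsDefiningFunction i W k)
    (hx : x ∈ U) (hy : y ∈ W) (g : D.PairHom x y) :
    D.IsScale i h k g (scale i h k (⟨x, y, g⟩ : Arr D.pair)) :=
  Classical.epsilon_spec (existsUnique_isScale hh hk hx hy g).exists

theorem IsScale.scale_eq (hh : D.IsDefiningFunction i U h) (hk : D.IsDefiningFunction i W k)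
    (hx : x ∈ U) (hy : y ∈ W) {g : D.PairHom x y} {a : ℂ} (hs : D.IsScale i h k g a) :
    scale i h k (⟨x, y, g⟩ : Arr D.pair) = a :=
  (existsUnique_isScale hh hk hx hy g).unique (isScale_scale hh hk hx hy g) hs

end Scale

end SNCDivisor

namespace SNCDivisor

variable {n : ℕ} {X : Type u} [TopologicalSpace X] [ChartedSpace (Fin n → ℂ) X]
  (D : SNCDivisor.{u, v} n X)

/-! ### The fibres of the family of groups and the values of meromorphic units -/

instance small_multiplicative (x : X) : Small.{u} (Multiplicative (D.Through x → ℤ)) :=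
  haveI : Countable (D.Through x → ℤ) := inferInstance
  small_map (Multiplicative.toAdd (α := D.Through x → ℤ))

/-- The fibre at `x` of the family of groups: the value at `x` of a unit times a monomial in the
coordinates of `D.loc x` that define `D` is recorded by the value of the unit and the exponents.
(`Shrink` only moves this group, which is as large as `ℂ`, to the universe of `X`.) -/
def Fib (x : X) : Type u := Shrink.{u} (ℂˣ × Multiplicative (D.Through x → ℤ))

instance (x : X) : CommGroup (D.Fib x) :=
  inferInstanceAs (CommGroup (Shrink.{u} (ℂˣ × Multiplicative (D.Through x → ℤ))))

/-- The components of an element of a fibre. -/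
def fibEquiv (x : X) : D.Fib x ≃* ℂˣ × Multiplicative (D.Through x → ℤ) := Shrink.mulEquiv

variable {D}

/-- The value of the unit. -/
def coef {x : X} (v : D.Fib x) : ℂˣ := (D.fibEquiv x v).1

/-- The exponents of the monomial. -/
def ord {x : X} (v : D.Fib x) : D.Through x → ℤ := (D.fibEquiv x v).2.toAdd

variable (D) in
/-- The element of the fibre at `x` with given components. -/
def fib (x : X) (c : ℂˣ) (m : D.Through x → ℤ) : D.Fib x :=
  (D.fibEquiv x).symm (c, Multiplicative.ofAdd m)

section Components

variable {x : X}

@[simp] theorem coef_fib (c : ℂˣ) (m : D.Through x → ℤ) : coef (D.fib x c m) = c := by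
  simp [coef, fib]

@[simp] theorem ord_fib (c : ℂˣ) (m : D.Through x → ℤ) : ord (D.fib x c m) = m := by
  simp [ord, fib]

theorem fib_ext {v w : D.Fib x} (h : coef v = coef w) (h' : ord v = ord w) : v = w :=
  (D.fibEquiv x).injective (Prod.ext h (Multiplicative.toAdd.injective h'))

@[simp] theorem coef_mul (v w : D.Fib x) : coef (v * w) = coef v * coef w := by simp [coef]
@[simp] theorem ord_mul (v w : D.Fib x) : ord (v * w) = ord v + ord w := by simp [ord]
@[simp] theorem coef_one : coef (1 : D.Fib x) = 1 := by simp [coef]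
@[simp] theorem ord_one : ord (1 : D.Fib x) = 0 := by simp [ord]
@[simp] theorem coef_inv (v : D.Fib x) : coef v⁻¹ = (coef v)⁻¹ := by simp [coef]
@[simp] theorem ord_inv (v : D.Fib x) : ord v⁻¹ = -ord v := by simp [ord]

open Classical in
variable (D x) in
/-- The value at `x` of the constant function `c`, if this is not zero; otherwise the unit. -/
def cst (c : ℂ) : D.Fib x := D.fib x (if h : c ≠ 0 then Units.mk0 c h else 1) 0

theorem coef_cst {c : ℂ} (hc : c ≠ 0) : (coef (D.cst x c) : ℂ) = c := by simp [cst, hc]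
@[simp] theorem ord_cst (c : ℂ) : ord (D.cst x c) = 0 := by simp [cst]

theorem cst_one : D.cst x 1 = 1 := fib_ext (Units.ext (by simp [coef_cst])) (by simp)

theorem cst_mul {c d : ℂ} (hc : c ≠ 0) (hd : d ≠ 0) :
    D.cst x (c * d) = D.cst x c * D.cst x d :=
  fib_ext (Units.ext (by simp [coef_cst, hc, hd])) (by simp)

theorem cst_inv {c : ℂ} (hc : c ≠ 0) : D.cst x c⁻¹ = (D.cst x c)⁻¹ :=
  fib_ext (Units.ext (by simp [coef_cst, hc])) (by simp)

/-- Elements with the same exponents differ by a constant. -/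
theorem eq_mul_cst_of_ord_eq {v w : D.Fib x} (h : ord v = ord w) :
    v = w * D.cst x (coef v / coef w) := by
  refine fib_ext (Units.ext ?_) (by simp [h])
  have : ((coef v : ℂ) / coef w) ≠ 0 := by simp
  simp [coef_cst this]
  field_simp

end Components

/-- `v` is the value at `x` of the function `f`, which need only be given off `D`: the quotient of
`f` by the monomial with the exponents of `v` tends to the coefficient of `v`. -/
def IsValue (x : X) (f : X → ℂ) (v : D.Fib x) : Prop :=
  Tendsto (fun y => f y / D.mono x (ord v) y) (𝓝[D.supportᶜ] x) (𝓝 (coef v : ℂ))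

theorem eventually_off {x : X} {P : X → Prop} (h : ∀ᶠ y in 𝓝 x, y ∉ D.support → P y) :
    ∀ᶠ y in 𝓝[D.supportᶜ] x, P y := by
  filter_upwards [h.filter_mono nhdsWithin_le_nhds, self_mem_nhdsWithin] with y h1 h2
  exact h1 h2

theorem eventually_mem_dom (x : X) : ∀ᶠ y in 𝓝[D.supportᶜ] x, y ∈ D.dom x ∧ y ∉ D.support := by
  filter_upwards [nhdsWithin_le_nhds ((D.dom x).isOpen.mem_nhds (D.mem_dom_self x)),
    self_mem_nhdsWithin] with y h1 h2
  exact ⟨h1, h2⟩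

section Value

variable {x : X} {f g : X → ℂ} {v w : D.Fib x}

theorem IsValue.eventually_ne (hf : IsValue x f v) : ∀ᶠ y in 𝓝[D.supportᶜ] x, f y ≠ 0 := by
  filter_upwards [Tendsto.eventually_ne hf (coef v).ne_zero] with y hy h0
  exact hy (by rw [h0, zero_div])

/-- The value is unique, since no nontrivial monomial has a nonzero limit. -/
theorem IsValue.unique (hv : IsValue x f v) (hw : IsValue x f w) : v = w := by
  have h1 : Tendsto (D.mono x (ord v - ord w)) (𝓝[D.supportᶜ] x) (𝓝 ((coef w : ℂ) / coef v)) := by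
    refine (tendsto_congr' ?_).1 (Tendsto.div hw hv (coef v).ne_zero)
    filter_upwards [hv.eventually_ne, eventually_mem_dom x] with y h1 h2
    have h3 := D.mono_ne_zero h2.1 h2.2 (ord v)
    have h4 := D.mono_ne_zero h2.1 h2.2 (ord w)
    rw [sub_eq_add_neg, D.mono_add h2.1 h2.2, mono_neg, Pi.div_apply]
    field_simp
  have h2 : ord v = ord w := sub_eq_zero.1 (D.eq_zero_of_tendsto_mono (by simp) h1)
  refine fib_ext (Units.ext ?_) h2
  rw [IsValue, ← h2] at hw
  exact tendsto_nhds_unique hv hw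

theorem IsValue.congr (hv : IsValue x f v) (h : ∀ᶠ y in 𝓝[D.supportᶜ] x, f y = g y) :
    IsValue x g v :=
  (tendsto_congr' (by filter_upwards [h] with y hy; rw [hy])).1 hv

theorem IsValue.mul (hv : IsValue x f v) (hw : IsValue x g w) :
    IsValue x (fun y => f y * g y) (v * w) := by
  have h := Tendsto.mul hv hw
  rw [IsValue, coef_mul, Units.val_mul]
  refine (tendsto_congr' ?_).1 h
  filter_upwards [eventually_mem_dom x] with y h2
  rw [ord_mul, D.mono_add h2.1 h2.2, mul_div_mul_comm]

theorem IsValue.inv (hv : IsValue x f v) : IsValue x (fun y => (f y)⁻¹) v⁻¹ := by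
  have h := Tendsto.inv₀ hv (coef v).ne_zero
  rw [IsValue, coef_inv, Units.val_inv_eq_inv_val]
  refine (tendsto_congr' ?_).1 h
  filter_upwards with y
  rw [ord_inv, mono_neg, inv_div, inv_div_inv]

theorem isValue_fib (u : X → ℂ) (hu : ContinuousAt u x) (hu0 : u x ≠ 0) (m : D.Through x → ℤ)
    (h : ∀ᶠ y in 𝓝[D.supportᶜ] x, f y = u y * D.mono x m y) :
    IsValue x f (D.fib x (Units.mk0 (u x) hu0) m) := by
  rw [IsValue, coef_fib, ord_fib, Units.val_mk0]
  refine (tendsto_congr' ?_).1 (hu.tendsto.mono_left nhdsWithin_le_nhds)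
  filter_upwards [h, eventually_mem_dom x] with y h1 h2
  rw [h1, mul_div_cancel_right₀ _ (D.mono_ne_zero h2.1 h2.2 m)]

theorem isValue_of_continuousAt {u : X → ℂ} (hu : ContinuousAt u x) (hu0 : u x ≠ 0) :
    IsValue x u (D.cst x (u x)) := by
  have := isValue_fib (D := D) (f := u) u hu hu0 0 (by simp)
  simpa [cst, hu0] using this

theorem IsValue.mul_cst {u : X → ℂ} (hv : IsValue x f v) (hu : ContinuousAt u x) (hu0 : u x ≠ 0)
    (h : ∀ᶠ y in 𝓝[D.supportᶜ] x, g y = f y * u y) : IsValue x g (v * D.cst x (u x)) :=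
  (hv.mul (isValue_of_continuousAt hu hu0)).congr (by filter_upwards [h] with y hy; rw [hy])

variable (D x f) in
/-- The value at `x` of a meromorphic unit (arbitrary for a function that has no value). -/
def value : D.Fib x := Classical.epsilon fun v => IsValue x f v

theorem IsValue.value_eq (h : IsValue x f v) : D.value x f = v :=
  IsValue.unique (Classical.epsilon_spec ⟨v, h⟩) h

theorem IsMerUnit.isValue {U : Opens X} (hf : D.IsMerUnit U f) (hx : x ∈ U) :
    IsValue x f (D.value x f) := by
  obtain ⟨m, u, hu, hu0, h⟩ := hf.exists_eq_mul_mono hx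
  have h1 := isValue_fib u hu.continuousAt hu0 m (eventually_off h)
  rwa [h1.value_eq]

end Value

theorem eventually_holAt (D : SNCDivisor.{u, v} n X) {f : X → ℂ} {x : X} (hf : HolAt n f x) :
    ∀ᶠ y in 𝓝 x, HolAt n f y := by
  have h1 := (D.analyticAt_comp_loc_symm (D.mem_dom_self x) hf).eventually_analyticAt
  filter_upwards [eventually_eventually_nhds.2 (D.eventually_loc (D.mem_dom_self x) h1)] with y hy
  refine (D.holAt_comp_loc hy.self_of_nhds.1 hy.self_of_nhds.2).congr_of_eventuallyEq ?_
  filter_upwards [hy] with z hz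
  rw [(D.loc x).left_inv hz.1]

/-- Two meromorphic units whose values at `x` have the same exponents differ near `x` by a
holomorphic unit. -/
theorem exists_eq_mul_of_ord_eq {U W : Opens X} {f g : X → ℂ} (hf : D.IsMerUnit U f)
    (hg : D.IsMerUnit W g) {x : X} (hx : x ∈ U) (hx' : x ∈ W)
    (h : ord (D.value x f) = ord (D.value x g)) :
    ∃ u : X → ℂ, HolAt n u x ∧ u x ≠ 0 ∧ (∀ᶠ y in 𝓝 x, y ∉ D.support → f y = g y * u y) ∧
      ∀ᶠ y in 𝓝 x, D.value y f = D.value y g * D.cst y (u y) := by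
  obtain ⟨m, u, hu, hu0, h1⟩ := hf.exists_eq_mul_mono hx
  obtain ⟨m', u', hu', hu'0, h2⟩ := hg.exists_eq_mul_mono hx'
  have e1 := (isValue_fib u hu.continuousAt hu0 m (eventually_off h1)).value_eq
  have e2 := (isValue_fib u' hu'.continuousAt hu'0 m' (eventually_off h2)).value_eq
  rw [e1, e2, ord_fib, ord_fib] at h
  subst h
  have hq : HolAt n (fun y => u y / u' y) x := hu.div₀ hu' hu'0
  have hq0 : u x / u' x ≠ 0 := div_ne_zero hu0 hu'0
  have hfg : ∀ᶠ y in 𝓝 x, y ∉ D.support → f y = g y * (u y / u' y) := by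
    filter_upwards [h1, h2, hu'.continuousAt.eventually_ne hu'0] with y h1 h2 h3 hD
    rw [h1 hD, h2 hD]
    field_simp
  refine ⟨_, hq, hq0, hfg, ?_⟩
  filter_upwards [U.isOpen.mem_nhds hx, W.isOpen.mem_nhds hx', eventually_eventually_nhds.2 hfg,
    D.eventually_holAt hq, hq.continuousAt.eventually_ne hq0] with y hyU hyW hy hqy hy0
  exact ((hg.isValue hyW).mul_cst hqy.continuousAt hy0 (eventually_off hy)).value_eq

/-! ### Operations on meromorphic units -/

theorem IsMerUnit.mul {U : Opens X} {f g : X → ℂ} (hf : D.IsMerUnit U f) (hg : D.IsMerUnit U g) :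
    D.IsMerUnit U (fun y => f y * g y) where
  holomorphic := hf.holomorphic.mul hg.holomorphic
  ne_zero x hx := mul_ne_zero (hf.ne_zero x hx) (hg.ne_zero x hx)
  meromorphic x hx := by
    obtain ⟨p, q, hp, hq, h⟩ := hf.meromorphic x hx
    obtain ⟨p', q', hp', hq', h'⟩ := hg.meromorphic x hx
    refine ⟨fun y => p y * p' y, fun y => q y * q' y, hp.mul hp', hq.mul hq', ?_⟩
    filter_upwards [h, h'] with y h h' hy
    refine ⟨mul_ne_zero (h hy).1 (h' hy).1, ?_⟩
    rw [(h hy).2, (h' hy).2, div_mul_div_comm]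

theorem isMerUnit_of_hol {U : Opens X} {f : X → ℂ} (hf : ∀ x ∈ U, HolAt n f x)
    (h0 : ∀ x ∈ U, f x ≠ 0) : D.IsMerUnit U f where
  holomorphic x hx := (hf x hx.1).contMDiffWithinAt
  ne_zero x hx := h0 x hx.1
  meromorphic x hx := ⟨f, fun _ => 1, hf x hx, contMDiffAt_const, by simp⟩

theorem isMerUnit_const {c : ℂ} (hc : c ≠ 0) (U : Opens X) : D.IsMerUnit U (fun _ => c) :=
  isMerUnit_of_hol (fun _ _ => contMDiffAt_const) fun _ _ => hc

theorem value_const {c : ℂ} (hc : c ≠ 0) (x : X) : D.value x (fun _ => c) = D.cst x c :=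
  (isValue_of_continuousAt (u := fun _ => c) continuousAt_const hc).value_eq

theorem IsMerUnit.value_mul {U : Opens X} {f g : X → ℂ} (hf : D.IsMerUnit U f)
    (hg : D.IsMerUnit U g) {x : X} (hx : x ∈ U) :
    D.value x (fun y => f y * g y) = D.value x f * D.value x g :=
  ((hf.isValue hx).mul (hg.isValue hx)).value_eq

theorem IsMerUnit.holAt {U : Opens X} {f : X → ℂ} (hf : D.IsMerUnit U f) {x : X} (hx : x ∈ U)
    (hD : x ∉ D.support) : HolAt n f x := by
  refine hf.holomorphic.contMDiffAt ?_
  have h1 : ∀ᶠ y in 𝓝 x, y ∉ D.support := by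
    have h2 : ∀ᶠ y in 𝓝 x, y ∈ D.dom x := (D.dom x).isOpen.mem_nhds (D.mem_dom_self x)
    filter_upwards [h2] with y hy
    exact D.notMem_support.2 fun i hi => D.notMem_support.1 hD i (D.mem_of_mem_dom hy hi)
  exact Filter.inter_mem (U.isOpen.mem_nhds hx) h1

theorem isMerUnit_mono (p : X) (m : D.Through p → ℤ) : D.IsMerUnit (D.dom p) (D.mono p m) := by
  have hq : ∀ m' : D.Through p → ℤ, ∀ y ∈ D.dom p, y ∉ D.support → D.mono p m' y ≠ 0 :=
    fun m' y hy hD => D.mono_ne_zero hy hD m'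
  have key : ∀ x ∈ D.dom p, ∃ a b : X → ℂ, HolAt n a x ∧ HolAt n b x ∧
      ∀ y ∈ D.dom p, y ∉ D.support → b y ≠ 0 ∧ D.mono p m y = a y / b y := by
    intro x hx
    refine ⟨fun y => ∏ i : D.Through p, D.zeta p i y ^ (m i).toNat,
      fun y => ∏ i : D.Through p, D.zeta p i y ^ (-m i).toNat, D.holAt_mono_nat hx _,
      D.holAt_mono_nat hx _, fun y hy hD => ?_⟩
    have hz : ∀ i : D.Through p, D.zeta p i y ≠ 0 := fun i h =>
      D.notMem_support.1 hD i ((D.zeta_eq_zero_iff hy i).1 h)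
    refine ⟨Finset.prod_ne_zero_iff.2 fun i _ => pow_ne_zero _ (hz i), ?_⟩
    rw [mono, ← Finset.prod_div_distrib]
    refine Finset.prod_congr rfl fun i _ => ?_
    rw [← zpow_natCast, ← zpow_natCast, ← zpow_sub₀ (hz i), Int.toNat_sub_toNat_neg]
  refine ⟨fun x hx => ?_, fun x hx => hq m x hx.1 hx.2, fun x hx => ?_⟩
  · obtain ⟨a, b, ha, hb, hab⟩ := key x hx.1
    refine ((ha.div₀ hb (hab x hx.1 hx.2).1).contMDiffWithinAt).congr
      (fun y hy => (hab y hy.1 hy.2).2) (hab x hx.1 hx.2).2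
  · obtain ⟨a, b, ha, hb, hab⟩ := key x hx
    refine ⟨a, b, ha, hb, ?_⟩
    filter_upwards [(D.dom p).isOpen.mem_nhds hx] with y hy hD
    exact hab y hy hD

theorem value_mono_self (x : X) (m : D.Through x → ℤ) : D.value x (D.mono x m) = D.fib x 1 m := by
  have h := isValue_fib (f := D.mono x m) (fun _ => (1 : ℂ)) continuousAt_const one_ne_zero m
    (by simp)
  rw [h.value_eq]
  congr 1
  exact Units.ext rfl

end SNCDivisor

namespace SNCDivisor

variable {n : ℕ} {X : Type u} [TopologicalSpace X] [ChartedSpace (Fin n → ℂ) X]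
  {D : SNCDivisor.{u, v} n X}

/-! ### The complex manifold structure on the family of groups -/

variable (D) in
/-- The values of `c f` at `x`, as a function of `(x, c)`. -/
def sec (f : X → ℂ) (z : X × ℂ) : Σ x, D.Fib x := ⟨z.1, D.value z.1 f * D.cst z.1 z.2⟩

/-- The constant `c` such that `v` is the value of `c f`, provided that there is one. -/
def quo (f : X → ℂ) (v : Σ x, D.Fib x) : ℂ := coef v.2 / coef (D.value v.1 f)

/-- The point `v` is the value of a constant multiple of `f`. -/
def OrdEq (f : X → ℂ) (v : Σ x, D.Fib x) : Prop := ord v.2 = ord (D.value v.1 f)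

theorem quo_ne_zero (f : X → ℂ) (v : Σ x, D.Fib x) : quo f v ≠ 0 := by simp [quo]

theorem sec_quo {f : X → ℂ} {v : Σ x, D.Fib x} (h : OrdEq f v) : D.sec f (v.1, quo f v) = v :=
  Sigma.ext rfl (heq_of_eq (eq_mul_cst_of_ord_eq h).symm)

theorem quo_sec {f : X → ℂ} {z : X × ℂ} (h : z.2 ≠ 0) : quo f (D.sec f z) = z.2 := by
  simp [quo, sec, coef_cst h]

theorem ordEq_sec_iff {f g : X → ℂ} {z : X × ℂ} :
    OrdEq g (D.sec f z) ↔ ord (D.value z.1 f) = ord (D.value z.1 g) := by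
  simp [OrdEq, sec]

theorem ordEq_sec {f : X → ℂ} {z : X × ℂ} : OrdEq f (D.sec f z) := ordEq_sec_iff.2 rfl

theorem ordEq_mono_self (v : Σ x, D.Fib x) : OrdEq (D.mono v.1 (ord v.2)) v := by
  rw [OrdEq, value_mono_self, ord_fib]

variable (D) in
/-- The chart given by the values of the constant multiples of a monomial. -/
def fibChart (p : X) (m : D.Through p → ℤ) :
    PartialEquiv (Σ x, D.Fib x) ((Fin n → ℂ) × ℂ) where
  toFun v := (D.loc p v.1, quo (D.mono p m) v)
  invFun z := D.sec (D.mono p m) ((D.loc p).symm z.1, z.2)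
  source := {v | v.1 ∈ D.dom p ∧ OrdEq (D.mono p m) v}
  target := {z | z.1 ∈ (D.loc p).target ∧ z.2 ≠ 0}
  map_source' v hv := ⟨(D.loc p).map_source hv.1, quo_ne_zero _ _⟩
  map_target' z hz := ⟨(D.loc p).map_target hz.1, ordEq_sec⟩
  left_inv' v hv := by
    rw [(D.loc p).left_inv hv.1]
    exact sec_quo hv.2
  right_inv' z hz := Prod.ext ((D.loc p).right_inv hz.1)
    (quo_sec (z := ((D.loc p).symm z.1, z.2)) hz.2)

theorem contMDiffAt_loc_symm (p : X) {z : Fin n → ℂ} (hz : z ∈ (D.loc p).target) :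
    ContMDiffAt 𝓘(ℂ, Fin n → ℂ) 𝓘(ℂ, Fin n → ℂ) ω (D.loc p).symm z :=
  contMDiffAt_symm_of_mem_maximalAtlas (D.loc_mem_maximalAtlas p) hz

theorem contMDiffAt_loc {p x : X} (hx : x ∈ D.dom p) :
    ContMDiffAt 𝓘(ℂ, Fin n → ℂ) 𝓘(ℂ, Fin n → ℂ) ω (D.loc p) x :=
  contMDiffAt_of_mem_maximalAtlas (D.loc_mem_maximalAtlas p) hx

/-- The transition functions are holomorphic with open domains: two monomials whose values at a
point have the same exponents differ near this point by a unit `u`, and `c` becomes `u c`. -/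
theorem fibChart_transition {p p' : X} {m : D.Through p → ℤ} {m' : D.Through p' → ℤ}
    {z : (Fin n → ℂ) × ℂ} (hz : z ∈ ((D.fibChart p m).symm.trans (D.fibChart p' m')).source) :
    (∀ᶠ y in 𝓝 z, y ∈ ((D.fibChart p m).symm.trans (D.fibChart p' m')).source) ∧
      ContDiffAt ℂ ω ((D.fibChart p m).symm.trans (D.fibChart p' m')) z := by
  obtain ⟨⟨hz1, hz2⟩, hz3, hz4⟩ := hz
  have hz1' : z.1 ∈ (D.loc p).target := hz1
  have hx : (D.loc p).symm z.1 ∈ D.dom p := (D.loc p).map_target hz1'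
  have hx' : (D.loc p).symm z.1 ∈ D.dom p' := hz3
  obtain ⟨u, hu, hu0, -, h⟩ := exists_eq_mul_of_ord_eq (D.isMerUnit_mono p m)
    (D.isMerUnit_mono p' m') hx hx' (ordEq_sec_iff.1 hz4)
  have hs := contMDiffAt_loc_symm (D := D) p hz1'
  have hsc : Tendsto (fun y : (Fin n → ℂ) × ℂ => (D.loc p).symm y.1) (𝓝 z)
      (𝓝 ((D.loc p).symm z.1)) :=
    hs.continuousAt.tendsto.comp (continuous_fst.tendsto z)
  have hev : ∀ᶠ y in 𝓝 z, y.1 ∈ (D.loc p).target ∧ y.2 ≠ 0 :=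
    ((continuous_fst.tendsto z).eventually ((D.loc p).open_target.mem_nhds hz1')).and
      (continuous_snd.continuousAt.eventually_ne hz2)
  have hev2 : ∀ᶠ y : (Fin n → ℂ) × ℂ in 𝓝 z, (D.loc p).symm y.1 ∈ D.dom p' ∧
      u ((D.loc p).symm y.1) ≠ 0 ∧
      D.value ((D.loc p).symm y.1) (D.mono p m) =
        D.value ((D.loc p).symm y.1) (D.mono p' m') * D.cst _ (u ((D.loc p).symm y.1)) :=
    hsc.eventually (Filter.Eventually.and ((D.dom p').isOpen.mem_nhds hx')
      ((hu.continuousAt.eventually_ne hu0).and h))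
  refine ⟨?_, ?_⟩
  · filter_upwards [hev, hev2] with y hy hy2
    refine ⟨hy, hy2.1, ordEq_sec_iff.2 ?_⟩
    simp [hy2.2.2]
  · have h1 : ContDiffAt ℂ ω (fun y : (Fin n → ℂ) × ℂ =>
        (D.loc p' ((D.loc p).symm y.1), u ((D.loc p).symm y.1) * y.2)) z := by
      have hs' : ContMDiffAt 𝓘(ℂ, (Fin n → ℂ) × ℂ) 𝓘(ℂ, Fin n → ℂ) ω
          (fun y : (Fin n → ℂ) × ℂ => (D.loc p).symm y.1) z :=
        ContMDiffAt.comp z hs contDiffAt_fst.contMDiffAt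
      refine ContDiffAt.prodMk ?_ (ContDiffAt.mul ?_ contDiffAt_snd)
      · exact contMDiffAt_iff_contDiffAt.1 (ContMDiffAt.comp z (contMDiffAt_loc hx') hs')
      · exact contMDiffAt_iff_contDiffAt.1 (ContMDiffAt.comp z (by exact hu) hs')
    refine h1.congr_of_eventuallyEq ?_
    filter_upwards [hev, hev2] with y hy hy2
    refine Prod.ext rfl ?_
    change quo (D.mono p' m') (D.sec (D.mono p m) ((D.loc p).symm y.1, y.2)) = _
    simp only [quo, sec, coef_mul, Units.val_mul, hy2.2.2, coef_cst hy2.2.1, coef_cst hy.2]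
    field_simp

variable (D) in
/-- The atlas of the charts `fibChart`. -/
def fibCore : ChartedSpaceCore ((Fin n → ℂ) × ℂ) (Σ x, D.Fib x) where
  atlas := Set.range fun q : Σ p, D.Through p → ℤ => D.fibChart q.1 q.2
  chartAt v := D.fibChart v.1 (ord v.2)
  mem_chart_source v := ⟨D.mem_dom_self v.1, ordEq_mono_self v⟩
  chart_mem_atlas v := ⟨⟨v.1, ord v.2⟩, rfl⟩
  open_source := by
    rintro _ _ ⟨q, rfl⟩ ⟨q', rfl⟩
    exact isOpen_iff_mem_nhds.2 fun z hz => (fibChart_transition hz).1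
  continuousOn_toFun := by
    rintro _ _ ⟨q, rfl⟩ ⟨q', rfl⟩ z hz
    exact (fibChart_transition hz).2.continuousAt.continuousWithinAt

instance : TopologicalSpace (Σ x, D.Fib x) := D.fibCore.toTopologicalSpace

instance : ChartedSpace ((Fin n → ℂ) × ℂ) (Σ x, D.Fib x) := D.fibCore.toChartedSpace

instance : IsManifold 𝓘(ℂ, (Fin n → ℂ) × ℂ) ω (Σ x, D.Fib x) := by
  refine isManifold_of_contDiffOn _ _ _ fun e e' he he' => ?_
  obtain ⟨_, ⟨_, rfl⟩, _, ⟨⟨q, rfl⟩, rfl⟩, h⟩ := he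
  obtain ⟨_, ⟨_, rfl⟩, _, ⟨⟨q', rfl⟩, rfl⟩, h'⟩ := he'
  rw [Set.mem_singleton_iff] at h h'
  subst h h'
  intro z hz
  exact (fibChart_transition (hz.1 : z ∈ ((D.fibChart q.1 q.2).symm.trans
    (D.fibChart q'.1 q'.2)).source)).2.contDiffWithinAt

variable (D) in
/-- The chart `fibChart`, as an open partial homeomorphism. -/
def fibHomeo (p : X) (m : D.Through p → ℤ) :
    OpenPartialHomeomorph (Σ x, D.Fib x) ((Fin n → ℂ) × ℂ) :=
  D.fibCore.openPartialHomeomorph (D.fibChart p m) ⟨⟨p, m⟩, rfl⟩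

theorem fibHomeo_mem_maximalAtlas (p : X) (m : D.Through p → ℤ) :
    D.fibHomeo p m ∈
      IsManifold.maximalAtlas 𝓘(ℂ, (Fin n → ℂ) × ℂ) ω (Σ x, D.Fib x) := by
  refine StructureGroupoid.subset_maximalAtlas _ ?_
  exact Set.mem_iUnion₂.2 ⟨D.fibChart p m, ⟨⟨p, m⟩, rfl⟩, rfl⟩

theorem contMDiff_fib_fst : ContMDiff 𝓘(ℂ, (Fin n → ℂ) × ℂ) 𝓘(ℂ, Fin n → ℂ) ω
    (fun v : Σ x, D.Fib x => v.1) := by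
  intro v
  set e := D.fibHomeo v.1 (ord v.2)
  have hv : v ∈ e.source := ⟨D.mem_dom_self v.1, ordEq_mono_self v⟩
  have h1 := contMDiffAt_of_mem_maximalAtlas (fibHomeo_mem_maximalAtlas v.1 (ord v.2)) hv
  have h2 : ContMDiffAt 𝓘(ℂ, (Fin n → ℂ) × ℂ) 𝓘(ℂ, Fin n → ℂ) ω
      (fun w => (D.loc v.1).symm (e w).1) v :=
    ContMDiffAt.comp v (contMDiffAt_loc_symm v.1 ((D.loc v.1).map_source (D.mem_dom_self v.1)))
      (ContMDiffAt.comp v (contDiffAt_fst (𝕜 := ℂ)).contMDiffAt h1)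
  refine h2.congr_of_eventuallyEq ?_
  filter_upwards [e.open_source.mem_nhds hv] with w hw
  exact ((D.loc v.1).left_inv hw.1).symm

/-- The values of a meromorphic unit depend holomorphically on the point. -/
theorem contMDiffAt_sec {U : Opens X} {f : X → ℂ} (hf : D.IsMerUnit U f) {z : X × ℂ}
    (hz : z.1 ∈ U) (hz0 : z.2 ≠ 0) :
    ContMDiffAt (𝓘(ℂ, Fin n → ℂ).prod 𝓘(ℂ, ℂ)) 𝓘(ℂ, (Fin n → ℂ) × ℂ) ω (D.sec f) z := by
  set m := ord (D.value z.1 f)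
  set e := D.fibHomeo z.1 m
  have hd := D.mem_dom_self z.1
  obtain ⟨u, hu, hu0, -, h⟩ := exists_eq_mul_of_ord_eq hf (D.isMerUnit_mono z.1 m) hz hd
    (by rw [value_mono_self, ord_fib])
  have ht : (D.loc z.1 z.1, u z.1 * z.2) ∈ e.target :=
    ⟨(D.loc z.1).map_source hd, mul_ne_zero hu0 hz0⟩
  have h1 := contMDiffAt_symm_of_mem_maximalAtlas (fibHomeo_mem_maximalAtlas z.1 m) ht
  have h2 : ContMDiffAt (𝓘(ℂ, Fin n → ℂ).prod 𝓘(ℂ, ℂ)) 𝓘(ℂ, (Fin n → ℂ) × ℂ) ω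
      (fun y : X × ℂ => (D.loc z.1 y.1, u y.1 * y.2)) z := by
    refine ContMDiffAt.prodMk_space ?_ (ContMDiffAt.mul ?_ contMDiffAt_snd)
    · exact ContMDiffAt.comp z (contMDiffAt_loc hd) contMDiffAt_fst
    · exact ContMDiffAt.comp z hu contMDiffAt_fst
  refine (ContMDiffAt.comp z h1 h2).congr_of_eventuallyEq ?_
  have h3 : ∀ᶠ y : X × ℂ in 𝓝 z, y.1 ∈ D.dom z.1 ∧ u y.1 ≠ 0 ∧
      D.value y.1 f = D.value y.1 (D.mono z.1 m) * D.cst y.1 (u y.1) :=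
    (continuous_fst.tendsto z).eventually (Filter.Eventually.and ((D.dom z.1).isOpen.mem_nhds hd)
      ((hu.continuousAt.eventually_ne hu0).and h))
  filter_upwards [h3, continuous_snd.continuousAt.eventually_ne hz0] with y hy hy0
  change _ = D.sec (D.mono z.1 m) ((D.loc z.1).symm (D.loc z.1 y.1), u y.1 * y.2)
  rw [(D.loc z.1).left_inv hy.1, sec, sec]
  simp only [hy.2.2, cst_mul hy.2.1 hy0, mul_assoc]

/-- Being the value of a constant multiple of `f` is an open condition, and the constant depends
holomorphically on the value. -/
theorem contMDiffAt_quo {U : Opens X} {f : X → ℂ} (hf : D.IsMerUnit U f) {v : Σ x, D.Fib x}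
    (hv : v.1 ∈ U) (h0 : OrdEq f v) :
    ContMDiffAt 𝓘(ℂ, (Fin n → ℂ) × ℂ) 𝓘(ℂ, ℂ) ω (quo (D := D) f) v ∧
      ∀ᶠ w in 𝓝 v, OrdEq f w := by
  set m := ord v.2
  set e := D.fibHomeo v.1 m
  have hd := D.mem_dom_self v.1
  have hve : v ∈ e.source := ⟨hd, ordEq_mono_self v⟩
  obtain ⟨u, hu, hu0, -, h⟩ := exists_eq_mul_of_ord_eq hf (D.isMerUnit_mono v.1 m) hv hd
    (by rw [value_mono_self, ord_fib]; exact h0.symm)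
  have h1 := contMDiffAt_of_mem_maximalAtlas (fibHomeo_mem_maximalAtlas v.1 m) hve
  have h2 : ContMDiffAt 𝓘(ℂ, (Fin n → ℂ) × ℂ) 𝓘(ℂ, ℂ) ω (fun w => (e w).2) v :=
    ContMDiffAt.comp v (contDiffAt_snd (𝕜 := ℂ)).contMDiffAt h1
  have h3 : ContMDiffAt 𝓘(ℂ, (Fin n → ℂ) × ℂ) 𝓘(ℂ, ℂ) ω (fun w : Σ x, D.Fib x => u w.1) v :=
    ContMDiffAt.comp v hu contMDiff_fib_fst.contMDiffAt
  have h4 : ∀ᶠ w : Σ x, D.Fib x in 𝓝 v, u w.1 ≠ 0 ∧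
      D.value w.1 f = D.value w.1 (D.mono v.1 m) * D.cst w.1 (u w.1) :=
    (contMDiff_fib_fst (D := D)).continuous.continuousAt.eventually
      ((hu.continuousAt.eventually_ne hu0).and h)
  refine ⟨(h2.div₀ h3 hu0).congr_of_eventuallyEq ?_, ?_⟩
  · filter_upwards [h4] with w hw
    change _ = quo (D.mono v.1 m) w / u w.1
    simp only [quo, hw.2, coef_mul, Units.val_mul, coef_cst hw.1]
    rw [div_div]
  · filter_upwards [h4, e.open_source.mem_nhds hve] with w hw hwe
    rw [OrdEq, hw.2, ord_mul, ord_cst, add_zero]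
    exact hwe.2

/-- A map to the family of groups is holomorphic if its base point is, and it is the value of
`c f` for a meromorphic unit `f` and a holomorphic factor `c`. -/
theorem contMDiffWithinAt_of_eq_sec {E' H' M' : Type*} [NormedAddCommGroup E'] [NormedSpace ℂ E']
    [TopologicalSpace H'] {I : ModelWithCorners ℂ E' H'} [TopologicalSpace M']
    [ChartedSpace H' M'] {G : M' → Σ x, D.Fib x} {S : Set M'} {z : M'} {U : Opens X} {f : X → ℂ}
    (hf : D.IsMerUnit U f) {b : M' → X} {c : M' → ℂ}
    (hb : ContMDiffWithinAt I 𝓘(ℂ, Fin n → ℂ) ω b S z)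
    (hc : ContMDiffWithinAt I 𝓘(ℂ, ℂ) ω c S z) (hbz : b z ∈ U) (hcz : c z ≠ 0)
    (h : ∀ᶠ y in 𝓝[S] z, G y = D.sec f (b y, c y)) (hz : G z = D.sec f (b z, c z)) :
    ContMDiffWithinAt I 𝓘(ℂ, (Fin n → ℂ) × ℂ) ω G S z :=
  ContMDiffWithinAt.congr_of_eventuallyEq (f := fun y => D.sec f (b y, c y))
    (ContMDiffAt.comp_contMDiffWithinAt z (contMDiffAt_sec hf (z := (b z, c z)) hbz hcz)
      (hb.prodMk hc)) h hz

end SNCDivisor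

namespace SNCDivisor

variable {n : ℕ} {X : Type u} [TopologicalSpace X] [ChartedSpace (Fin n → ℂ) X]
  {D : SNCDivisor.{u, v} n X}

/-! ### The family of groups and the sheaf of meromorphic units -/

theorem isSubmersion_fib_fst : Manifold.IsSubmersion 𝓘(ℂ, (Fin n → ℂ) × ℂ) 𝓘(ℂ, Fin n → ℂ) ω
    (fun v : Σ x, D.Fib x => v.1) := by
  refine Manifold.IsSubmersionOfComplement.isSubmersion (F := ℂ) fun v => ?_
  refine Manifold.IsSubmersionAtOfComplement.mk_of_charts (ContinuousLinearEquiv.refl ℂ _)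
    (D.fibHomeo v.1 (ord v.2)) (D.loc v.1) ⟨D.mem_dom_self v.1, ordEq_mono_self v⟩
    (D.mem_loc_source v.1) (fibHomeo_mem_maximalAtlas _ _) (D.loc_mem_maximalAtlas _)
    (fun w hw => hw.1) fun z hz => ?_
  have hz' : z ∈ (D.fibHomeo v.1 (ord v.2)).target := by simpa using hz
  exact (D.loc v.1).right_inv hz'.1

/-- The value of a product at a point is computed from the values of the factors. -/
theorem eq_sec_mul {U : Opens X} {f g : X → ℂ} (hf : D.IsMerUnit U f) (hg : D.IsMerUnit U g)
    {x : X} (hx : x ∈ U) {a b : D.Fib x} (ha : OrdEq f ⟨x, a⟩) (hb : OrdEq g ⟨x, b⟩) :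
    (⟨x, a * b⟩ : Σ x, D.Fib x) =
      D.sec (fun y => f y * g y) (x, quo f ⟨x, a⟩ * quo g ⟨x, b⟩) := by
  have h1 : a = D.value x f * D.cst x (quo f ⟨x, a⟩) := eq_mul_cst_of_ord_eq ha
  have h2 : b = D.value x g * D.cst x (quo g ⟨x, b⟩) := eq_mul_cst_of_ord_eq hb
  conv_lhs => rw [h1, h2]
  simp only [sec, hf.value_mul hg hx, cst_mul (quo_ne_zero f _) (quo_ne_zero g _)]
  rw [mul_mul_mul_comm]

theorem IsMerUnit.inv {U : Opens X} {f : X → ℂ} (hf : D.IsMerUnit U f) :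
    D.IsMerUnit U (fun y => (f y)⁻¹) where
  holomorphic := hf.holomorphic.inv₀ hf.ne_zero
  ne_zero x hx := inv_ne_zero (hf.ne_zero x hx)
  meromorphic x hx := by
    obtain ⟨p, q, hp, hq, h⟩ := hf.meromorphic x hx
    refine ⟨q, p, hq, hp, ?_⟩
    filter_upwards [h, U.isOpen.mem_nhds hx] with y h hU hy
    have h1 := hf.ne_zero y ⟨hU, hy⟩
    rw [(h hy).2] at h1 ⊢
    exact ⟨fun h2 => h1 (by rw [h2, zero_div]), by rw [inv_div]⟩

theorem sec_one (f : X → ℂ) (x : X) : D.sec f (x, 1) = ⟨x, D.value x f⟩ := by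
  simp [sec, cst_one]

theorem isSection_value {U : Opens X} {f : X → ℂ} (hf : D.IsMerUnit U f) :
    IsSection (E := Fin n → ℂ) (EM := (Fin n → ℂ) × ℂ) D.Fib U (fun x => D.value x f) := by
  intro x hx
  refine contMDiffWithinAt_of_eq_sec hf (b := id) (c := fun _ => 1) contMDiffWithinAt_id
    contMDiffWithinAt_const hx one_ne_zero (Eventually.of_forall fun y => (sec_one f y).symm)
    (sec_one f x).symm

theorem value_one (x : X) : D.value x (fun _ => 1) = 1 := by
  rw [value_const one_ne_zero, cst_one]

variable (D) in
/-- Inverses and products of the values of meromorphic units are the values of their inverses and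
products, which gives the holomorphy of the operations. -/
theorem isFamilyOfAbelianGroups_fib [IsManifold 𝓘(ℂ, Fin n → ℂ) ω X] :
    IsFamilyOfAbelianGroups (E := Fin n → ℂ) (EM := (Fin n → ℂ) × ℂ) D.Fib where
  proj_submersion := isSubmersion_fib_fst
  one_holomorphic := by
    have h := isSection_value (D := D) (isMerUnit_const one_ne_zero ⊤)
    simp only [value_one] at h
    exact contMDiffOn_univ.1 h
  inv_holomorphic := by
    rintro ⟨x, a⟩
    set f := D.mono x (ord a)
    have hf : D.IsMerUnit (D.dom x) f := D.isMerUnit_mono _ _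
    have h0 : OrdEq f (⟨x, a⟩ : Σ x, D.Fib x) := ordEq_mono_self ⟨x, a⟩
    have hq := contMDiffAt_quo hf (D.mem_dom_self x) h0
    have hd : ∀ᶠ w : Σ x, D.Fib x in 𝓝 ⟨x, a⟩, w.1 ∈ D.dom x :=
      contMDiff_fib_fst.continuous.continuousAt.eventually
        ((D.dom x).isOpen.mem_nhds (D.mem_dom_self x))
    have key : ∀ w : Σ x, D.Fib x, w.1 ∈ D.dom x → OrdEq f w →
        (⟨w.1, w.2⁻¹⟩ : Σ x, D.Fib x) = D.sec (fun y => (f y)⁻¹) (w.1, (quo f w)⁻¹) := by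
      rintro ⟨y, b⟩ hy hb
      have h1 : b = D.value y f * D.cst y (quo f ⟨y, b⟩) := eq_mul_cst_of_ord_eq hb
      have h2 : D.value y (fun z => (f z)⁻¹) = (D.value y f)⁻¹ := (hf.isValue hy).inv.value_eq
      simp only [sec, cst_inv (quo_ne_zero _ _), h2]
      conv_lhs => rw [h1]
      rw [mul_inv]
    refine contMDiffWithinAt_of_eq_sec hf.inv (b := fun w => w.1) (c := fun w => (quo f w)⁻¹)
      contMDiff_fib_fst.contMDiffAt (hq.1.inv₀ (quo_ne_zero _ _)) (D.mem_dom_self x)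
      (inv_ne_zero (quo_ne_zero _ _)) ?_ (key _ (D.mem_dom_self x) h0)
    rw [nhdsWithin_univ]
    filter_upwards [hq.2, hd] with w h1 h2
    exact key w h2 h1
  mul_holomorphic := by
    classical
    refine ⟨fun p => if h : p.1.1 = p.2.1 then ⟨p.2.1, (h ▸ p.1.2) * p.2.2⟩ else p.1,
      fun x a b => by simp, ?_⟩
    rintro ⟨⟨x, a⟩, ⟨x', b⟩⟩ (h : x = x')
    subst h
    set f := D.mono x (ord a)
    set g := D.mono x (ord b)
    have hf : D.IsMerUnit (D.dom x) f := D.isMerUnit_mono _ _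
    have hg : D.IsMerUnit (D.dom x) g := D.isMerUnit_mono _ _
    have hqf := contMDiffAt_quo hf (D.mem_dom_self x) (ordEq_mono_self ⟨x, a⟩)
    have hqg := contMDiffAt_quo hg (D.mem_dom_self x) (ordEq_mono_self ⟨x, b⟩)
    have key : ∀ p : (Σ x, D.Fib x) × (Σ x, D.Fib x), p.1.1 = p.2.1 → p.1.1 ∈ D.dom x →
        OrdEq f p.1 → OrdEq g p.2 →
        (if h : p.1.1 = p.2.1 then (⟨p.2.1, (h ▸ p.1.2) * p.2.2⟩ : Σ x, D.Fib x) else p.1) =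
          D.sec (fun y => f y * g y) (p.1.1, quo f p.1 * quo g p.2) := by
      rintro ⟨⟨y, c⟩, ⟨y', d⟩⟩ (h : y = y') hy h1 h2
      subst h
      simpa using eq_sec_mul hf hg hy h1 h2
    have hc1 : Tendsto Prod.fst (𝓝[{p : (Σ x, D.Fib x) × (Σ x, D.Fib x) | p.1.1 = p.2.1}]
        ((⟨x, a⟩ : Σ x, D.Fib x), (⟨x, b⟩ : Σ x, D.Fib x))) (𝓝 ⟨x, a⟩) :=
      continuousAt_fst.tendsto.mono_left nhdsWithin_le_nhds
    have hc2 : Tendsto Prod.snd (𝓝[{p : (Σ x, D.Fib x) × (Σ x, D.Fib x) | p.1.1 = p.2.1}]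
        ((⟨x, a⟩ : Σ x, D.Fib x), (⟨x, b⟩ : Σ x, D.Fib x))) (𝓝 ⟨x, b⟩) :=
      continuousAt_snd.tendsto.mono_left nhdsWithin_le_nhds
    have hd : ∀ᶠ w : Σ x, D.Fib x in 𝓝 ⟨x, a⟩, w.1 ∈ D.dom x :=
      contMDiff_fib_fst.continuous.continuousAt.eventually
        ((D.dom x).isOpen.mem_nhds (D.mem_dom_self x))
    refine contMDiffWithinAt_of_eq_sec (hf.mul hg) (b := fun p => p.1.1)
      (c := fun p => quo f p.1 * quo g p.2) ?_ ?_ (D.mem_dom_self x)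
      (mul_ne_zero (quo_ne_zero _ _) (quo_ne_zero _ _)) ?_
      (key _ rfl (D.mem_dom_self x) (ordEq_mono_self ⟨x, a⟩) (ordEq_mono_self ⟨x, b⟩))
    · exact ContMDiffAt.contMDiffWithinAt (ContMDiffAt.comp
        ((⟨x, a⟩ : Σ x, D.Fib x), (⟨x, b⟩ : Σ x, D.Fib x)) contMDiff_fib_fst.contMDiffAt
          contMDiffAt_fst)
    · refine ContMDiffAt.contMDiffWithinAt (ContMDiffAt.mul ?_ ?_)
      · exact ContMDiffAt.comp ((⟨x, a⟩ : Σ x, D.Fib x), (⟨x, b⟩ : Σ x, D.Fib x)) hqf.1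
          (contMDiffAt_fst (J := 𝓘(ℂ, (Fin n → ℂ) × ℂ)))
      · exact ContMDiffAt.comp ((⟨x, a⟩ : Σ x, D.Fib x), (⟨x, b⟩ : Σ x, D.Fib x)) hqg.1
          (contMDiffAt_snd (I := 𝓘(ℂ, (Fin n → ℂ) × ℂ)))
    · filter_upwards [hc1.eventually hqf.2, hc2.eventually hqg.2, hc1.eventually hd,
        self_mem_nhdsWithin] with p h1 h2 h3 h4
      exact key p h4 h3 h1 h2

theorem value_of_notMem {U : Opens X} {f : X → ℂ} (hf : D.IsMerUnit U f) {x : X} (hx : x ∈ U)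
    (hD : x ∉ D.support) : D.value x f = D.cst x (f x) :=
  (isValue_of_continuousAt (hf.holAt hx hD).continuousAt (hf.ne_zero x ⟨hx, hD⟩)).value_eq

theorem eventually_notMem_support {x : X} (hx : x ∉ D.support) : ∀ᶠ y in 𝓝 x, y ∉ D.support := by
  filter_upwards [(D.dom x).isOpen.mem_nhds (D.mem_dom_self x)] with y hy
  exact D.notMem_support.2 fun i hi => D.notMem_support.1 hx i (D.mem_of_mem_dom hy hi)

/-- Near each point, a section is a holomorphic multiple of the values of a monomial. -/
theorem exists_section_eq {U : Opens X} {s : ∀ x, D.Fib x}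
    (hs : IsSection (E := Fin n → ℂ) (EM := (Fin n → ℂ) × ℂ) D.Fib U s) {x : X} (hx : x ∈ U) :
    ∃ c : X → ℂ, HolAt n c x ∧ (∀ y, c y ≠ 0) ∧
      ∀ᶠ y in 𝓝 x, s y = D.value y (D.mono x (ord (s x))) * D.cst y (c y) := by
  have hq := contMDiffAt_quo (D.isMerUnit_mono x (ord (s x))) (v := ⟨x, s x⟩) (D.mem_dom_self x)
    (ordEq_mono_self ⟨x, s x⟩)
  have hsx := hs.contMDiffAt (U.isOpen.mem_nhds hx)
  refine ⟨fun y => quo (D.mono x (ord (s x))) ⟨y, s y⟩, ContMDiffAt.comp x hq.1 hsx,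
    fun y => quo_ne_zero _ _, ?_⟩
  filter_upwards [hsx.continuousAt.eventually hq.2] with y hy
  exact eq_mul_cst_of_ord_eq hy

/-- A section of the family, restricted to the complement of `D`, is a function. -/
theorem exists_coef_eq {U : Opens X} {s : ∀ x, D.Fib x}
    (hs : IsSection (E := Fin n → ℂ) (EM := (Fin n → ℂ) × ℂ) D.Fib U s) {x : X} (hx : x ∈ U) :
    ∃ c : X → ℂ, HolAt n c x ∧ c x ≠ 0 ∧ s x = D.value x (D.mono x (ord (s x))) * D.cst x (c x) ∧
      ∀ᶠ y in 𝓝 x, y ∉ D.support → (coef (s y) : ℂ) = D.mono x (ord (s x)) y * c y := by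
  obtain ⟨c, hc, hc0, h⟩ := exists_section_eq hs hx
  refine ⟨c, hc, hc0 x, h.self_of_nhds, ?_⟩
  filter_upwards [h, (D.dom x).isOpen.mem_nhds (D.mem_dom_self x)] with y hy hyd hD
  rw [hy, value_of_notMem (D.isMerUnit_mono _ _) hyd hD, coef_mul, Units.val_mul,
    coef_cst (hc0 y), coef_cst (D.mono_ne_zero hyd hD _)]

theorem isMerUnit_coef {U : Opens X} {s : ∀ x, D.Fib x}
    (hs : IsSection (E := Fin n → ℂ) (EM := (Fin n → ℂ) × ℂ) D.Fib U s) :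
    D.IsMerUnit U (fun x => (coef (s x) : ℂ)) where
  holomorphic x hx := by
    obtain ⟨c, hc, -, -, h⟩ := exists_coef_eq hs hx.1
    have h1 : HolAt n (fun y => D.mono x (ord (s x)) y * c y) x :=
      ((D.isMerUnit_mono x (ord (s x))).holAt (D.mem_dom_self x) hx.2).mul hc
    refine (h1.congr_of_eventuallyEq ?_).contMDiffWithinAt
    filter_upwards [h, eventually_notMem_support hx.2] with y h1 h2
    exact h1 h2
  ne_zero x _ := (coef (s x)).ne_zero
  meromorphic x hx := by
    obtain ⟨c, hc, -, -, h⟩ := exists_coef_eq hs hx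
    obtain ⟨p, q, hp, hq, hpq⟩ := (D.isMerUnit_mono x (ord (s x))).meromorphic x (D.mem_dom_self x)
    refine ⟨fun y => p y * c y, q, hp.mul hc, hq, ?_⟩
    filter_upwards [h, hpq] with y h1 h2 hD
    exact ⟨(h2 hD).1, by rw [h1 hD, (h2 hD).2, div_mul_eq_mul_div]⟩

theorem value_coef {U : Opens X} {s : ∀ x, D.Fib x}
    (hs : IsSection (E := Fin n → ℂ) (EM := (Fin n → ℂ) × ℂ) D.Fib U s) {x : X} (hx : x ∈ U) :
    D.value x (fun x => (coef (s x) : ℂ)) = s x := by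
  obtain ⟨c, hc, hc0, hsx, h⟩ := exists_coef_eq hs hx
  rw [hsx]
  exact (((D.isMerUnit_mono x (ord (s x))).isValue (D.mem_dom_self x)).mul_cst hc.continuousAt hc0
    (eventually_off h)).value_eq

/-- A section of the family is recovered from its constant coefficient off `D`. -/
theorem isSheafIso_value : D.IsSheafIso (EM := (Fin n → ℂ) × ℂ) D.Fib
    (fun _ f x => D.value x f) where
  isSection _ _ hf := isSection_value hf
  map_mul _ _ _ hf hg _ hx := hf.value_mul hg hx
  map_restrict U W f g hWU hf hg h x hx := by
    refine (((hf.isValue (hWU hx)).congr (eventually_off ?_)).value_eq).symm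
    filter_upwards [W.isOpen.mem_nhds hx] with y hy hD
    exact h y ⟨hy, hD⟩
  injective U f g hf hg h x hx := by
    have h1 := congrArg (fun v => (coef v : ℂ)) (h x hx.1)
    simpa [value_of_notMem hf hx.1 hx.2, value_of_notMem hg hx.1 hx.2,
      coef_cst (hf.ne_zero x hx), coef_cst (hg.ne_zero x hx)] using h1
  surjective U s hs := ⟨_, isMerUnit_coef hs, fun _ hx => value_coef hs hx⟩

/-- The family is not locally trivial along `D`: off `D` the fibres are `2`-divisible. -/
theorem exists_isEmpty_mulEquiv {x : X} (hx : x ∈ D.support) {U : Set X} (hU : U ∈ 𝓝 x) :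
    ∃ y ∈ U, IsEmpty (D.Fib x ≃* D.Fib y) := by
  obtain ⟨y, hyU, hyD⟩ : ∃ y, y ∈ U ∧ y ∉ D.support :=
    ((Filter.Eventually.and (nhdsWithin_le_nhds hU) self_mem_nhdsWithin :
      ∀ᶠ y in 𝓝[D.supportᶜ] x, y ∈ U ∧ y ∉ D.support)).exists
  refine ⟨y, hyU, ⟨fun e => ?_⟩⟩
  obtain ⟨i, hi⟩ : ∃ i, x ∈ D.comp i := by simpa [support] using hx
  set v := e (D.fib x 1 (fun _ => 1))
  obtain ⟨c, hc⟩ := IsAlgClosed.exists_pow_nat_eq (coef v : ℂ) (n := 2) two_pos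
  have hc0 : c ≠ 0 := by
    rintro rfl
    exact (coef v).ne_zero (by rw [← hc]; simp)
  have hv : v = D.cst y c * D.cst y c := by
    refine fib_ext (Units.ext ?_) (funext fun j => absurd j.2 (D.notMem_support.1 hyD j))
    rw [coef_mul, Units.val_mul, coef_cst hc0, ← hc, sq]
  have h1 : D.fib x 1 (fun _ => 1) = e.symm (D.cst y c) * e.symm (D.cst y c) := by
    rw [← map_mul, ← hv, e.symm_apply_apply]
  have h2 := congrFun (congrArg ord h1) ⟨i, hi⟩
  simp only [ord_fib, ord_mul, Pi.add_apply] at h2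
  omega

end SNCDivisor

namespace SNCDivisor

variable {n : ℕ} {X : Type u} [TopologicalSpace X] [ChartedSpace (Fin n → ℂ) X]
  {D : SNCDivisor.{u, v} n X}

/-! ### The complex manifold structure on the arrows of `Pair(X, D)` -/

/-- Replacing the defining functions multiplies the scales by holomorphic units. -/
theorem exists_scale_change {i : D.ι} {U W U' W' : Opens X} {h k h' k' : X → ℂ}
    (hh : D.IsDefiningFunction i U h) (hk : D.IsDefiningFunction i W k)
    (hh' : D.IsDefiningFunction i U' h') (hk' : D.IsDefiningFunction i W' k') {x y : X}
    (hx : x ∈ U) (hy : y ∈ W) (hx' : x ∈ U') (hy' : y ∈ W') :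
    ∃ q r : X → ℂ, HolAt n q x ∧ HolAt n r y ∧ q x ≠ 0 ∧ r y ≠ 0 ∧
      ∃ A ∈ 𝓝 x, ∃ B ∈ 𝓝 y, ∀ g : Arr D.pair, g.1 ∈ A → g.2.1 ∈ B →
        scale i h' k' g = scale i h k g * r g.2.1 / q g.1 := by
  obtain ⟨q, hq, hq0, hhq⟩ := hh'.exists_eq_mul hh hx' hx
  obtain ⟨r, hr, hr0, hkr⟩ := hk'.exists_eq_mul hk hy' hy
  have hU : ∀ᶠ z in 𝓝 x, z ∈ U := U.isOpen.mem_nhds hx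
  have hU' : ∀ᶠ z in 𝓝 x, z ∈ U' := U'.isOpen.mem_nhds hx'
  have hW : ∀ᶠ z in 𝓝 y, z ∈ W := W.isOpen.mem_nhds hy
  have hW' : ∀ᶠ z in 𝓝 y, z ∈ W' := W'.isOpen.mem_nhds hy'
  refine ⟨q, r, hq, hr, hq0, hr0, _, hU.and (hU'.and ((eventually_eventually_nhds.2 hhq).and
      ((D.eventually_holAt hq).and (hq.continuousAt.eventually_ne hq0)))), _,
    hW.and (hW'.and ((eventually_eventually_nhds.2 hkr).and (D.eventually_holAt hr))), ?_⟩
  rintro ⟨a, b, g⟩ ⟨h1, h2, h3, h4, h5⟩ ⟨h6, h7, h8, h9⟩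
  exact ((isScale_scale hh hk h1 h6 g).change hh hk h1 h6 h4 h9 h5 h3 h8).scale_eq hh' hk' h2 h7

/-- The scale with respect to the local coordinates that define `D`. -/
def scl (p q : X) (i : D.ι) (g : Arr D.pair) : ℂ := scale i (D.zeta p i) (D.zeta q i) g

section ArrowChart

variable {p q : X}

theorem isScale_scl {x y : X} (hx : x ∈ D.dom p) (hy : y ∈ D.dom q) (i : D.ι)
    (g : D.PairHom x y) : D.IsScale i (D.zeta p i) (D.zeta q i) g (scl p q i ⟨x, y, g⟩) :=
  isScale_scale (D.isDefiningFunction_zeta p i) (D.isDefiningFunction_zeta q i) hx hy g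

theorem scl_eq {x y : X} (hx : x ∈ D.dom p) (hy : y ∈ D.dom q) {i : D.ι}
    {g : D.PairHom x y} {a : ℂ} (h : D.IsScale i (D.zeta p i) (D.zeta q i) g a) :
    scl p q i ⟨x, y, g⟩ = a :=
  h.scale_eq (D.isDefiningFunction_zeta p i) (D.isDefiningFunction_zeta q i) hx hy

theorem scl_ne_zero {g : Arr D.pair} (hx : g.1 ∈ D.dom p) (hy : g.2.1 ∈ D.dom q) (i : D.ι) :
    scl p q i g ≠ 0 :=
  (isScale_scl hx hy i g.2.2).ne_zero (D.isDefiningFunction_zeta p i)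
    (D.isDefiningFunction_zeta q i) hx hy

/-- The scale is the quotient of the defining functions at target and source. -/
theorem zeta_target {g : Arr D.pair} (hx : g.1 ∈ D.dom p) (hy : g.2.1 ∈ D.dom q) (i : D.ι) :
    D.zeta q i g.2.1 = scl p q i g * D.zeta p i g.1 := by
  by_cases hi : g.1 ∈ D.comp i
  · rw [(D.zeta_eq_zero_iff hx i).2 hi,
      (D.zeta_eq_zero_iff hy i).2 ((g.2.2.mem_iff i).1 hi), mul_zero]
  · exact (isScale_scl hx hy i g.2.2).off hi

/-- The chart of an arrow: the coordinates of the source, the scales, and those coordinates of the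
target that do not define a component of `D`. -/
def arrCoord (p q : X) (g : Arr D.pair) : (Fin n → ℂ) × (Fin n → ℂ) :=
  (D.loc p g.1, Function.extend (D.idx q) (fun i => scl p q i g) (D.loc q g.2.1))

/-- The coordinates of the target of an arrow with given coordinates: those that define `D` are the
products of the scales and the coordinates of the source. -/
def arrTarget (h : ∀ i, p ∈ D.comp i ↔ q ∈ D.comp i) (z : (Fin n → ℂ) × (Fin n → ℂ)) : Fin n → ℂ :=
  Function.extend (D.idx q) (fun i => z.2 (D.idx q i) * z.1 (D.idx p ⟨i, (h i).2 i.2⟩)) z.2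

theorem arrTarget_arrCoord (h : ∀ i, p ∈ D.comp i ↔ q ∈ D.comp i) {g : Arr D.pair}
    (hx : g.1 ∈ D.dom p) (hy : g.2.1 ∈ D.dom q) :
    arrTarget h (arrCoord p q g) = D.loc q g.2.1 := by
  funext j
  by_cases hj : ∃ i, D.idx q i = j
  · obtain ⟨i, rfl⟩ := hj
    rw [arrTarget, (D.idx_injective q).extend_apply]
    simp only [arrCoord, (D.idx_injective q).extend_apply]
    rw [← D.zeta_of_mem i.2, zeta_target hx hy, D.zeta_of_mem ((h i).2 i.2)]
  · rw [arrTarget, Function.extend_apply' _ _ _ hj]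
    simp only [arrCoord, Function.extend_apply' _ _ _ hj]

/-- The coordinates separate arrows and take all values for which the point `arrTarget` is defined
and the scales are not zero. -/
theorem bijOn_arrCoord (h : ∀ i, p ∈ D.comp i ↔ q ∈ D.comp i) :
    Set.BijOn (arrCoord (D := D) p q) {g | g.1 ∈ D.dom p ∧ g.2.1 ∈ D.dom q}
      {z | z.1 ∈ (D.loc p).target ∧ arrTarget h z ∈ (D.loc q).target ∧
        ∀ i, z.2 (D.idx q i) ≠ 0} := by
  refine ⟨?_, ?_, ?_⟩
  · rintro g ⟨hx, hy⟩
    refine ⟨(D.loc p).map_source hx, ?_, fun i => ?_⟩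
    · rw [arrTarget_arrCoord h hx hy]
      exact (D.loc q).map_source hy
    · simp only [arrCoord, (D.idx_injective q).extend_apply]
      exact scl_ne_zero hx hy _
  · rintro ⟨x, y, g⟩ ⟨hx, hy⟩ ⟨x', y', g'⟩ ⟨hx', hy'⟩ heq
    have h1 : x = x' := (D.loc p).injOn hx hx' (congrArg Prod.fst heq)
    subst h1
    have h2 : y = y' := (D.loc q).injOn hy hy' (by
      have := congrArg (arrTarget h) heq
      rwa [arrTarget_arrCoord h hx hy, arrTarget_arrCoord h hx' hy'] at this)
    subst h2
    have h3 : g = g' := pairHom_ext (fun i => D.zeta p i) (fun i => D.zeta q i)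
      (fun _ => D.dom p) (fun _ => D.dom q) (fun i => D.isDefiningFunction_zeta p i)
      (fun i => D.isDefiningFunction_zeta q i) (fun _ => hx) (fun _ => hy) fun i hi => by
        refine ⟨scl p q i ⟨x, y, g⟩, isScale_scl hx hy i g, ?_⟩
        have h4 : q ∈ D.comp i := (h i).1 (D.mem_of_mem_dom hx hi)
        have h5 := congrFun (congrArg Prod.snd heq) (D.idx q ⟨i, h4⟩)
        simp only [arrCoord, (D.idx_injective q).extend_apply] at h5
        rw [h5]
        exact isScale_scl hx hy i g'
    rw [h3]
  · classical
    rintro ⟨z, v⟩ ⟨hz : z ∈ (D.loc p).target, ht, hv : ∀ i, v (D.idx q i) ≠ 0⟩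
    set x := (D.loc p).symm z
    set y := (D.loc q).symm (arrTarget h (z, v))
    have hx : x ∈ D.dom p := (D.loc p).map_target hz
    have hy : y ∈ D.dom q := (D.loc q).map_target ht
    have hzeta : ∀ i (hi : q ∈ D.comp i), D.zeta q i y = v (D.idx q ⟨i, hi⟩) * D.zeta p i x := by
      intro i hi
      rw [D.zeta_of_mem hi, D.zeta_of_mem ((h i).2 hi), (D.loc q).right_inv ht,
        (D.loc p).right_inv hz, arrTarget, (D.idx_injective q).extend_apply]
    have hxy : ∀ i, x ∈ D.comp i ↔ y ∈ D.comp i := by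
      intro i
      by_cases hi : q ∈ D.comp i
      · rw [← D.zeta_eq_zero_iff hx, ← D.zeta_eq_zero_iff hy, hzeta i hi]
        simp [hv]
      · exact ⟨fun hc => absurd ((h i).1 (D.mem_of_mem_dom hx hc)) hi,
          fun hc => absurd (D.mem_of_mem_dom hy hc) hi⟩
    obtain ⟨g, hg⟩ := exists_pairHom hxy (fun i => D.zeta p i) (fun i => D.zeta q i)
      (fun _ => D.dom p) (fun _ => D.dom q) (fun i => D.isDefiningFunction_zeta p i)
      (fun i => D.isDefiningFunction_zeta q i) (fun _ => hx) (fun _ => hy)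
      (fun i => if hi : q ∈ D.comp i then v (D.idx q ⟨i, hi⟩) else 1) (fun i _ => by
        split_ifs with hi
        · exact hv _
        · exact one_ne_zero)
    refine ⟨⟨x, y, g⟩, ⟨hx, hy⟩, Prod.ext ((D.loc p).right_inv hz) (funext fun j => ?_)⟩
    by_cases hj : ∃ i, D.idx q i = j
    · obtain ⟨i, rfl⟩ := hj
      simp only [arrCoord, (D.idx_injective q).extend_apply]
      refine scl_eq hx hy ?_
      by_cases hi : x ∈ D.comp i
      · have h1 := hg i hi
        rwa [dif_pos i.2] at h1
      · exact (isScale_iff_off hi).2 (hzeta i i.2)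
    · simp only [arrCoord, Function.extend_apply' _ _ _ hj]
      have h1 : D.loc q y = arrTarget h (z, v) := (D.loc q).right_inv ht
      rw [h1, arrTarget, Function.extend_apply' _ _ _ hj]

variable (D) in
/-- Pairs of points that are joined by an arrow. -/
abbrev Joined : Type u := {r : X × X // ∀ i, r.1 ∈ D.comp i ↔ r.2 ∈ D.comp i}

/-- The chart `arrCoord`, as a partial equivalence. -/
def arrChart (r : D.Joined) : PartialEquiv (Arr D.pair) ((Fin n → ℂ) × (Fin n → ℂ)) :=
  haveI : Nonempty (Arr D.pair) := ⟨idArr D.pair r.1.1⟩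
  (bijOn_arrCoord r.2).toPartialEquiv _ _ _

theorem arrChart_apply (r : D.Joined) (g : Arr D.pair) :
    arrChart r g = arrCoord r.1.1 r.1.2 g := rfl

theorem mem_arrChart_source {r : D.Joined} {g : Arr D.pair} :
    g ∈ (arrChart r).source ↔ g.1 ∈ D.dom r.1.1 ∧ g.2.1 ∈ D.dom r.1.2 := Iff.rfl

theorem mem_arrChart_target {r : D.Joined} {z : (Fin n → ℂ) × (Fin n → ℂ)} :
    z ∈ (arrChart r).target ↔ z.1 ∈ (D.loc r.1.1).target ∧ arrTarget r.2 z ∈ (D.loc r.1.2).target ∧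
        ∀ i, z.2 (D.idx r.1.2 i) ≠ 0 := Iff.rfl

section Symm

variable {r : D.Joined} {z : (Fin n → ℂ) × (Fin n → ℂ)}

theorem arrChart_symm_fst (hz : z ∈ (arrChart r).target) :
    ((arrChart r).symm z).1 = (D.loc r.1.1).symm z.1 := by
  have h1 := congrArg Prod.fst ((arrChart r).right_inv hz)
  have h2 := mem_arrChart_source.1 ((arrChart r).map_target hz)
  rw [← h1]
  exact ((D.loc r.1.1).left_inv h2.1).symm

theorem arrChart_symm_snd (hz : z ∈ (arrChart r).target) :
    ((arrChart r).symm z).2.1 = (D.loc r.1.2).symm (arrTarget r.2 z) := by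
  have h1 := (arrChart r).right_inv hz
  have h2 := mem_arrChart_source.1 ((arrChart r).map_target hz)
  conv_rhs => rw [← h1, arrChart_apply, arrTarget_arrCoord r.2 h2.1 h2.2]
  exact ((D.loc r.1.2).left_inv h2.2).symm

theorem scl_arrChart_symm (hz : z ∈ (arrChart r).target) (i : D.Through r.1.2) :
    scl r.1.1 r.1.2 i ((arrChart r).symm z) = z.2 (D.idx r.1.2 i) := by
  have h1 := congrFun (congrArg Prod.snd ((arrChart r).right_inv hz)) (D.idx r.1.2 i)
  rw [← h1, arrChart_apply, arrCoord]
  exact ((D.idx_injective r.1.2).extend_apply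
    (fun i => scl r.1.1 r.1.2 i ((arrChart r).symm z)) _ i).symm

end Symm

theorem scl_of_notMem {i : D.ι} (hp : p ∉ D.comp i) (hq : q ∉ D.comp i) {g : Arr D.pair}
    (hx : g.1 ∈ D.dom p) (hy : g.2.1 ∈ D.dom q) : scl p q i g = 1 := by
  have := zeta_target hx hy i
  rw [D.zeta_of_notMem hp, D.zeta_of_notMem hq, mul_one] at this
  exact this.symm

theorem contDiff_arrTarget (h : ∀ i, p ∈ D.comp i ↔ q ∈ D.comp i) :
    ContDiff ℂ ω (arrTarget (D := D) h) := by
  refine contDiff_pi.2 fun j => ?_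
  by_cases hj : ∃ i, D.idx q i = j
  · obtain ⟨i, rfl⟩ := hj
    simp only [arrTarget, (D.idx_injective q).extend_apply]
    fun_prop
  · simp only [arrTarget, Function.extend_apply' _ _ _ hj]
    fun_prop

theorem isOpen_arrChart_target (r : D.Joined) : IsOpen (arrChart r).target := by
  have h1 : IsOpen {z : (Fin n → ℂ) × (Fin n → ℂ) | z.1 ∈ (D.loc r.1.1).target} :=
    (D.loc r.1.1).open_target.preimage continuous_fst
  have h2 : IsOpen {z : (Fin n → ℂ) × (Fin n → ℂ) | arrTarget r.2 z ∈ (D.loc r.1.2).target} :=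
    (D.loc r.1.2).open_target.preimage (contDiff_arrTarget r.2).continuous
  have h3 : IsOpen {z : (Fin n → ℂ) × (Fin n → ℂ) | ∀ i, z.2 (D.idx r.1.2 i) ≠ 0} := by
    simp only [Set.ofPred_forall]
    exact isOpen_iInter_of_finite fun i => isOpen_ne_fun (by fun_prop) (by fun_prop)
  exact h1.inter (h2.inter h3)

/-- The source, the target and the scales depend holomorphically on the coordinates. -/
theorem contMDiffAt_arrChart_symm_aux {r : D.Joined} {z : (Fin n → ℂ) × (Fin n → ℂ)}
    (hz : z ∈ (arrChart r).target) :
    ContMDiffAt 𝓘(ℂ, (Fin n → ℂ) × (Fin n → ℂ)) 𝓘(ℂ, Fin n → ℂ) ω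
        (fun y => ((arrChart r).symm y).1) z ∧
      ContMDiffAt 𝓘(ℂ, (Fin n → ℂ) × (Fin n → ℂ)) 𝓘(ℂ, Fin n → ℂ) ω
        (fun y => ((arrChart r).symm y).2.1) z ∧
      ∀ i, ContMDiffAt 𝓘(ℂ, (Fin n → ℂ) × (Fin n → ℂ)) 𝓘(ℂ, ℂ) ω
        (fun y => scl r.1.1 r.1.2 i ((arrChart r).symm y)) z := by
  have ht := (isOpen_arrChart_target r).mem_nhds hz
  have hz' := mem_arrChart_target.1 hz
  refine ⟨?_, ?_, fun i => ?_⟩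
  · have h1 : ContMDiffAt 𝓘(ℂ, (Fin n → ℂ) × (Fin n → ℂ)) 𝓘(ℂ, Fin n → ℂ) ω
        (fun y : (Fin n → ℂ) × (Fin n → ℂ) => (D.loc r.1.1).symm y.1) z :=
      ContMDiffAt.comp z (contMDiffAt_loc_symm r.1.1 hz'.1) contDiffAt_fst.contMDiffAt
    refine h1.congr_of_eventuallyEq ?_
    filter_upwards [ht] with y hy
    exact arrChart_symm_fst hy
  · have h1 : ContMDiffAt 𝓘(ℂ, (Fin n → ℂ) × (Fin n → ℂ)) 𝓘(ℂ, Fin n → ℂ) ω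
        (fun y : (Fin n → ℂ) × (Fin n → ℂ) => (D.loc r.1.2).symm (arrTarget r.2 y)) z :=
      ContMDiffAt.comp z (contMDiffAt_loc_symm r.1.2 hz'.2.1)
        (contDiff_arrTarget r.2).contDiffAt.contMDiffAt
    refine h1.congr_of_eventuallyEq ?_
    filter_upwards [ht] with y hy
    exact arrChart_symm_snd hy
  · by_cases hi : r.1.2 ∈ D.comp i
    · have h1 : ContMDiffAt 𝓘(ℂ, (Fin n → ℂ) × (Fin n → ℂ)) 𝓘(ℂ, ℂ) ω
          (fun y : (Fin n → ℂ) × (Fin n → ℂ) => y.2 (D.idx r.1.2 ⟨i, hi⟩)) z := by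
        refine ContDiffAt.contMDiffAt ?_
        fun_prop
      refine h1.congr_of_eventuallyEq ?_
      filter_upwards [ht] with y hy
      exact scl_arrChart_symm hy ⟨i, hi⟩
    · refine (contMDiffAt_const (c := (1 : ℂ))).congr_of_eventuallyEq ?_
      filter_upwards [ht] with y hy
      have h1 := mem_arrChart_source.1 ((arrChart r).map_target hy)
      exact scl_of_notMem (fun h => hi ((r.2 i).1 h)) hi h1.1 h1.2

theorem contMDiffAt_scale_arrChart_symm {r : D.Joined} {z : (Fin n → ℂ) × (Fin n → ℂ)}
    (hz : z ∈ (arrChart r).target) {i : D.ι} {U W : Opens X} {h k : X → ℂ}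
    (hh : D.IsDefiningFunction i U h) (hk : D.IsDefiningFunction i W k)
    (hx : ((arrChart r).symm z).1 ∈ U) (hy : ((arrChart r).symm z).2.1 ∈ W) :
    ContMDiffAt 𝓘(ℂ, (Fin n → ℂ) × (Fin n → ℂ)) 𝓘(ℂ, ℂ) ω
      (fun y => scale i h k ((arrChart r).symm y)) z := by
  obtain ⟨h1, h2, h3⟩ := contMDiffAt_arrChart_symm_aux hz
  have hg := mem_arrChart_source.1 ((arrChart r).map_target hz)
  obtain ⟨q, t, hq, ht, hq0, -, A, hA, B, hB, hAB⟩ := exists_scale_change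
    (D.isDefiningFunction_zeta r.1.1 i) (D.isDefiningFunction_zeta r.1.2 i) hh hk hg.1 hg.2 hx hy
  have h4 := ContMDiffAt.div₀ ((h3 i).mul (ContMDiffAt.comp z ht h2)) (ContMDiffAt.comp z hq h1) hq0
  refine h4.congr_of_eventuallyEq ?_
  filter_upwards [h1.continuousAt.eventually hA, h2.continuousAt.eventually hB] with y hyA hyB
  exact hAB _ hyA hyB

theorem arrChart_transition {r r' : D.Joined} {z : (Fin n → ℂ) × (Fin n → ℂ)}
    (hz : z ∈ ((arrChart r).symm.trans (arrChart r')).source) :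
    (∀ᶠ y in 𝓝 z, y ∈ ((arrChart r).symm.trans (arrChart r')).source) ∧
      ContDiffAt ℂ ω ((arrChart r).symm.trans (arrChart r')) z := by
  obtain ⟨hz1, hz2⟩ := hz
  have hz1' : z ∈ (arrChart r).target := hz1
  have hz2' := mem_arrChart_source.1 hz2
  obtain ⟨h1, h2, -⟩ := contMDiffAt_arrChart_symm_aux hz1'
  refine ⟨?_, ?_⟩
  · filter_upwards [(isOpen_arrChart_target r).mem_nhds hz1',
      h1.continuousAt.eventually ((D.dom r'.1.1).isOpen.mem_nhds hz2'.1),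
      h2.continuousAt.eventually ((D.dom r'.1.2).isOpen.mem_nhds hz2'.2)] with y hy1 hy2 hy3
    exact ⟨hy1, hy2, hy3⟩
  · refine ContDiffAt.prodMk ?_ (contDiffAt_pi.2 fun j => ?_)
    · exact contMDiffAt_iff_contDiffAt.1 (ContMDiffAt.comp z (contMDiffAt_loc hz2'.1) h1)
    · by_cases hj : ∃ i, D.idx r'.1.2 i = j
      · obtain ⟨i, rfl⟩ := hj
        have h3 := contMDiffAt_scale_arrChart_symm hz1' (D.isDefiningFunction_zeta r'.1.1 i)
          (D.isDefiningFunction_zeta r'.1.2 i) hz2'.1 hz2'.2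
        refine (contMDiffAt_iff_contDiffAt.1 h3).congr_of_eventuallyEq
          (Eventually.of_forall fun y => ?_)
        exact (D.idx_injective _).extend_apply _ _ i
      · have h3 : ContDiffAt ℂ ω (fun y => D.loc r'.1.2 ((arrChart r).symm y).2.1 j) z :=
          contDiffAt_pi.1 (contMDiffAt_iff_contDiffAt.1
            (ContMDiffAt.comp z (contMDiffAt_loc hz2'.2) h2)) j
        refine h3.congr_of_eventuallyEq (Eventually.of_forall fun y => ?_)
        exact Function.extend_apply' _ _ _ hj

end ArrowChart

variable (D) in
/-- The atlas of the charts `arrChart`. -/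
def arrCore : ChartedSpaceCore ((Fin n → ℂ) × (Fin n → ℂ)) (Arr D.pair) where
  atlas := Set.range fun r : D.Joined => arrChart r
  chartAt g := arrChart ⟨(g.1, g.2.1), g.2.2.mem_iff⟩
  mem_chart_source g := ⟨D.mem_dom_self g.1, D.mem_dom_self g.2.1⟩
  chart_mem_atlas g := ⟨⟨(g.1, g.2.1), g.2.2.mem_iff⟩, rfl⟩
  open_source := by
    rintro _ _ ⟨q, rfl⟩ ⟨q', rfl⟩
    exact isOpen_iff_mem_nhds.2 fun z hz => (arrChart_transition hz).1
  continuousOn_toFun := by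
    rintro _ _ ⟨q, rfl⟩ ⟨q', rfl⟩ z hz
    exact (arrChart_transition hz).2.continuousAt.continuousWithinAt

instance : TopologicalSpace (Arr D.pair) := D.arrCore.toTopologicalSpace

instance : ChartedSpace ((Fin n → ℂ) × (Fin n → ℂ)) (Arr D.pair) := D.arrCore.toChartedSpace

instance : IsManifold 𝓘(ℂ, (Fin n → ℂ) × (Fin n → ℂ)) ω (Arr D.pair) := by
  refine isManifold_of_contDiffOn _ _ _ fun e e' he he' => ?_
  obtain ⟨_, ⟨_, rfl⟩, _, ⟨⟨q, rfl⟩, rfl⟩, h⟩ := he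
  obtain ⟨_, ⟨_, rfl⟩, _, ⟨⟨q', rfl⟩, rfl⟩, h'⟩ := he'
  rw [Set.mem_singleton_iff] at h h'
  subst h h'
  intro z hz
  exact (arrChart_transition (hz.1 : z ∈ ((arrChart q).symm.trans
    (arrChart q')).source)).2.contDiffWithinAt

/-- The chart `arrChart`, as an open partial homeomorphism. -/
def arrHomeo (r : D.Joined) :
    OpenPartialHomeomorph (Arr D.pair) ((Fin n → ℂ) × (Fin n → ℂ)) :=
  D.arrCore.openPartialHomeomorph (arrChart r) ⟨r, rfl⟩

theorem arrHomeo_mem_maximalAtlas (r : D.Joined) :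
    arrHomeo r ∈
      IsManifold.maximalAtlas 𝓘(ℂ, (Fin n → ℂ) × (Fin n → ℂ)) ω (Arr D.pair) := by
  refine StructureGroupoid.subset_maximalAtlas _ ?_
  exact Set.mem_iUnion₂.2 ⟨arrChart r, ⟨r, rfl⟩, rfl⟩

/-- A map from the space of arrows that is holomorphic in the coordinates is holomorphic. -/
theorem contMDiffAt_of_arrChart_symm {E' H' M' : Type*} [NormedAddCommGroup E'] [NormedSpace ℂ E']
    [TopologicalSpace H'] {I : ModelWithCorners ℂ E' H'} [TopologicalSpace M']
    [ChartedSpace H' M'] {F : Arr D.pair → M'} {r : D.Joined} {g : Arr D.pair}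
    (hg : g ∈ (arrChart r).source)
    (h : ContMDiffAt 𝓘(ℂ, (Fin n → ℂ) × (Fin n → ℂ)) I ω (fun z => F ((arrChart r).symm z))
      (arrChart r g)) :
    ContMDiffAt 𝓘(ℂ, (Fin n → ℂ) × (Fin n → ℂ)) I ω F g := by
  have h1 := contMDiffAt_of_mem_maximalAtlas (arrHomeo_mem_maximalAtlas r) (x := g) hg
  refine (ContMDiffAt.comp g (g := fun z => F ((arrChart r).symm z)) h h1).congr_of_eventuallyEq ?_
  filter_upwards [(arrHomeo r).open_source.mem_nhds hg] with g' hg'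
  exact congrArg F ((arrChart r).left_inv hg').symm

variable (D) in
theorem contMDiff_source : ContMDiff 𝓘(ℂ, (Fin n → ℂ) × (Fin n → ℂ)) 𝓘(ℂ, Fin n → ℂ) ω
    (fun g : Arr D.pair => g.1) := fun g =>
  contMDiffAt_of_arrChart_symm (D.arrCore.mem_chart_source g)
    (contMDiffAt_arrChart_symm_aux
      ((arrChart _).map_source (D.arrCore.mem_chart_source g))).1

variable (D) in
theorem contMDiff_target : ContMDiff 𝓘(ℂ, (Fin n → ℂ) × (Fin n → ℂ)) 𝓘(ℂ, Fin n → ℂ) ω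
    (fun g : Arr D.pair => g.2.1) := fun g =>
  contMDiffAt_of_arrChart_symm (D.arrCore.mem_chart_source g)
    (contMDiffAt_arrChart_symm_aux
      ((arrChart _).map_source (D.arrCore.mem_chart_source g))).2.1

/-- The scales are holomorphic. -/
theorem contMDiffAt_scale {i : D.ι} {U W : Opens X} {h k : X → ℂ}
    (hh : D.IsDefiningFunction i U h) (hk : D.IsDefiningFunction i W k) {g : Arr D.pair}
    (hx : g.1 ∈ U) (hy : g.2.1 ∈ W) :
    ContMDiffAt 𝓘(ℂ, (Fin n → ℂ) × (Fin n → ℂ)) 𝓘(ℂ, ℂ) ω (scale i h k) g := by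
  have hg := D.arrCore.mem_chart_source g
  have hl := (arrChart ⟨(g.1, g.2.1), g.2.2.mem_iff⟩).left_inv hg
  refine contMDiffAt_of_arrChart_symm hg
    (contMDiffAt_scale_arrChart_symm ((arrChart _).map_source hg) hh hk ?_ ?_)
  · rwa [hl]
  · rwa [hl]

variable (D) in
theorem scalesHolomorphic : D.ScalesHolomorphic (EG := (Fin n → ℂ) × (Fin n → ℂ)) :=
  fun _ _ _ _ _ hh hk => ⟨scale _ _ _, fun _ _ g hx hy => isScale_scale hh hk hx hy g,
    fun _ hg => (contMDiffAt_scale hh hk hg.1 hg.2).contMDiffWithinAt⟩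

/-- A map to the space of arrows is holomorphic if the source, the target and the scales are. -/
theorem contMDiffWithinAt_arr {E' H' M' : Type*} [NormedAddCommGroup E'] [NormedSpace ℂ E']
    [TopologicalSpace H'] {I : ModelWithCorners ℂ E' H'} [TopologicalSpace M']
    [ChartedSpace H' M'] {G : M' → Arr D.pair} {S : Set M'} {z : M'} (r : D.Joined)
    (hr : (G z).1 ∈ D.dom r.1.1) (hr' : (G z).2.1 ∈ D.dom r.1.2)
    (hs : ContMDiffWithinAt I 𝓘(ℂ, Fin n → ℂ) ω (fun y => (G y).1) S z)
    (ht : ContMDiffWithinAt I 𝓘(ℂ, Fin n → ℂ) ω (fun y => (G y).2.1) S z)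
    (ha : ∀ i, ContMDiffWithinAt I 𝓘(ℂ, ℂ) ω (fun y => scl r.1.1 r.1.2 i (G y)) S z) :
    ContMDiffWithinAt I 𝓘(ℂ, (Fin n → ℂ) × (Fin n → ℂ)) ω G S z := by
  have hg : G z ∈ (arrChart r).source := ⟨hr, hr'⟩
  have h1 := contMDiffAt_symm_of_mem_maximalAtlas (arrHomeo_mem_maximalAtlas r)
    (x := arrChart r (G z)) ((arrChart r).map_source hg)
  have h2 : ContMDiffWithinAt I 𝓘(ℂ, (Fin n → ℂ) × (Fin n → ℂ)) ω
      (fun y => arrChart r (G y)) S z := by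
    refine ContMDiffWithinAt.prodMk_space ?_ (contMDiffWithinAt_pi_space.2 fun j => ?_)
    · exact ContMDiffAt.comp_contMDiffWithinAt z (contMDiffAt_loc hr) hs
    · by_cases hj : ∃ i, D.idx r.1.2 i = j
      · obtain ⟨i, rfl⟩ := hj
        have h3 : ∀ y, Function.extend (D.idx r.1.2) (fun i => scl r.1.1 r.1.2 i (G y))
            (D.loc r.1.2 (G y).2.1) (D.idx r.1.2 i) = scl r.1.1 r.1.2 i (G y) :=
          fun y => (D.idx_injective _).extend_apply _ _ i
        exact (ha i).congr (fun y _ => h3 y) (h3 z)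
      · have h3 : ∀ y, Function.extend (D.idx r.1.2) (fun i => scl r.1.1 r.1.2 i (G y))
            (D.loc r.1.2 (G y).2.1) j = D.loc r.1.2 (G y).2.1 j :=
          fun y => Function.extend_apply' _ _ _ hj
        exact (contMDiffWithinAt_pi_space.1
          (ContMDiffAt.comp_contMDiffWithinAt z (contMDiffAt_loc hr') ht) j).congr
          (fun y _ => h3 y) (h3 z)
  refine (ContMDiffAt.comp_contMDiffWithinAt z h1 h2).congr_of_eventuallyEq ?_
    ((arrChart r).left_inv hg).symm
  filter_upwards [hs.continuousWithinAt.eventually ((D.dom r.1.1).isOpen.mem_nhds hr),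
    ht.continuousWithinAt.eventually ((D.dom r.1.2).isOpen.mem_nhds hr')] with y hy hy'
  exact ((arrChart r).left_inv (⟨hy, hy'⟩ : G y ∈ (arrChart r).source)).symm

end SNCDivisor

namespace SNCDivisor

variable {n : ℕ} {X : Type u} [TopologicalSpace X] [ChartedSpace (Fin n → ℂ) X]
  {D : SNCDivisor.{u, v} n X}

/-! ### The Lie groupoid `Pair(X, D)` -/

variable (D) in
/-- In the charts, the source is the projection to the first factor. -/
theorem isSubmersion_source : Manifold.IsSubmersion 𝓘(ℂ, (Fin n → ℂ) × (Fin n → ℂ))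
    𝓘(ℂ, Fin n → ℂ) ω (fun g : Arr D.pair => g.1) := by
  refine Manifold.IsSubmersionOfComplement.isSubmersion (F := Fin n → ℂ) fun g => ?_
  refine Manifold.IsSubmersionAtOfComplement.mk_of_charts (ContinuousLinearEquiv.refl ℂ _)
    (arrHomeo ⟨(g.1, g.2.1), g.2.2.mem_iff⟩) (D.loc g.1) (D.arrCore.mem_chart_source g)
    (D.mem_loc_source g.1) (arrHomeo_mem_maximalAtlas _) (D.loc_mem_maximalAtlas _)
    (fun w hw => hw.1) fun z hz => ?_
  have hz' : z ∈ (arrChart ⟨(g.1, g.2.1), g.2.2.mem_iff⟩).target := by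
    have : z ∈ (arrHomeo ⟨(g.1, g.2.1), g.2.2.mem_iff⟩).target := by simpa using hz
    exact this
  exact congrArg Prod.fst ((arrChart ⟨(g.1, g.2.1), g.2.2.mem_iff⟩).right_inv hz')

/-- The inversion of arrows. -/
def arrInv (g : Arr D.pair) : Arr D.pair := ⟨g.2.1, g.1, D.pair.inv g.2.2⟩

theorem arrInv_arrInv (g : Arr D.pair) : arrInv (arrInv g) = g := rfl

theorem scl_arrInv {p q : X} {g : Arr D.pair} (hx : g.1 ∈ D.dom p) (hy : g.2.1 ∈ D.dom q)
    (i : D.ι) : scl q p i (arrInv g) = (scl p q i g)⁻¹ :=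
  scl_eq hy hx ((isScale_scl hx hy i g.2.2).inv (scl_ne_zero hx hy i))

theorem scl_id {p x : X} (hx : x ∈ D.dom p) (i : D.ι) : scl p p i (idArr D.pair x) = 1 :=
  scl_eq hx hx (isScale_id (D.isDefiningFunction_zeta p i) hx)

theorem scl_comp {p q r x y z : X} (hx : x ∈ D.dom p) (hy : y ∈ D.dom q) (hz : z ∈ D.dom r)
    (i : D.ι) (f : D.PairHom x y) (g : D.PairHom y z) :
    scl p r i ⟨x, z, D.pair.comp f g⟩ = scl q r i ⟨y, z, g⟩ * scl p q i ⟨x, y, f⟩ :=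
  scl_eq hx hz ((isScale_scl hx hy i f).comp (isScale_scl hy hz i g))

theorem contMDiffAt_scl {p q : X} {g : Arr D.pair} (hx : g.1 ∈ D.dom p) (hy : g.2.1 ∈ D.dom q)
    (i : D.ι) :
    ContMDiffAt 𝓘(ℂ, (Fin n → ℂ) × (Fin n → ℂ)) 𝓘(ℂ, ℂ) ω (scl p q i) g :=
  contMDiffAt_scale (D.isDefiningFunction_zeta p i) (D.isDefiningFunction_zeta q i) hx hy

theorem eventually_source_mem {p : X} {g : Arr D.pair} (hx : g.1 ∈ D.dom p) :
    ∀ᶠ g' : Arr D.pair in 𝓝 g, g'.1 ∈ D.dom p :=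
  (contMDiff_source D).continuous.continuousAt.eventually ((D.dom p).isOpen.mem_nhds hx)

theorem eventually_target_mem {p : X} {g : Arr D.pair} (hx : g.2.1 ∈ D.dom p) :
    ∀ᶠ g' : Arr D.pair in 𝓝 g, g'.2.1 ∈ D.dom p :=
  (contMDiff_target D).continuous.continuousAt.eventually ((D.dom p).isOpen.mem_nhds hx)

theorem contMDiff_arrInv : ContMDiff 𝓘(ℂ, (Fin n → ℂ) × (Fin n → ℂ))
    𝓘(ℂ, (Fin n → ℂ) × (Fin n → ℂ)) ω (arrInv (D := D)) := by
  intro g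
  have hx := D.mem_dom_self g.1
  have hy := D.mem_dom_self g.2.1
  refine contMDiffWithinAt_arr ⟨(g.2.1, g.1), fun i => (g.2.2.mem_iff i).symm⟩ hy hx
    (contMDiff_target D g) (contMDiff_source D g) fun i => ContMDiffAt.contMDiffWithinAt ?_
  refine ((contMDiffAt_scl hx hy i).inv₀ (scl_ne_zero hx hy i)).congr_of_eventuallyEq ?_
  filter_upwards [eventually_source_mem hx, eventually_target_mem hy] with g' h1 h2
  exact scl_arrInv h1 h2 i

theorem contMDiff_idArr : ContMDiff 𝓘(ℂ, Fin n → ℂ) 𝓘(ℂ, (Fin n → ℂ) × (Fin n → ℂ)) ω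
    (fun x => idArr D.pair x) := by
  intro x
  have hx := D.mem_dom_self x
  refine contMDiffWithinAt_arr ⟨(x, x), fun i => Iff.rfl⟩ hx hx contMDiffWithinAt_id
    contMDiffWithinAt_id fun i => ContMDiffAt.contMDiffWithinAt ?_
  refine (contMDiffAt_const (c := (1 : ℂ))).congr_of_eventuallyEq ?_
  filter_upwards [(D.dom x).isOpen.mem_nhds hx] with y hy
  exact scl_id hy i

/-- The inversion, as a homeomorphism. -/
def arrInvHomeomorph : Arr D.pair ≃ₜ Arr D.pair where
  toFun := arrInv
  invFun := arrInv
  left_inv := arrInv_arrInv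
  right_inv := arrInv_arrInv
  continuous_toFun := contMDiff_arrInv.continuous
  continuous_invFun := contMDiff_arrInv.continuous

/-- The chart `arrHomeo` after inversion: its first component is the coordinate of the target. -/
theorem arrInv_trans_arrHomeo_mem_maximalAtlas (r : D.Joined) :
    arrInvHomeomorph.toOpenPartialHomeomorph.trans (arrHomeo r) ∈
      IsManifold.maximalAtlas 𝓘(ℂ, (Fin n → ℂ) × (Fin n → ℂ)) ω (Arr D.pair) := by
  refine OpenPartialHomeomorph.mem_maximalAtlas_of_contMDiffOn
    (I := 𝓘(ℂ, (Fin n → ℂ) × (Fin n → ℂ))) (n := ω) (M := Arr D.pair) _ ?_ ?_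
  · intro g hg
    have hg' : arrInvHomeomorph g ∈ (arrHomeo r).source := by simpa using hg
    have h1 := contMDiffAt_of_mem_maximalAtlas (arrHomeo_mem_maximalAtlas r) hg'
    exact (ContMDiffAt.comp g h1 contMDiff_arrInv.contMDiffAt).contMDiffWithinAt
  · intro z hz
    have hz' : z ∈ (arrHomeo r).target := by simpa using hz
    have h1 := contMDiffAt_symm_of_mem_maximalAtlas (arrHomeo_mem_maximalAtlas r) hz'
    exact (ContMDiffAt.comp z contMDiff_arrInv.contMDiffAt h1).contMDiffWithinAt

variable (D) in
/-- The target is the source of the inverse arrow. -/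
theorem isSubmersion_target : Manifold.IsSubmersion 𝓘(ℂ, (Fin n → ℂ) × (Fin n → ℂ))
    𝓘(ℂ, Fin n → ℂ) ω (fun g : Arr D.pair => g.2.1) := by
  refine Manifold.IsSubmersionOfComplement.isSubmersion (F := Fin n → ℂ) fun g => ?_
  set r : D.Joined := ⟨(g.2.1, g.1), fun i => (g.2.2.mem_iff i).symm⟩
  refine Manifold.IsSubmersionAtOfComplement.mk_of_charts (ContinuousLinearEquiv.refl ℂ _)
    (arrInvHomeomorph.toOpenPartialHomeomorph.trans (arrHomeo r)) (D.loc g.2.1) ?_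
    (D.mem_loc_source g.2.1) (arrInv_trans_arrHomeo_mem_maximalAtlas r)
    (D.loc_mem_maximalAtlas _) ?_ fun z hz => ?_
  · have : arrInvHomeomorph g ∈ (arrHomeo r).source := ⟨D.mem_dom_self _, D.mem_dom_self _⟩
    simpa using this
  · intro g' hg'
    have : arrInvHomeomorph g' ∈ (arrHomeo r).source := by simpa using hg'
    exact this.1
  · have hz' : z ∈ (arrChart r).target := by
      have : z ∈ (arrHomeo r).target := by simpa using hz
      exact this
    exact congrArg Prod.fst ((arrChart r).right_inv hz')

variable (D) in
/-- The scales of inverse and composite arrows are inverses and products, hence holomorphic. -/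
theorem isLieGroupoid_pair [IsManifold 𝓘(ℂ, Fin n → ℂ) ω X] :
    IsLieGroupoid (E := Fin n → ℂ) (EG := (Fin n → ℂ) × (Fin n → ℂ)) D.pair where
  source_submersion := D.isSubmersion_source
  target_submersion := D.isSubmersion_target
  id_holomorphic := contMDiff_idArr
  inv_holomorphic := contMDiff_arrInv
  comp_holomorphic := by
    classical
    set m : Arr D.pair × Arr D.pair → Arr D.pair := fun p =>
      if h : p.1.2.1 = p.2.1 then
        ⟨p.1.1, p.2.2.1, D.pair.comp (Eq.ndrec (motive := fun y => D.PairHom p.1.1 y) p.1.2.2 h)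
          p.2.2.2⟩
      else p.1
    have hm : ∀ (x y z : X) (f : D.pair.Hom x y) (g : D.pair.Hom y z),
        m (⟨x, y, f⟩, ⟨y, z, g⟩) = ⟨x, z, D.pair.comp f g⟩ := fun x y z f g => by simp [m]
    refine ⟨m, hm, ?_⟩
    rintro ⟨⟨x, y, f⟩, ⟨y', z, g⟩⟩ (h : y = y')
    subst h
    have hx := D.mem_dom_self x
    have hy := D.mem_dom_self y
    have hz := D.mem_dom_self z
    have hs : ∀ p : Arr D.pair × Arr D.pair, p.1.2.1 = p.2.1 → (m p).1 = p.1.1 := by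
      rintro ⟨⟨x, y, f⟩, ⟨y', z, g⟩⟩ (h : y = y')
      subst h
      rw [hm]
    have ht : ∀ p : Arr D.pair × Arr D.pair, p.1.2.1 = p.2.1 → (m p).2.1 = p.2.2.1 := by
      rintro ⟨⟨x, y, f⟩, ⟨y', z, g⟩⟩ (h : y = y')
      subst h
      rw [hm]
    have hsc : ∀ p : Arr D.pair × Arr D.pair, p.1.2.1 = p.2.1 → p.1.1 ∈ D.dom x →
        p.1.2.1 ∈ D.dom y → p.2.2.1 ∈ D.dom z → ∀ i,
        scl x z i (m p) = scl y z i p.2 * scl x y i p.1 := by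
      rintro ⟨⟨x, y, f⟩, ⟨y', z, g⟩⟩ (h : y = y') h1 h2 h3 i
      subst h
      rw [hm]
      exact scl_comp h1 h2 h3 i f g
    have hc1 : Tendsto Prod.fst (𝓝[{p : Arr D.pair × Arr D.pair | p.1.2.1 = p.2.1}]
        ((⟨x, y, f⟩ : Arr D.pair), (⟨y, z, g⟩ : Arr D.pair))) (𝓝 ⟨x, y, f⟩) :=
      continuousAt_fst.tendsto.mono_left nhdsWithin_le_nhds
    have hc2 : Tendsto Prod.snd (𝓝[{p : Arr D.pair × Arr D.pair | p.1.2.1 = p.2.1}]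
        ((⟨x, y, f⟩ : Arr D.pair), (⟨y, z, g⟩ : Arr D.pair))) (𝓝 ⟨y, z, g⟩) :=
      continuousAt_snd.tendsto.mono_left nhdsWithin_le_nhds
    have hp1 : ContMDiffAt (𝓘(ℂ, (Fin n → ℂ) × (Fin n → ℂ)).prod 𝓘(ℂ, (Fin n → ℂ) × (Fin n → ℂ)))
        𝓘(ℂ, (Fin n → ℂ) × (Fin n → ℂ)) ω Prod.fst
        ((⟨x, y, f⟩ : Arr D.pair), (⟨y, z, g⟩ : Arr D.pair)) := contMDiffAt_fst
    have hp2 : ContMDiffAt (𝓘(ℂ, (Fin n → ℂ) × (Fin n → ℂ)).prod 𝓘(ℂ, (Fin n → ℂ) × (Fin n → ℂ)))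
        𝓘(ℂ, (Fin n → ℂ) × (Fin n → ℂ)) ω Prod.snd
        ((⟨x, y, f⟩ : Arr D.pair), (⟨y, z, g⟩ : Arr D.pair)) := contMDiffAt_snd
    refine contMDiffWithinAt_arr ⟨(x, z), fun i => (f.mem_iff i).trans (g.mem_iff i)⟩
      (by rw [hm]; exact hx) (by rw [hm]; exact hz) ?_ ?_ fun i => ?_
    · exact ((ContMDiffAt.comp _ (contMDiff_source D).contMDiffAt hp1).contMDiffWithinAt).congr
        (fun p hp => hs p hp) (hs _ rfl)
    · exact ((ContMDiffAt.comp _ (contMDiff_target D).contMDiffAt hp2).contMDiffWithinAt).congr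
        (fun p hp => ht p hp) (ht _ rfl)
    · refine (((ContMDiffAt.comp ((⟨x, y, f⟩ : Arr D.pair), (⟨y, z, g⟩ : Arr D.pair))
        (contMDiffAt_scl (g := ⟨y, z, g⟩) hy hz i) hp2).mul
        (ContMDiffAt.comp ((⟨x, y, f⟩ : Arr D.pair), (⟨y, z, g⟩ : Arr D.pair))
        (contMDiffAt_scl (g := ⟨x, y, f⟩) hx hy i) hp1)).contMDiffWithinAt).congr_of_eventuallyEq
        ?_ (hsc _ rfl hx hy hz i)
      filter_upwards [hc1.eventually (eventually_source_mem hx),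
        hc1.eventually (eventually_target_mem hy), hc2.eventually (eventually_target_mem hz),
        self_mem_nhdsWithin] with p h1 h2 h3 h4
      exact hsc p h4 h1 h2 h3 i

end SNCDivisor

/-! ### Differentiation along holomorphic vector fields -/

section Calculus

variable {E₁ H₁ : Type*} [NormedAddCommGroup E₁] [NormedSpace ℂ E₁] [TopologicalSpace H₁]
  {I : ModelWithCorners ℂ E₁ H₁}
  {M₁ : Type*} [TopologicalSpace M₁] [ChartedSpace H₁ M₁] [IsManifold I ω M₁]
  {E₂ : Type*} [NormedAddCommGroup E₂] [NormedSpace ℂ E₂]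
  {M₂ : Type*} [TopologicalSpace M₂] [ChartedSpace E₂ M₂] [IsManifold 𝓘(ℂ, E₂) ω M₂]
  {E₃ : Type*} [NormedAddCommGroup E₃] [NormedSpace ℂ E₃]
  {M₃ : Type*} [TopologicalSpace M₃] [ChartedSpace E₃ M₃]

/-- The differential of a holomorphic map takes vector fields along a map to such fields. -/
theorem contMDiffAt_mfderiv_section {f : M₁ → M₂} {b : M₃ → M₁}
    {v : ∀ y, TangentSpace I (b y)} {y : M₃}
    (hf : ContMDiffAt I 𝓘(ℂ, E₂) ω f (b y))
    (hv : ContMDiffAt 𝓘(ℂ, E₃) I.tangent ω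
      (fun y => (⟨b y, v y⟩ : TangentBundle I M₁)) y) :
    ContMDiffAt 𝓘(ℂ, E₃) 𝓘(ℂ, E₂).tangent ω
      (fun y => (⟨f (b y), mfderiv I 𝓘(ℂ, E₂) f (b y) (v y)⟩ :
        TangentBundle 𝓘(ℂ, E₂) M₂)) y := by
  have he : ∀ᶠ x in 𝓝 (b y), ContMDiffAt I 𝓘(ℂ, E₂) ω f x :=
    (contMDiffAt_iff_contMDiffAt_nhds (by simp)).1 hf
  obtain ⟨s, hs, hso, hys⟩ := eventually_nhds_iff.1 he
  have h1 : ContMDiffOn I 𝓘(ℂ, E₂) ω f s := fun x hx => (hs x hx).contMDiffWithinAt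
  have h2 := h1.contMDiffOn_tangentMapWithin (m := ω) (by simp) hso.uniqueMDiffOn
  have hb : ContinuousAt b y :=
    ((FiberBundle.continuous_proj E₁ (TangentSpace I)).continuousAt.comp hv.continuousAt :)
  have hp : IsOpen (Bundle.TotalSpace.proj ⁻¹' s : Set (TangentBundle I M₁)) :=
    hso.preimage (FiberBundle.continuous_proj E₁ (TangentSpace I))
  have h3 := (h2 ⟨b y, v y⟩ hys).contMDiffAt (hp.mem_nhds hys)
  refine (ContMDiffAt.comp y h3 hv).congr_of_eventuallyEq ?_
  filter_upwards [hb.eventually (hso.mem_nhds hys)] with z hz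
  simp only [Function.comp_apply, tangentMapWithin]
  rw [mfderivWithin_of_isOpen hso hz]

/-- A holomorphic map differentiated along a holomorphic vector field is holomorphic. -/
theorem contMDiffAt_mfderiv_apply {f : M₁ → E₂} {b : M₃ → M₁}
    {v : ∀ y, TangentSpace I (b y)} {y : M₃}
    (hf : ContMDiffAt I 𝓘(ℂ, E₂) ω f (b y))
    (hv : ContMDiffAt 𝓘(ℂ, E₃) I.tangent ω
      (fun y => (⟨b y, v y⟩ : TangentBundle I M₁)) y) :
    ContMDiffAt 𝓘(ℂ, E₃) 𝓘(ℂ, E₂) ω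
      (fun y => (mfderiv I 𝓘(ℂ, E₂) f (b y) (v y) : E₂)) y :=
  ((contMDiff_snd_tangentBundle_modelSpace E₂ 𝓘(ℂ, E₂)).contMDiffAt.comp y
    (contMDiffAt_mfderiv_section hf hv) :)

/-- A vector field along a map to a vector space is holomorphic if the map and the components of
the field are. -/
theorem contMDiffAt_modelSpace_section {b v : M₃ → E₂} {y : M₃}
    (hb : ContMDiffAt 𝓘(ℂ, E₃) 𝓘(ℂ, E₂) ω b y) (hv : ContMDiffAt 𝓘(ℂ, E₃) 𝓘(ℂ, E₂) ω v y) :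
    ContMDiffAt 𝓘(ℂ, E₃) 𝓘(ℂ, E₂).tangent ω
      (fun y => (⟨b y, v y⟩ : TangentBundle 𝓘(ℂ, E₂) E₂)) y := by
  rw [Bundle.contMDiffAt_totalSpace]
  refine ⟨hb, ?_⟩
  simpa using hv

end Calculus

section Curves

variable {E₂ : Type*} [NormedAddCommGroup E₂] [NormedSpace ℂ E₂]
  {M₂ : Type*} [TopologicalSpace M₂] [ChartedSpace E₂ M₂]

theorem hasMFDerivAt_toSpanSingleton {γ : ℂ → M₂} {L : ℂ →L[ℂ] E₂} {v : E₂}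
    (h : HasMFDerivAt 𝓘(ℂ, ℂ) 𝓘(ℂ, E₂) γ 0 L) (hv : L 1 = v) :
    HasMFDerivAt 𝓘(ℂ, ℂ) 𝓘(ℂ, E₂) γ 0 (ContinuousLinearMap.toSpanSingleton ℂ v) := by
  obtain rfl : L = ContinuousLinearMap.toSpanSingleton ℂ v :=
    ContinuousLinearMap.ext_ring (by simp [hv])
  exact h

/-- The chain rule for a function along a curve with a given velocity. -/
theorem hasDerivAt_comp_curve {f : M₂ → ℂ} {γ : ℂ → M₂} {v : E₂}
    (hf : MDifferentiableAt 𝓘(ℂ, E₂) 𝓘(ℂ, ℂ) f (γ 0))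
    (hγ : HasMFDerivAt 𝓘(ℂ, ℂ) 𝓘(ℂ, E₂) γ 0 (ContinuousLinearMap.toSpanSingleton ℂ v)) :
    HasDerivAt (fun ε => f (γ ε)) (mfderiv 𝓘(ℂ, E₂) 𝓘(ℂ, ℂ) f (γ 0) v : ℂ) 0 := by
  set L : E₂ →L[ℂ] ℂ := mfderiv 𝓘(ℂ, E₂) 𝓘(ℂ, ℂ) f (γ 0)
  have h1 : HasFDerivAt (fun ε => f (γ ε)) (L ∘L ContinuousLinearMap.toSpanSingleton ℂ v) 0 :=
    (hf.hasMFDerivAt.comp (0 : ℂ) hγ).hasFDerivAt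
  have h2 : (L ∘L ContinuousLinearMap.toSpanSingleton ℂ v) 1 = L v := by simp
  have h3 := h1.hasDerivAt
  rw [h2] at h3
  exact h3

end Curves

namespace SNCDivisor

variable {n : ℕ} {X : Type u} [TopologicalSpace X] [ChartedSpace (Fin n → ℂ) X]
  {D : SNCDivisor.{u, v} n X} [IsManifold 𝓘(ℂ, Fin n → ℂ) ω X]
  {V W : ∀ x : X, TangentSpace 𝓘(ℂ, Fin n → ℂ) x} {g : X → ℂ} {x : X}

theorem holAt_lieDeriv (hg : HolAt n g x)
    (hV : ContMDiffAt 𝓘(ℂ, Fin n → ℂ) 𝓘(ℂ, Fin n → ℂ).tangent ω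
      (fun x => (⟨x, V x⟩ : TangentBundle 𝓘(ℂ, Fin n → ℂ) X)) x) :
    HolAt n (lieDeriv V g) x :=
  contMDiffAt_mfderiv_apply (b := id) hg hV

/-- Derivation along the bracket of two vector fields is the commutator of the derivations: in a
chart this is the symmetry of the second derivative. -/
theorem lieDeriv_mlieBracket (hg : HolAt n g x)
    (hV : ContMDiffAt 𝓘(ℂ, Fin n → ℂ) 𝓘(ℂ, Fin n → ℂ).tangent ω
      (fun x => (⟨x, V x⟩ : TangentBundle 𝓘(ℂ, Fin n → ℂ) X)) x)
    (hW : ContMDiffAt 𝓘(ℂ, Fin n → ℂ) 𝓘(ℂ, Fin n → ℂ).tangent ω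
      (fun x => (⟨x, W x⟩ : TangentBundle 𝓘(ℂ, Fin n → ℂ) X)) x) :
    lieDeriv (VectorField.mlieBracket 𝓘(ℂ, Fin n → ℂ) V W) g x =
      lieDeriv V (lieDeriv W g) x - lieDeriv W (lieDeriv V g) x := by
  set e := extChartAt 𝓘(ℂ, Fin n → ℂ) x x
  set φ : (Fin n → ℂ) → X := fun z => (extChartAt 𝓘(ℂ, Fin n → ℂ) x).symm z
  have hφe : φ e = x := extChartAt_to_inv x
  have htgt : ∀ᶠ y in 𝓝 e, y ∈ (extChartAt 𝓘(ℂ, Fin n → ℂ) x).target :=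
    (isOpen_extChartAt_target x).mem_nhds (mem_extChartAt_target x)
  have hφ : ∀ y ∈ (extChartAt 𝓘(ℂ, Fin n → ℂ) x).target,
      ContMDiffAt 𝓘(ℂ, Fin n → ℂ) 𝓘(ℂ, Fin n → ℂ) ω φ y := fun y hy =>
    (contMDiffOn_extChartAt_symm x).contMDiffAt ((isOpen_extChartAt_target x).mem_nhds hy)
  have hinv : ∀ y ∈ (extChartAt 𝓘(ℂ, Fin n → ℂ) x).target,
      (mfderiv 𝓘(ℂ, Fin n → ℂ) 𝓘(ℂ, Fin n → ℂ) φ y).IsInvertible := fun y hy => by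
    have := isInvertible_mfderivWithin_extChartAt_symm (I := 𝓘(ℂ, Fin n → ℂ)) hy
    rw [modelWithCornersSelf_coe, Set.range_id, mfderivWithin_univ] at this
    exact this
  -- the derivative along the pulled back field is the pulled back derivative
  have key : ∀ (U : ∀ x : X, TangentSpace 𝓘(ℂ, Fin n → ℂ) x) (k : X → ℂ), HolAt n k x →
      ∀ᶠ y in 𝓝 e, fderiv ℂ (k ∘ φ) y
        (VectorField.mpullback 𝓘(ℂ, Fin n → ℂ) 𝓘(ℂ, Fin n → ℂ) φ U y) = lieDeriv U k (φ y) := by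
    intro U k hk
    have hc : ContinuousAt φ e := (hφ e (mem_extChartAt_target x)).continuousAt
    have hk' : ∀ᶠ z in 𝓝 (φ e), HolAt n k z := by
      rw [hφe]
      exact (contMDiffAt_iff_contMDiffAt_nhds (by simp)).1 hk
    filter_upwards [htgt, hc.eventually hk'] with y hy hky
    have h1 := (hky.mdifferentiableAt.hasMFDerivAt).comp y
      ((hφ y hy).mdifferentiableAt (by simp)).hasMFDerivAt
    have h2 : fderiv ℂ (k ∘ φ) y = _ := mfderiv_eq_fderiv.symm.trans h1.mfderiv
    rw [h2]
    change mfderiv 𝓘(ℂ, Fin n → ℂ) 𝓘(ℂ, ℂ) k (φ y) (mfderiv 𝓘(ℂ, Fin n → ℂ) 𝓘(ℂ, Fin n → ℂ) φ y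
      ((mfderiv 𝓘(ℂ, Fin n → ℂ) 𝓘(ℂ, Fin n → ℂ) φ y).inverse (U (φ y)))) = _
    rw [(hinv y hy).self_apply_inverse]
    rfl
  have he := mem_extChartAt_target (I := 𝓘(ℂ, Fin n → ℂ)) x
  have hmd : ∀ U : ∀ x : X, TangentSpace 𝓘(ℂ, Fin n → ℂ) x,
      ContMDiffAt 𝓘(ℂ, Fin n → ℂ) 𝓘(ℂ, Fin n → ℂ).tangent ω
        (fun x => (⟨x, U x⟩ : TangentBundle 𝓘(ℂ, Fin n → ℂ) X)) x →
      MDifferentiableAt 𝓘(ℂ, Fin n → ℂ) 𝓘(ℂ, Fin n → ℂ).tangent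
        (fun x => (⟨x, U x⟩ : TangentBundle 𝓘(ℂ, Fin n → ℂ) X)) (φ e) := fun U hU => by
    rw [hφe]
    exact hU.mdifferentiableAt (by simp)
  have hdiff : ∀ U : ∀ x : X, TangentSpace 𝓘(ℂ, Fin n → ℂ) x,
      ContMDiffAt 𝓘(ℂ, Fin n → ℂ) 𝓘(ℂ, Fin n → ℂ).tangent ω
        (fun x => (⟨x, U x⟩ : TangentBundle 𝓘(ℂ, Fin n → ℂ) X)) x →
      DifferentiableAt ℂ (VectorField.mpullback 𝓘(ℂ, Fin n → ℂ) 𝓘(ℂ, Fin n → ℂ) φ U) e := by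
    intro U hU
    have h1 : ContMDiffAt 𝓘(ℂ, Fin n → ℂ) 𝓘(ℂ, Fin n → ℂ).tangent 1
        (fun x => (⟨x, U x⟩ : TangentBundle 𝓘(ℂ, Fin n → ℂ) X)) (φ e) := by
      rw [hφe]
      exact hU.of_le le_top
    have h2 := ContMDiffAt.mpullback_vectorField_preimage h1 (hφ e he) (hinv e he) (by simp)
    exact (contMDiffAt_vectorSpace_iff_contDiffAt.1 h2).differentiableAt (by simp)
  set V' : (Fin n → ℂ) → Fin n → ℂ :=
    VectorField.mpullback 𝓘(ℂ, Fin n → ℂ) 𝓘(ℂ, Fin n → ℂ) φ V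
  set W' : (Fin n → ℂ) → Fin n → ℂ :=
    VectorField.mpullback 𝓘(ℂ, Fin n → ℂ) 𝓘(ℂ, Fin n → ℂ) φ W
  have hb : VectorField.mpullback 𝓘(ℂ, Fin n → ℂ) 𝓘(ℂ, Fin n → ℂ) φ
      (VectorField.mlieBracket 𝓘(ℂ, Fin n → ℂ) V W) e = VectorField.lieBracket ℂ V' W' e :=
    (VectorField.mpullback_mlieBracket (hmd V hV) (hmd W hW) (hφ e he) (by simp)).trans
      ((congrFun (VectorField.mlieBracketWithin_eq_lieBracketWithin (s := Set.univ)) e).trans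
        (congrFun (VectorField.lieBracketWithin_univ (V := V') (W := W')) e))
  have h1 := (congrArg (fderiv ℂ (g ∘ φ) e) hb.symm).trans
    (key (VectorField.mlieBracket 𝓘(ℂ, Fin n → ℂ) V W) g hg).self_of_nhds
  rw [hφe] at h1
  have hgφ : ContDiffAt ℂ ω (g ∘ φ) e := by
    refine contMDiffAt_iff_contDiffAt.1 (ContMDiffAt.comp e ?_ (hφ e he))
    rw [hφe]
    exact hg
  rw [← h1, VectorField.fderiv_apply_lieBracket hgφ (by simp) (hdiff W hW) (hdiff V hV)]
  have h2 := (key V (lieDeriv W g) (holAt_lieDeriv hg hW)).self_of_nhds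
  have h3 := (key W (lieDeriv V g) (holAt_lieDeriv hg hV)).self_of_nhds
  rw [hφe] at h2 h3
  have h4 : (fun y => fderiv ℂ (g ∘ φ) y (V' y)) =ᶠ[𝓝 e] lieDeriv V g ∘ φ := key V g hg
  have h5 : (fun y => fderiv ℂ (g ∘ φ) y (W' y)) =ᶠ[𝓝 e] lieDeriv W g ∘ φ := key W g hg
  rw [← h2, ← h3, h4.fderiv_eq, h5.fderiv_eq]

end SNCDivisor

namespace SNCDivisor

variable {n : ℕ} {X : Type u} [TopologicalSpace X] [ChartedSpace (Fin n → ℂ) X]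
  {D : SNCDivisor.{u, v} n X}

/-! ### The Lie algebroid of the family of groups -/

variable {x : X}

theorem isMerUnit_one : D.IsMerUnit ⊤ (fun _ => 1) := isMerUnit_const one_ne_zero ⊤

theorem sec_one_apply (x : X) (t : ℂ) : D.sec (fun _ => 1) (x, t) = ⟨x, D.cst x t⟩ := by
  rw [sec, value_one, one_mul]

theorem sec_one_one (x : X) : D.sec (fun _ => 1) (x, 1) = ⟨x, 1⟩ := by
  rw [sec_one_apply, cst_one]

theorem quo_one (v : Σ x, D.Fib x) : quo (fun _ => 1) v = coef v.2 := by
  simp [quo, value_one]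

theorem ordEq_one_iff {v : Σ x, D.Fib x} : OrdEq (fun _ => 1) v ↔ ord v.2 = 0 := by
  simp [OrdEq, value_one]

theorem contMDiffAt_sec_one (x : X) : ContMDiffAt (𝓘(ℂ, Fin n → ℂ).prod 𝓘(ℂ, ℂ))
    𝓘(ℂ, (Fin n → ℂ) × ℂ) ω (D.sec (fun _ => 1)) (x, 1) :=
  contMDiffAt_sec isMerUnit_one (Opens.mem_top _) one_ne_zero

theorem contMDiffAt_quo_one {v : Σ x, D.Fib x} (hv : ord v.2 = 0) :
    ContMDiffAt 𝓘(ℂ, (Fin n → ℂ) × ℂ) 𝓘(ℂ, ℂ) ω (quo (D := D) (fun _ => 1)) v :=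
  (contMDiffAt_quo isMerUnit_one (Opens.mem_top _) (ordEq_one_iff.2 hv)).1

theorem ord_pow (v : D.Fib x) (N : ℕ) : ord (v ^ N) = N • ord v := by simp [ord]

variable (D) in
/-- The differential at the unit of the constant coefficient, a holomorphic function near the unit
section. -/
def dcoef (x : X) : TangentSpace 𝓘(ℂ, (Fin n → ℂ) × ℂ) (⟨x, 1⟩ : Σ x, D.Fib x) →L[ℂ] ℂ :=
  mfderiv 𝓘(ℂ, (Fin n → ℂ) × ℂ) 𝓘(ℂ, ℂ) (quo (D := D) (fun _ => 1)) ⟨x, 1⟩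

/-- A tangent vector at the unit is determined by its components along the base and the group. -/
theorem tangent_one_ext {ξ η : TangentSpace 𝓘(ℂ, (Fin n → ℂ) × ℂ) (⟨x, 1⟩ : Σ x, D.Fib x)}
    (h1 : mfderiv 𝓘(ℂ, (Fin n → ℂ) × ℂ) 𝓘(ℂ, Fin n → ℂ) (fun v : Σ x, D.Fib x => v.1) ⟨x, 1⟩ ξ =
      mfderiv 𝓘(ℂ, (Fin n → ℂ) × ℂ) 𝓘(ℂ, Fin n → ℂ) (fun v : Σ x, D.Fib x => v.1) ⟨x, 1⟩ η)
    (h2 : D.dcoef x ξ = D.dcoef x η) : ξ = η := by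
  have hq := contMDiffAt_quo isMerUnit_one (D := D) (v := ⟨x, 1⟩) (Opens.mem_top _)
    (ordEq_one_iff.2 (ord_one))
  have hf : HasMFDerivAt 𝓘(ℂ, (Fin n → ℂ) × ℂ) (𝓘(ℂ, Fin n → ℂ).prod 𝓘(ℂ, ℂ))
      (fun v : Σ x, D.Fib x => (v.1, quo (fun _ => 1) v)) ⟨x, 1⟩ _ :=
    (contMDiff_fib_fst.contMDiffAt.mdifferentiableAt (by simp)).hasMFDerivAt.prodMk
      (hq.1.mdifferentiableAt (by simp)).hasMFDerivAt
  have hp : ((fun v : Σ x, D.Fib x => (v.1, quo (fun _ => 1) v)) ⟨x, 1⟩) = (x, 1) := by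
    simp [quo_one]
  have hs : MDifferentiableAt (𝓘(ℂ, Fin n → ℂ).prod 𝓘(ℂ, ℂ)) 𝓘(ℂ, (Fin n → ℂ) × ℂ)
      (D.sec (fun _ => 1)) ((fun v : Σ x, D.Fib x => (v.1, quo (fun _ => 1) v)) ⟨x, 1⟩) := by
    rw [hp]
    exact (contMDiffAt_sec_one x).mdifferentiableAt (by simp)
  have hc := (hs.hasMFDerivAt.comp (⟨x, 1⟩ : Σ x, D.Fib x) hf).congr_of_eventuallyEq
    (f₁ := id) (by
      filter_upwards [hq.2] with v hv
      exact (sec_quo hv).symm)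
  have hid := hasMFDerivAt_unique hc (hasMFDerivAt_id (I := 𝓘(ℂ, (Fin n → ℂ) × ℂ)) _)
  have e1 := DFunLike.congr_fun hid ξ
  have e2 := DFunLike.congr_fun hid η
  refine e1.symm.trans (Eq.trans ?_ e2)
  exact congrArg (mfderiv (𝓘(ℂ, Fin n → ℂ).prod 𝓘(ℂ, ℂ)) 𝓘(ℂ, (Fin n → ℂ) × ℂ)
    (D.sec (fun _ => 1)) _) (Prod.ext h1 h2)

/-- The tangent vector at the unit of the group over `x` with coefficient `c`. (Its base point is
the unit only up to the propositional equality `sec_one_one`.) -/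
def unitVec (x : X) (c : ℂ) :
    TangentSpace 𝓘(ℂ, (Fin n → ℂ) × ℂ) (D.sec (fun _ => 1) (x, 1)) :=
  mfderiv (𝓘(ℂ, Fin n → ℂ).prod 𝓘(ℂ, ℂ)) 𝓘(ℂ, (Fin n → ℂ) × ℂ) (D.sec (fun _ => 1)) (x, 1)
    ((0, c) : (Fin n → ℂ) × ℂ)

theorem mfderiv_fst_unitVec (x : X) (c : ℂ) :
    mfderiv 𝓘(ℂ, (Fin n → ℂ) × ℂ) 𝓘(ℂ, Fin n → ℂ) (fun v : Σ x, D.Fib x => v.1)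
      (D.sec (fun _ => 1) (x, 1)) (unitVec x c) = 0 := by
  have h1 := HasMFDerivAt.comp (x, (1 : ℂ))
    ((contMDiff_fib_fst (D := D)).contMDiffAt.mdifferentiableAt (by simp)).hasMFDerivAt
    ((contMDiffAt_sec_one x).mdifferentiableAt (by simp)).hasMFDerivAt
  have h2 := hasMFDerivAt_unique h1
    (hasMFDerivAt_fst (I := 𝓘(ℂ, Fin n → ℂ)) (I' := 𝓘(ℂ, ℂ)) (x := (x, (1 : ℂ))))
  exact DFunLike.congr_fun h2 ((0, c) : (Fin n → ℂ) × ℂ)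

theorem mfderiv_quo_unitVec (x : X) (c : ℂ) :
    (mfderiv 𝓘(ℂ, (Fin n → ℂ) × ℂ) 𝓘(ℂ, ℂ) (quo (D := D) (fun _ => 1))
      (D.sec (fun _ => 1) (x, 1)) (unitVec x c) : ℂ) = c := by
  have h0 : ord (D.sec (fun _ => 1) (x, 1)).2 = 0 := by rw [sec_one_one, ord_one]
  have h1 := HasMFDerivAt.comp (x, (1 : ℂ))
    ((contMDiffAt_quo_one h0).mdifferentiableAt (by simp)).hasMFDerivAt
    ((contMDiffAt_sec_one x).mdifferentiableAt (by simp)).hasMFDerivAt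
  have h2 := hasMFDerivAt_unique (h1.congr_of_eventuallyEq (f₁ := Prod.snd) (by
      have : ∀ᶠ z : X × ℂ in 𝓝 (x, 1), z.2 ≠ 0 :=
        continuousAt_snd.eventually_ne one_ne_zero
      filter_upwards [this] with z hz
      exact (quo_sec hz).symm))
    (hasMFDerivAt_snd (I := 𝓘(ℂ, Fin n → ℂ)) (I' := 𝓘(ℂ, ℂ)) (x := (x, (1 : ℂ))))
  exact DFunLike.congr_fun h2 ((0, c) : (Fin n → ℂ) × ℂ)

variable (D) in
/-- The trivialization of the Lie algebroid of the family of groups. -/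
def triv (x : X) : ℂ ≃ₗ[ℂ] LieFibre (E := Fin n → ℂ) (EM := (Fin n → ℂ) × ℂ) D.Fib x :=
  haveI hx : D.sec (fun _ => 1) (x, 1) = ⟨x, 1⟩ := sec_one_one x
  LinearEquiv.symm <| LinearEquiv.ofBijective
    ((D.dcoef x).toLinearMap ∘ₗ
      (LieFibre (E := Fin n → ℂ) (EM := (Fin n → ℂ) × ℂ) D.Fib x).subtype) <| by
    refine ⟨fun ξ η h => Subtype.ext (tangent_one_ext ?_ h), fun c => ?_⟩
    · exact (LinearMap.mem_ker.1 ξ.2).trans (LinearMap.mem_ker.1 η.2).symm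
    · have h1 := mfderiv_fst_unitVec (D := D) x c
      have h2 := mfderiv_quo_unitVec (D := D) x c
      rw [hx] at h1 h2
      exact ⟨⟨_, LinearMap.mem_ker.2 h1⟩, h2⟩

theorem dcoef_triv (c : ℂ) : D.dcoef x (D.triv x c).1 = c :=
  (D.triv x).symm_apply_apply c

theorem triv_val (x : X) (c : ℂ) : ((D.triv x c).1 : (Fin n → ℂ) × ℂ) = unitVec (D := D) x c := by
  have h1 := mfderiv_fst_unitVec (D := D) x c
  have h2 := mfderiv_quo_unitVec (D := D) x c
  rw [sec_one_one] at h1 h2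
  exact tangent_one_ext (ξ := (D.triv x c).1) (η := unitVec (D := D) x c)
    ((LinearMap.mem_ker.1 (D.triv x c).2).trans h1.symm) ((dcoef_triv c).trans h2.symm)

/-- The holomorphic sections of the Lie algebroid are the holomorphic functions. -/
theorem isLieSection_iff [IsManifold 𝓘(ℂ, Fin n → ℂ) ω X] {U : Opens X}
    {σ : ∀ x, LieFibre (E := Fin n → ℂ) (EM := (Fin n → ℂ) × ℂ) D.Fib x} :
    IsLieSection D.Fib U σ ↔ ∀ x ∈ U, HolAt n (fun y => (D.triv y).symm (σ y)) x := by
  constructor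
  · intro h x hx
    exact contMDiffAt_mfderiv_apply (contMDiffAt_quo_one ord_one)
      (h.contMDiffAt (U.isOpen.mem_nhds hx))
  · intro h x hx
    have h1 : ContMDiffAt 𝓘(ℂ, Fin n → ℂ) (𝓘(ℂ, Fin n → ℂ).prod 𝓘(ℂ, ℂ)).tangent ω
        (fun y : X => (⟨(y, 1), ((0, (D.triv y).symm (σ y)) : (Fin n → ℂ) × ℂ)⟩ :
          TangentBundle (𝓘(ℂ, Fin n → ℂ).prod 𝓘(ℂ, ℂ)) (X × ℂ))) x := by
      have h2 := (contMDiff_equivTangentBundleProd_symm (I := 𝓘(ℂ, Fin n → ℂ)) (M := X)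
        (I' := 𝓘(ℂ, ℂ)) (M' := ℂ) (n := ω))
      have h3 : ContMDiffAt 𝓘(ℂ, Fin n → ℂ) 𝓘(ℂ, Fin n → ℂ).tangent ω
          (fun y : X => (⟨y, 0⟩ : TangentBundle 𝓘(ℂ, Fin n → ℂ) X)) x :=
        Bundle.contMDiff_zeroSection ℂ (TangentSpace 𝓘(ℂ, Fin n → ℂ) : X → Type _) x
      exact h2.contMDiffAt.comp x (h3.prodMk
        (contMDiffAt_modelSpace_section (b := fun _ => 1) contMDiffAt_const (h x hx)))
    have h4 := contMDiffAt_mfderiv_section (b := fun y : X => (y, (1 : ℂ))) (y := x)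
      (contMDiffAt_sec_one (D := D) x) h1
    refine (h4.congr_of_eventuallyEq (Eventually.of_forall fun y => ?_)).contMDiffWithinAt
    have h5 : ∀ (w : Σ x, D.Fib x) (_ : ⟨y, 1⟩ = w)
        (η : TangentSpace 𝓘(ℂ, (Fin n → ℂ) × ℂ) w)
        (_ : ((σ y).1 : (Fin n → ℂ) × ℂ) = η),
        (⟨⟨y, 1⟩, (σ y).1⟩ : TangentBundle 𝓘(ℂ, (Fin n → ℂ) × ℂ) (Σ x, D.Fib x)) = ⟨w, η⟩ := by
      rintro w rfl η rfl
      rfl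
    refine h5 _ (sec_one_one y).symm _ ?_
    have h6 := triv_val (D := D) y ((D.triv y).symm (σ y))
    rw [LinearEquiv.apply_symm_apply] at h6
    exact h6

/-- The velocity of a curve of constants is the derivative of the constants. -/
theorem hasVelocity_triv {c : ℂ → D.Fib x} {G : ℂ → ℂ} {a : ℂ} (hG : HasDerivAt G a 0)
    (h0 : G 0 = 1) (h : ∀ᶠ ε in 𝓝 0, c ε = D.cst x (G ε)) :
    HasVelocity D.Fib c (D.triv x a) := by
  refine ⟨by rw [h.self_of_nhds, h0, cst_one], ?_⟩
  have h1 : HasMFDerivAt 𝓘(ℂ, ℂ) (𝓘(ℂ, Fin n → ℂ).prod 𝓘(ℂ, ℂ)) (fun ε => (x, G ε)) 0 _ :=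
    (hasMFDerivAt_const x (0 : ℂ)).prodMk hG.hasFDerivAt.hasMFDerivAt
  have h2 : MDifferentiableAt (𝓘(ℂ, Fin n → ℂ).prod 𝓘(ℂ, ℂ)) 𝓘(ℂ, (Fin n → ℂ) × ℂ)
      (D.sec (fun _ => 1)) (x, G 0) := by
    rw [h0]
    exact (contMDiffAt_sec_one x).mdifferentiableAt (by simp)
  have h3 := (HasMFDerivAt.comp (0 : ℂ) h2.hasMFDerivAt h1).congr_of_eventuallyEq
    (f₁ := fun ε => (⟨x, c ε⟩ : Σ x, D.Fib x)) (by
      filter_upwards [h] with ε hε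
      rw [Function.comp_apply, sec_one_apply, hε])
  refine hasMFDerivAt_toSpanSingleton h3 ?_
  have h4 : ∀ t : ℂ, t = 1 → (mfderiv (𝓘(ℂ, Fin n → ℂ).prod 𝓘(ℂ, ℂ)) 𝓘(ℂ, (Fin n → ℂ) × ℂ)
      (D.sec (fun _ => 1)) (x, t) ((0, a) : (Fin n → ℂ) × ℂ) : (Fin n → ℂ) × ℂ) =
      (D.triv x a).1 := by
    rintro t rfl
    exact (triv_val x a).symm
  refine Eq.trans ?_ (h4 (G 0) h0)
  exact congrArg (mfderiv (𝓘(ℂ, Fin n → ℂ).prod 𝓘(ℂ, ℂ)) 𝓘(ℂ, (Fin n → ℂ) × ℂ)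
    (D.sec (fun _ => 1)) (x, G 0)) (Prod.ext rfl (one_smul ℂ a))

/-- Conversely, a curve through the unit consists of constants for small times, and their derivative
is its velocity. -/
theorem _root_.LogPair.HasVelocity.hasDerivAt_coef {c : ℂ → D.Fib x}
    {a : LieFibre (E := Fin n → ℂ) (EM := (Fin n → ℂ) × ℂ) D.Fib x}
    (h : HasVelocity D.Fib c a) :
    HasDerivAt (fun ε => (coef (c ε) : ℂ)) ((D.triv x).symm a) 0 ∧
      ∀ᶠ ε in 𝓝 0, ord (c ε) = 0 := by
  obtain ⟨h0, hd⟩ := h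
  have hq := contMDiffAt_quo isMerUnit_one (D := D) (v := ⟨x, c 0⟩) (Opens.mem_top _)
    (ordEq_one_iff.2 (by rw [h0, ord_one]))
  refine ⟨?_, ?_⟩
  · have h1 := hasDerivAt_comp_curve (f := quo (D := D) (fun _ => 1))
      (γ := fun ε => (⟨x, c ε⟩ : Σ x, D.Fib x)) (hq.1.mdifferentiableAt (by simp)) hd
    have h2 : ∀ w : D.Fib x, w = 1 → (mfderiv 𝓘(ℂ, (Fin n → ℂ) × ℂ) 𝓘(ℂ, ℂ)
        (quo (D := D) (fun _ => 1)) ⟨x, w⟩ (a.1 : (Fin n → ℂ) × ℂ) : ℂ) = (D.triv x).symm a := by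
      rintro w rfl
      rfl
    rw [h2 _ h0] at h1
    refine h1.congr_of_eventuallyEq (Eventually.of_forall fun ε => ?_)
    exact (quo_one (⟨x, c ε⟩ : Σ x, D.Fib x)).symm
  · filter_upwards [hd.continuousAt.eventually hq.2] with ε hε
    exact ordEq_one_iff.1 hε

theorem isExp_triv (x : X) (a : ℂ) : IsExp D.Fib (D.triv x a) (D.cst x (Complex.exp a)) := by
  refine ⟨MonoidHom.mk' (fun t => D.cst x (Complex.exp (t.toAdd * a))) fun s t => ?_,
    hasVelocity_triv (G := fun t => Complex.exp (t * a)) ?_ (by simp)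
      (Eventually.of_forall fun _ => rfl), ?_⟩
  · rw [← cst_mul (Complex.exp_ne_zero _) (Complex.exp_ne_zero _), ← Complex.exp_add, ← add_mul]
    rfl
  · simpa using ((hasDerivAt_id (0 : ℂ)).mul_const a).cexp
  · simp

/-- A one-parameter subgroup is the exponential of its velocity: it stays in the unit component. -/
theorem _root_.LogPair.IsExp.eq_cst
    {a : LieFibre (E := Fin n → ℂ) (EM := (Fin n → ℂ) × ℂ) D.Fib x} {b : D.Fib x}
    (h : IsExp D.Fib a b) : b = D.cst x (Complex.exp ((D.triv x).symm a)) := by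
  obtain ⟨φ, hφ, rfl⟩ := h
  obtain ⟨h1, h2⟩ := hφ.hasDerivAt_coef
  set α := (D.triv x).symm a
  -- the coefficient `k` is multiplicative, so it satisfies `k' = k α`
  set k : ℂ → ℂ := fun t => (coef (φ (Multiplicative.ofAdd t)) : ℂ)
  have hadd : ∀ s t, k (s + t) = k s * k t := fun s t => by simp [k]
  have hk : ∀ t, HasDerivAt k (k t * α) t := by
    intro t
    have h3 : HasDerivAt (fun s => k t * k (s - t)) (k t * α) t := by
      refine HasDerivAt.const_mul _ ?_
      have h4 : HasDerivAt k α (t - t) := by rw [sub_self]; exact h1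
      simpa using h4.comp_sub_const t t
    refine h3.congr_of_eventuallyEq (Eventually.of_forall fun s => ?_)
    simp only
    rw [← hadd, add_sub_cancel]
  have hconst : ∀ t, k t * Complex.exp (-(t * α)) = k 0 * Complex.exp (-(0 * α)) := by
    intro t
    refine is_const_of_deriv_eq_zero (𝕜 := ℂ) (f := fun t => k t * Complex.exp (-(t * α)))
      (fun t => ?_) (fun t => ?_) t 0
    · exact (hk t).differentiableAt.mul (by fun_prop)
    · have h5 := (hk t).mul ((((hasDerivAt_id t).mul_const α).neg).cexp)
      refine h5.deriv.trans ?_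
      simp only [id]
      ring
  have hk1 : k 1 = Complex.exp α := by
    have h6 := hconst 1
    have h7 : k 0 = 1 := by simp [k]
    rw [h7, one_mul, zero_mul, neg_zero, Complex.exp_zero, Complex.exp_neg, mul_one,
      mul_inv_eq_one₀ (Complex.exp_ne_zero _)] at h6
    exact h6
  -- the exponents at time `1` are a multiple of those at time `1 / (N + 1)`, which vanish
  have hord : ord (φ (Multiplicative.ofAdd 1)) = 0 := by
    have h8 : Tendsto (fun N : ℕ => ((N : ℂ) + 1)⁻¹) atTop (𝓝 0) := by
      simpa using tendsto_one_div_add_atTop_nhds_zero_nat (𝕜 := ℂ)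
    obtain ⟨N, hN⟩ := (h8.eventually h2).exists
    have h9 : φ (Multiplicative.ofAdd 1) = φ (Multiplicative.ofAdd ((N : ℂ) + 1)⁻¹) ^ (N + 1) := by
      rw [← map_pow, ← ofAdd_nsmul]
      congr 2
      have : (N : ℂ) + 1 ≠ 0 := Nat.cast_add_one_ne_zero N
      simp [this]
    rw [h9, ord_pow, hN, smul_zero]
  refine fib_ext (Units.ext ?_) (by simp [hord])
  rw [coef_cst (Complex.exp_ne_zero _)]
  exact hk1

end SNCDivisor

namespace SNCDivisor

variable {n : ℕ} {X : Type u} [TopologicalSpace X] [ChartedSpace (Fin n → ℂ) X]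
  {D : SNCDivisor.{u, v} n X}

/-! ### Logarithmic derivatives -/

variable {V W : ∀ x : X, TangentSpace 𝓘(ℂ, Fin n → ℂ) x} {f g : X → ℂ} {x : X}

theorem lieDeriv_mul (hf : HolAt n f x) (hg : HolAt n g x) :
    lieDeriv V (fun y => f y * g y) x = f x * lieDeriv V g x + g x * lieDeriv V f x :=
  differential_mul hf hg (V x)

theorem lieDeriv_congr (h : f =ᶠ[𝓝 x] g) : lieDeriv V f x = lieDeriv V g x :=
  differential_congr h (V x)

theorem differential_add (hf : HolAt n f x) (hg : HolAt n g x)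
    (ξ : TangentSpace 𝓘(ℂ, Fin n → ℂ) x) :
    differential (fun y => f y + g y) x ξ = differential f x ξ + differential g x ξ := by
  have h := hf.mdifferentiableAt.hasMFDerivAt.add hg.mdifferentiableAt.hasMFDerivAt
  have h1 : mfderiv 𝓘(ℂ, Fin n → ℂ) 𝓘(ℂ, ℂ) (fun y => f y + g y) x = _ := h.mfderiv
  rw [differential, h1]
  rfl

theorem lieDeriv_field_add (f : X → ℂ) (x : X) :
    lieDeriv (fun y => V y + W y) f x = lieDeriv V f x + lieDeriv W f x :=
  map_add (mfderiv 𝓘(ℂ, Fin n → ℂ) 𝓘(ℂ, ℂ) f x) (V x) (W x)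

theorem lieDeriv_field_smul (g f : X → ℂ) (x : X) :
    lieDeriv (fun y => g y • V y) f x = g x * lieDeriv V f x :=
  map_smul (mfderiv 𝓘(ℂ, Fin n → ℂ) 𝓘(ℂ, ℂ) f x) (g x) (V x)

theorem lieDeriv_cexp (hf : HolAt n f x) :
    lieDeriv V (fun y => Complex.exp (f y)) x = Complex.exp (f x) * lieDeriv V f x := by
  have h := (Complex.hasDerivAt_exp (f x)).hasFDerivAt.hasMFDerivAt.comp x
    hf.mdifferentiableAt.hasMFDerivAt
  have h1 : mfderiv 𝓘(ℂ, Fin n → ℂ) 𝓘(ℂ, ℂ) (fun y => Complex.exp (f y)) x = _ := h.mfderiv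
  rw [lieDeriv, differential, h1]
  exact mul_comm _ _

variable (D) in
/-- The logarithmic derivative of `f` along `V`, extended to `D` by its limit from outside (which
exists for meromorphic units and logarithmic fields). -/
def dlogAlong (V : ∀ x : X, TangentSpace 𝓘(ℂ, Fin n → ℂ) x) (f : X → ℂ) (x : X) : ℂ :=
  limUnder (𝓝[D.supportᶜ] x) fun y => lieDeriv V f y / f y

theorem dlogAlong_eq {h : X → ℂ} (hh : ContinuousAt h x)
    (hf : ∀ᶠ y in 𝓝 x, y ∉ D.support → lieDeriv V f y / f y = h y) :
    D.dlogAlong V f x = h x := by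
  refine Tendsto.limUnder_eq ((hh.tendsto.mono_left nhdsWithin_le_nhds).congr' ?_)
  filter_upwards [eventually_off hf] with y hy
  exact hy.symm

/-- As the complement of `D` is dense, continuous functions that agree off `D` agree. -/
theorem eq_of_eventually_off {h k : X → ℂ} (hh : ContinuousAt h x) (hk : ContinuousAt k x)
    (heq : ∀ᶠ y in 𝓝 x, y ∉ D.support → h y = k y) : h x = k x :=
  tendsto_nhds_unique_of_eventuallyEq (hh.tendsto.mono_left nhdsWithin_le_nhds)
    (hk.tendsto.mono_left nhdsWithin_le_nhds) (eventually_off heq)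

variable (D) in
/-- The germ of `f` at `x` has a holomorphic logarithmic derivative along `V`. -/
def HasDlogAt (V : ∀ x : X, TangentSpace 𝓘(ℂ, Fin n → ℂ) x) (f : X → ℂ) (x : X) : Prop :=
  ∃ h : X → ℂ, HolAt n h x ∧ ∀ᶠ y in 𝓝 x, y ∉ D.support →
    HolAt n f y ∧ f y ≠ 0 ∧ lieDeriv V f y = h y * f y

theorem HasDlogAt.mul (hf : D.HasDlogAt V f x) (hg : D.HasDlogAt V g x) :
    D.HasDlogAt V (fun y => f y * g y) x := by
  obtain ⟨h, hh, hf⟩ := hf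
  obtain ⟨k, hk, hg⟩ := hg
  refine ⟨fun y => h y + k y, hh.add hk, ?_⟩
  filter_upwards [hf, hg] with y hf hg hy
  obtain ⟨h1, h2, h3⟩ := hf hy
  obtain ⟨h4, h5, h6⟩ := hg hy
  refine ⟨h1.mul h4, mul_ne_zero h2 h5, ?_⟩
  rw [lieDeriv_mul h1 h4, h3, h6]
  ring

theorem HasDlogAt.inv (hf : D.HasDlogAt V f x) : D.HasDlogAt V (fun y => (f y)⁻¹) x := by
  obtain ⟨h, hh, hf⟩ := hf
  refine ⟨fun y => -h y, hh.neg, ?_⟩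
  filter_upwards [hf] with y hf hy
  obtain ⟨h1, h2, h3⟩ := hf hy
  have h4 : HolAt n (fun z => (f z)⁻¹) y := h1.inv₀ h2
  refine ⟨h4, inv_ne_zero h2, ?_⟩
  have h5 : lieDeriv V (fun z => f z * (f z)⁻¹) y = 0 := by
    refine (lieDeriv_congr (g := fun _ => 1) ?_).trans (differential_const 1 y (V y))
    filter_upwards [h1.continuousAt.eventually_ne h2] with z hz
    exact mul_inv_cancel₀ hz
  rw [lieDeriv_mul h1 h4, h3] at h5
  refine mul_left_cancel₀ h2 ?_
  linear_combination h5

theorem hasDlogAt_of_holAt [IsManifold 𝓘(ℂ, Fin n → ℂ) ω X] (hf : HolAt n f x) (h0 : f x ≠ 0)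
    (hV : ContMDiffAt 𝓘(ℂ, Fin n → ℂ) 𝓘(ℂ, Fin n → ℂ).tangent ω
      (fun x => (⟨x, V x⟩ : TangentBundle 𝓘(ℂ, Fin n → ℂ) X)) x) :
    D.HasDlogAt V f x := by
  refine ⟨fun y => lieDeriv V f y / f y, ContMDiffAt.div₀ (holAt_lieDeriv hf hV) hf h0, ?_⟩
  filter_upwards [D.eventually_holAt hf, hf.continuousAt.eventually_ne h0] with y h1 h2 _
  exact ⟨h1, h2, (div_mul_cancel₀ _ h2).symm⟩

/-- The logarithmic derivative depends only on the function off `D`. -/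
theorem HasDlogAt.congr (hf : D.HasDlogAt V f x)
    (h : ∀ᶠ y in 𝓝 x, y ∉ D.support → g y = f y) : D.HasDlogAt V g x := by
  obtain ⟨k, hk, hf⟩ := hf
  refine ⟨k, hk, ?_⟩
  filter_upwards [hf, h.eventually_nhds] with y hf hg hy
  obtain ⟨h1, h2, h3⟩ := hf hy
  have h4 : g =ᶠ[𝓝 y] f := by
    filter_upwards [hg, eventually_notMem_support hy] with z hz hzD
    exact hz hzD
  exact ⟨h1.congr_of_eventuallyEq h4, h4.eq_of_nhds ▸ h2, by
    rw [lieDeriv_congr h4, h4.eq_of_nhds, h3]⟩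

theorem hasDlogAt_const {c : ℂ} (hc : c ≠ 0) : D.HasDlogAt V (fun _ => c) x :=
  ⟨fun _ => 0, contMDiffAt_const, Eventually.of_forall fun y _ =>
    ⟨contMDiffAt_const, hc, (differential_const c y (V y)).trans (zero_mul _).symm⟩⟩

theorem HasDlogAt.zpow (hf : D.HasDlogAt V f x) (m : ℤ) :
    D.HasDlogAt V (fun y => f y ^ m) x := by
  have hpow : ∀ N : ℕ, D.HasDlogAt V (fun y => f y ^ N) x := by
    intro N
    induction N with
    | zero => simpa using hasDlogAt_const (D := D) one_ne_zero
    | succ N ih => simpa only [pow_succ] using ih.mul hf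
  cases m with
  | ofNat N => simpa using hpow N
  | negSucc N => simpa only [zpow_negSucc] using (hpow (N + 1)).inv

section LogField

variable [IsManifold 𝓘(ℂ, Fin n → ℂ) ω X] {U : Opens X}

theorem IsLogField.contMDiffAt (hV : D.IsLogField U V) (hx : x ∈ U) :
    ContMDiffAt 𝓘(ℂ, Fin n → ℂ) 𝓘(ℂ, Fin n → ℂ).tangent ω
      (fun x => (⟨x, V x⟩ : TangentBundle 𝓘(ℂ, Fin n → ℂ) X)) x :=
  hV.holomorphic.contMDiffAt (U.isOpen.mem_nhds hx)

/-- A coordinate that defines `D` divides its derivative along a logarithmic field. -/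
theorem IsLogField.exists_lieDeriv_zeta (hV : D.IsLogField U V) (hx : x ∈ U) (i : D.ι) :
    ∃ q : X → ℂ, HolAt n q x ∧ ∀ᶠ y in 𝓝 x, lieDeriv V (D.zeta x i) y = q y * D.zeta x i y := by
  by_cases hi : x ∈ D.comp i
  · obtain ⟨q, hq, h⟩ := D.exists_eq_zeta_mul (i := i)
      (holAt_lieDeriv (D.holAt_zeta (D.mem_dom_self x) i) (hV.contMDiffAt hx)) hi (by
        filter_upwards [(D.dom x).isOpen.mem_nhds (D.mem_dom_self x), U.isOpen.mem_nhds hx]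
          with y hy hyU hyi
        exact ((D.isDefiningFunction_zeta x i).mem_tangentTo_iff hy hyi _).1
          (hV.tangent y hyU i hyi))
    refine ⟨q, hq, ?_⟩
    filter_upwards [h] with y hy
    rw [hy, mul_comm]
  · refine ⟨fun _ => 0, contMDiffAt_const, Eventually.of_forall fun y => ?_⟩
    have : D.zeta x i = fun _ => 1 := funext (D.zeta_of_notMem hi)
    rw [this, zero_mul]
    exact differential_const 1 y (V y)

theorem IsLogField.hasDlogAt_zeta (hV : D.IsLogField U V) (hx : x ∈ U) (i : D.ι) :
    D.HasDlogAt V (D.zeta x i) x := by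
  obtain ⟨q, hq, h⟩ := hV.exists_lieDeriv_zeta hx i
  refine ⟨q, hq, ?_⟩
  filter_upwards [h, (D.dom x).isOpen.mem_nhds (D.mem_dom_self x)] with y hy hyd hD
  exact ⟨D.holAt_zeta hyd i,
    fun h => D.notMem_support.1 hD i ((D.zeta_eq_zero_iff hyd i).1 h), hy⟩

theorem IsLogField.hasDlogAt_mono (hV : D.IsLogField U V) (hx : x ∈ U) (m : D.Through x → ℤ) :
    D.HasDlogAt V (D.mono x m) x := by
  have h1 : D.mono x m = ∏ i : D.Through x, fun y => D.zeta x i y ^ m i := by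
    funext y
    simp [mono]
  rw [h1]
  exact Finset.prod_induction _ (fun f => D.HasDlogAt V f x) (fun _ _ hf hg => hf.mul hg)
    (hasDlogAt_const one_ne_zero) fun i _ => (hV.hasDlogAt_zeta hx i).zpow (m i)

theorem IsLogField.hasDlogAt (hV : D.IsLogField U V) (hf : D.IsMerUnit U f) (hx : x ∈ U) :
    D.HasDlogAt V f x := by
  obtain ⟨m, u, hu, hu0, h⟩ := hf.exists_eq_mul_mono hx
  exact ((hasDlogAt_of_holAt hu hu0 (hV.contMDiffAt hx)).mul (hV.hasDlogAt_mono hx m)).congr h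

theorem dlogAlong_of_notMem (hV : D.IsLogField U V) (hf : D.IsMerUnit U f) (hx : x ∈ U)
    (hD : x ∉ D.support) : D.dlogAlong V f x = lieDeriv V f x / f x :=
  dlogAlong_eq (h := fun y => lieDeriv V f y / f y)
    (ContMDiffAt.div₀ (holAt_lieDeriv (hf.holAt hx hD) (hV.contMDiffAt hx)) (hf.holAt hx hD)
      (hf.ne_zero x ⟨hx, hD⟩)).continuousAt (Eventually.of_forall fun _ _ => rfl)

theorem holAt_dlogAlong (hV : D.IsLogField U V) (hf : D.IsMerUnit U f) (hx : x ∈ U) :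
    HolAt n (D.dlogAlong V f) x := by
  obtain ⟨h, hh, he⟩ := hV.hasDlogAt hf hx
  refine hh.congr_of_eventuallyEq ?_
  filter_upwards [he.eventually_nhds, D.eventually_holAt hh] with y hy hhy
  refine dlogAlong_eq hhy.continuousAt ?_
  filter_upwards [hy] with z hz hzD
  rw [(hz hzD).2.2, mul_div_cancel_right₀ _ (hz hzD).2.1]

theorem isDlog_dlogAlong (hV : D.IsLogField U V) (hf : D.IsMerUnit U f) :
    D.IsDlog U f V (D.dlogAlong V f) :=
  ⟨fun _ hx => (holAt_dlogAlong hV hf hx).contMDiffWithinAt,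
    fun _ hx => dlogAlong_of_notMem hV hf hx.1 hx.2⟩

end LogField

end SNCDivisor

namespace SNCDivisor

variable {n : ℕ} {X : Type u} [TopologicalSpace X] [ChartedSpace (Fin n → ℂ) X]
  {D : SNCDivisor.{u, v} n X} [IsManifold 𝓘(ℂ, Fin n → ℂ) ω X]

/-! ### The module over the logarithmic tangent sheaf -/

variable {V W : ∀ x : X, TangentSpace 𝓘(ℂ, Fin n → ℂ) x} {f g : X → ℂ} {x : X} {U : Opens X}

theorem dlogAlong_congr {V' : ∀ x : X, TangentSpace 𝓘(ℂ, Fin n → ℂ) x}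
    (hV : D.IsLogField U V) (hf : D.IsMerUnit U f) (hx : x ∈ U)
    (hVV' : ∀ᶠ y in 𝓝 x, V' y = V y) (hfg : ∀ᶠ y in 𝓝 x, y ∉ D.support → g y = f y) :
    D.dlogAlong V' g x = D.dlogAlong V f x := by
  refine dlogAlong_eq (holAt_dlogAlong hV hf hx).continuousAt ?_
  filter_upwards [hVV', hfg.eventually_nhds, U.isOpen.mem_nhds hx] with y h1 h2 h3 hy
  have h4 : g =ᶠ[𝓝 y] f := by
    filter_upwards [h2, eventually_notMem_support hy] with z hz hzD
    exact hz hzD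
  rw [dlogAlong_of_notMem hV hf h3 hy, lieDeriv_congr h4, h4.eq_of_nhds, lieDeriv, h1]
  rfl

theorem dlogAlong_mul (hV : D.IsLogField U V) (hf : D.IsMerUnit U f) (hg : D.IsMerUnit U g)
    (hx : x ∈ U) :
    D.dlogAlong V (fun y => f y * g y) x = D.dlogAlong V f x + D.dlogAlong V g x := by
  refine dlogAlong_eq (h := fun y => D.dlogAlong V f y + D.dlogAlong V g y)
    ((holAt_dlogAlong hV hf hx).add (holAt_dlogAlong hV hg hx)).continuousAt ?_
  filter_upwards [U.isOpen.mem_nhds hx] with y hyU hy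
  have h1 := hf.ne_zero y ⟨hyU, hy⟩
  have h2 := hg.ne_zero y ⟨hyU, hy⟩
  rw [dlogAlong_of_notMem hV hf hyU hy, dlogAlong_of_notMem hV hg hyU hy,
    lieDeriv_mul (hf.holAt hyU hy) (hg.holAt hyU hy)]
  field_simp
  ring

theorem dlogAlong_field_add (hV : D.IsLogField U V) (hW : D.IsLogField U W)
    (hf : D.IsMerUnit U f) (hx : x ∈ U) :
    D.dlogAlong (fun y => V y + W y) f x = D.dlogAlong V f x + D.dlogAlong W f x := by
  refine dlogAlong_eq (h := fun y => D.dlogAlong V f y + D.dlogAlong W f y)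
    ((holAt_dlogAlong hV hf hx).add (holAt_dlogAlong hW hf hx)).continuousAt ?_
  filter_upwards [U.isOpen.mem_nhds hx] with y hyU hy
  rw [dlogAlong_of_notMem hV hf hyU hy, dlogAlong_of_notMem hW hf hyU hy, lieDeriv_field_add,
    add_div]

theorem dlogAlong_field_smul (hV : D.IsLogField U V) (hf : D.IsMerUnit U f)
    (hg : HolAt n g x) (hx : x ∈ U) :
    D.dlogAlong (fun y => g y • V y) f x = g x * D.dlogAlong V f x := by
  refine dlogAlong_eq (h := fun y => g y * D.dlogAlong V f y)
    (hg.mul (holAt_dlogAlong hV hf hx)).continuousAt ?_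
  filter_upwards [U.isOpen.mem_nhds hx] with y hyU hy
  rw [dlogAlong_of_notMem hV hf hyU hy, lieDeriv_field_smul, mul_div_assoc]

/-- The form `dlog f` is closed. -/
theorem dlogAlong_mlieBracket (hV : D.IsLogField U V) (hW : D.IsLogField U W)
    (hf : D.IsMerUnit U f) (hx : x ∈ U) :
    D.dlogAlong (fun y => VectorField.mlieBracket 𝓘(ℂ, Fin n → ℂ) V W y) f x =
      lieDeriv V (D.dlogAlong W f) x - lieDeriv W (D.dlogAlong V f) x := by
  refine dlogAlong_eq
    (h := fun y => lieDeriv V (D.dlogAlong W f) y - lieDeriv W (D.dlogAlong V f) y)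
    ((holAt_lieDeriv (holAt_dlogAlong hW hf hx) (hV.contMDiffAt hx)).sub
      (holAt_lieDeriv (holAt_dlogAlong hV hf hx) (hW.contMDiffAt hx))).continuousAt ?_
  filter_upwards [U.isOpen.mem_nhds hx] with y hyU hy
  have h0 := hf.ne_zero y ⟨hyU, hy⟩
  have key : ∀ {W' : ∀ x : X, TangentSpace 𝓘(ℂ, Fin n → ℂ) x}, D.IsLogField U W' →
      lieDeriv W' f =ᶠ[𝓝 y] fun z => f z * D.dlogAlong W' f z := by
    intro W' hW'
    filter_upwards [U.isOpen.mem_nhds hyU, eventually_notMem_support hy] with z hzU hz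
    rw [dlogAlong_of_notMem hW' hf hzU hz, mul_div_cancel₀ _ (hf.ne_zero z ⟨hzU, hz⟩)]
  have h1 := hf.holAt hyU hy
  rw [lieDeriv_mlieBracket h1 (hV.contMDiffAt hyU) (hW.contMDiffAt hyU),
    lieDeriv_congr (key hV), lieDeriv_congr (key hW),
    lieDeriv_mul h1 (holAt_dlogAlong hV hf hyU), lieDeriv_mul h1 (holAt_dlogAlong hW hf hyU),
    (key hV).eq_of_nhds, (key hW).eq_of_nhds, div_eq_iff h0]
  ring

theorem dlogAlong_cexp (hV : D.IsLogField U V) (hg : ∀ y ∈ U, HolAt n g y) (hx : x ∈ U) :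
    D.dlogAlong V (fun y => Complex.exp (g y)) x = lieDeriv V g x := by
  refine dlogAlong_eq (holAt_lieDeriv (hg x hx) (hV.contMDiffAt hx)).continuousAt ?_
  filter_upwards [U.isOpen.mem_nhds hx] with y hyU _
  rw [lieDeriv_cexp (hg y hyU), mul_div_cancel_left₀ _ (Complex.exp_ne_zero _)]

/-- A section as a meromorphic function: off `D` its constant coefficient is its value. -/
abbrev coefFun (s : ∀ x, D.Fib x) (x : X) : ℂ := (coef (s x) : ℂ)

variable (D) in
/-- The module structure given by the logarithmic derivative. All identities for it hold off `D`,
where they are rules for derivatives of functions, and extend to `D` by continuity. -/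
def logModule : D.LogModule (EM := (Fin n → ℂ) × ℂ) D.Fib where
  L _ V σ x := D.triv x (lieDeriv V (fun y => (D.triv y).symm (σ y)) x)
  Lt _ V s x := D.triv x (D.dlogAlong V (coefFun s) x)
  L_section U V σ hV hσ := by
    rw [isLieSection_iff] at hσ ⊢
    intro x hx
    simpa using holAt_lieDeriv (hσ x hx) (hV.contMDiffAt hx)
  L_restrict U W V V' σ σ' _ _ _ _ _ hVV' hσσ' x hx := by
    have h1 : (fun y => (D.triv y).symm (σ y)) =ᶠ[𝓝 x] fun y => (D.triv y).symm (σ' y) := by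
      filter_upwards [W.isOpen.mem_nhds hx] with y hy
      rw [hσσ' y hy]
    rw [lieDeriv_congr h1, lieDeriv, hVV' x hx]
    rfl
  L_add_left U V V' σ _ _ _ x _ := by
    rw [lieDeriv_field_add, map_add]
  L_add_right U V σ σ' _ hσ hσ' x hx := by
    rw [isLieSection_iff] at hσ hσ'
    rw [← map_add]
    congr 1
    simp only [map_add]
    exact differential_add (hσ x hx) (hσ' x hx) (V x)
  L_smul U V σ g _ _ _ x _ := by
    rw [lieDeriv_field_smul, ← smul_eq_mul, map_smul]
  L_leibniz U V σ g _ hσ hg x hx := by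
    rw [isLieSection_iff] at hσ
    have h1 : HolAt n g x := hg.contMDiffAt (U.isOpen.mem_nhds hx)
    have h2 : σ x = D.triv x ((D.triv x).symm (σ x)) := by simp
    conv_rhs => rw [h2]
    rw [← map_smul, ← map_smul, ← map_add]
    congr 1
    simp only [map_smul, smul_eq_mul]
    rw [lieDeriv_mul h1 (hσ x hx), mul_comm (lieDeriv V g x)]
  L_bracket U V V' σ hV hV' hσ x hx := by
    rw [isLieSection_iff] at hσ
    simp only [LinearEquiv.symm_apply_apply]
    rw [← map_sub]
    congr 1
    exact lieDeriv_mlieBracket (hσ x hx) (hV.contMDiffAt hx) (hV'.contMDiffAt hx)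
  Lt_section U V s hV hs := by
    rw [isLieSection_iff]
    intro x hx
    simpa using holAt_dlogAlong hV (isMerUnit_coef hs) hx
  Lt_restrict U W V V' s s' hWU hV _ hs _ hVV' hss' x hx := by
    congr 1
    refine (dlogAlong_congr hV (isMerUnit_coef hs) (hWU hx) ?_ ?_).symm
    · filter_upwards [W.isOpen.mem_nhds hx] with y hy
      exact (hVV' y hy).symm
    · filter_upwards [W.isOpen.mem_nhds hx] with y hy _
      rw [coefFun, hss' y hy]
  Lt_add U V V' s hV hV' hs x hx := by
    rw [dlogAlong_field_add hV hV' (isMerUnit_coef hs) hx, map_add]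
  Lt_mul U V s s' hV hs hs' x hx := by
    rw [← map_add, ← dlogAlong_mul hV (isMerUnit_coef hs) (isMerUnit_coef hs') hx]
    congr 2
    funext y
    simp [coefFun]
  Lt_smul U V s g hV hs hg x hx := by
    rw [dlogAlong_field_smul hV (isMerUnit_coef hs) (hg.contMDiffAt (U.isOpen.mem_nhds hx)) hx,
      ← smul_eq_mul, map_smul]
  Lt_bracket U V V' s hV hV' hs x hx := by
    simp only [LinearEquiv.symm_apply_apply]
    rw [← map_sub]
    congr 1
    exact dlogAlong_mlieBracket hV hV' (isMerUnit_coef hs) hx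
  Lt_exp U V σ s hV hσ _ he x hx := by
    rw [isLieSection_iff] at hσ
    congr 1
    rw [← dlogAlong_cexp hV hσ hx]
    refine dlogAlong_congr hV (isMerUnit_of_hol (fun y hy => ?_) fun y _ => Complex.exp_ne_zero _)
      hx (Eventually.of_forall fun _ => rfl) ?_
    · exact (Complex.contDiff_exp.contMDiff.contMDiffAt).comp y (hσ y hy)
    · filter_upwards [U.isOpen.mem_nhds hx] with y hy _
      rw [coefFun, (he y hy).eq_cst, coef_cst (Complex.exp_ne_zero _)]

theorem logModule_Lt_value (hV : D.IsLogField U V) (hf : D.IsMerUnit U f) (hx : x ∈ U) :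
    D.logModule.Lt U V (fun y => D.value y f) x = D.triv x (D.dlogAlong V f x) := by
  refine congrArg (D.triv x) (dlogAlong_congr hV hf hx (Eventually.of_forall fun _ => rfl) ?_)
  filter_upwards [U.isOpen.mem_nhds hx] with y hy hD
  rw [coefFun, value_of_notMem hf hy hD, coef_cst (hf.ne_zero y ⟨hy, hD⟩)]

end SNCDivisor

/-! ### Tangent vectors in charts -/

section TangentChart

variable {E₂ : Type*} [NormedAddCommGroup E₂] [NormedSpace ℂ E₂]
  {M₂ : Type*} [TopologicalSpace M₂] [ChartedSpace E₂ M₂]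
  {E₃ : Type*} [NormedAddCommGroup E₃] [NormedSpace ℂ E₃]
  {M₃ : Type*} [TopologicalSpace M₃] [ChartedSpace E₃ M₃]
  {e : OpenPartialHomeomorph M₂ E₂}

theorem mfderiv_symm_comp_mfderiv_chart (he : e ∈ IsManifold.maximalAtlas 𝓘(ℂ, E₂) ω M₂)
    {z : M₂} (hz : z ∈ e.source) (ξ : TangentSpace 𝓘(ℂ, E₂) z) :
    (mfderiv 𝓘(ℂ, E₂) 𝓘(ℂ, E₂) e.symm (e z) (mfderiv 𝓘(ℂ, E₂) 𝓘(ℂ, E₂) e z ξ) : E₂) = ξ := by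
  have h1 := (contMDiffAt_of_mem_maximalAtlas he hz).mdifferentiableAt (by simp)
  have h2 := (contMDiffAt_symm_of_mem_maximalAtlas he (e.map_source hz)).mdifferentiableAt (by simp)
  have h3 := (h2.hasMFDerivAt.comp z h1.hasMFDerivAt).congr_of_eventuallyEq (f₁ := id) (by
    filter_upwards [e.open_source.mem_nhds hz] with w hw
    exact (e.left_inv hw).symm)
  exact DFunLike.congr_fun (hasMFDerivAt_unique h3 (hasMFDerivAt_id (I := 𝓘(ℂ, E₂)) z)) ξ

theorem mfderiv_chart_injective (he : e ∈ IsManifold.maximalAtlas 𝓘(ℂ, E₂) ω M₂)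
    {z : M₂} (hz : z ∈ e.source) : Function.Injective (mfderiv 𝓘(ℂ, E₂) 𝓘(ℂ, E₂) e z) := by
  intro ξ η h
  have h1 := mfderiv_symm_comp_mfderiv_chart he hz ξ
  rw [h] at h1
  exact h1.symm.trans (mfderiv_symm_comp_mfderiv_chart he hz η)

theorem exists_mfderiv_chart_eq [FiniteDimensional ℂ E₂]
    (he : e ∈ IsManifold.maximalAtlas 𝓘(ℂ, E₂) ω M₂)
    {z : M₂} (hz : z ∈ e.source) (w : E₂) :
    ∃ ξ : TangentSpace 𝓘(ℂ, E₂) z, (mfderiv 𝓘(ℂ, E₂) 𝓘(ℂ, E₂) e z ξ : E₂) = w := by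
  let L : E₂ →L[ℂ] E₂ := mfderiv 𝓘(ℂ, E₂) 𝓘(ℂ, E₂) e z
  exact LinearMap.surjective_of_injective (f := (L : E₂ →ₗ[ℂ] E₂)) (mfderiv_chart_injective he hz) w

/-- Holomorphy of a vector field along a map can be checked in a chart. -/
theorem contMDiffAt_section_of_chart [IsManifold 𝓘(ℂ, E₂) ω M₂]
    (he : e ∈ IsManifold.maximalAtlas 𝓘(ℂ, E₂) ω M₂)
    {b : M₃ → M₂} {v : ∀ y, TangentSpace 𝓘(ℂ, E₂) (b y)} {y : M₃} (hy : b y ∈ e.source)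
    (hb : ContMDiffAt 𝓘(ℂ, E₃) 𝓘(ℂ, E₂) ω b y)
    (hv : ContMDiffAt 𝓘(ℂ, E₃) 𝓘(ℂ, E₂) ω
      (fun y => (mfderiv 𝓘(ℂ, E₂) 𝓘(ℂ, E₂) e (b y) (v y) : E₂)) y) :
    ContMDiffAt 𝓘(ℂ, E₃) 𝓘(ℂ, E₂).tangent ω
      (fun y => (⟨b y, v y⟩ : TangentBundle 𝓘(ℂ, E₂) M₂)) y := by
  have h1 := contMDiffAt_modelSpace_section
    ((contMDiffAt_of_mem_maximalAtlas he hy).comp y hb) hv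
  have h2 := contMDiffAt_mfderiv_section (b := fun y => e (b y)) (y := y)
    (contMDiffAt_symm_of_mem_maximalAtlas he (e.map_source hy)) h1
  refine h2.congr_of_eventuallyEq ?_
  filter_upwards [hb.continuousAt.eventually (e.open_source.mem_nhds hy)] with z hz
  have h3 : ∀ (w : M₂) (_ : b z = w) (η : TangentSpace 𝓘(ℂ, E₂) w) (_ : (v z : E₂) = η),
      (⟨b z, v z⟩ : TangentBundle 𝓘(ℂ, E₂) M₂) = ⟨w, η⟩ := by
    rintro w rfl η rfl
    rfl
  exact h3 _ (e.left_inv hz).symm _ (mfderiv_symm_comp_mfderiv_chart he hz (v z)).symm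

/-- The differential of a composition of maps, at a vector. -/
theorem mfderiv_comp_apply' {E₄ M₄ : Type*} [NormedAddCommGroup E₄] [NormedSpace ℂ E₄]
    [TopologicalSpace M₄] [ChartedSpace E₄ M₄] {f : M₂ → M₄} {b : M₃ → M₂} {y : M₃}
    (hf : ContMDiffAt 𝓘(ℂ, E₂) 𝓘(ℂ, E₄) ω f (b y)) (hb : ContMDiffAt 𝓘(ℂ, E₃) 𝓘(ℂ, E₂) ω b y)
    (ξ : TangentSpace 𝓘(ℂ, E₃) y) :
    (mfderiv 𝓘(ℂ, E₃) 𝓘(ℂ, E₄) (fun z => f (b z)) y ξ : E₄) =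
      mfderiv 𝓘(ℂ, E₂) 𝓘(ℂ, E₄) f (b y) (mfderiv 𝓘(ℂ, E₃) 𝓘(ℂ, E₂) b y ξ) :=
  DFunLike.congr_fun ((hf.mdifferentiableAt (by simp)).hasMFDerivAt.comp y
    (hb.mdifferentiableAt (by simp)).hasMFDerivAt).mfderiv ξ

/-- Linear maps commute with differentials. -/
theorem clm_mfderiv_apply {E₄ : Type*} [NormedAddCommGroup E₄] [NormedSpace ℂ E₄] (π : E₂ →L[ℂ] E₄)
    {b : M₃ → E₂} {y : M₃} (hb : ContMDiffAt 𝓘(ℂ, E₃) 𝓘(ℂ, E₂) ω b y)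
    (ξ : TangentSpace 𝓘(ℂ, E₃) y) :
    π (mfderiv 𝓘(ℂ, E₃) 𝓘(ℂ, E₂) b y ξ) =
      (mfderiv 𝓘(ℂ, E₃) 𝓘(ℂ, E₄) (fun z => π (b z)) y ξ : E₄) := by
  have h := (π.hasFDerivAt (x := b y)).hasMFDerivAt.comp y
    (hb.mdifferentiableAt (by simp)).hasMFDerivAt
  exact (DFunLike.congr_fun h.mfderiv ξ).symm

end TangentChart

namespace SNCDivisor

variable {n : ℕ} {X : Type u} [TopologicalSpace X] [ChartedSpace (Fin n → ℂ) X]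
  {D : SNCDivisor.{u, v} n X}

/-! ### The Lie algebroid of `Pair(X, D)` -/

variable {p y : X}

theorem mfderiv_loc_idx (hy : y ∈ D.dom p) (i : D.Through p)
    (v : TangentSpace 𝓘(ℂ, Fin n → ℂ) y) :
    (mfderiv 𝓘(ℂ, Fin n → ℂ) 𝓘(ℂ, Fin n → ℂ) (D.loc p) y v : Fin n → ℂ) (D.idx p i) =
      differential (D.zeta p i) y v := by
  have h := clm_mfderiv_apply (ContinuousLinearMap.proj (R := ℂ) (φ := fun _ : Fin n => ℂ)
    (D.idx p i)) (contMDiffAt_loc hy) v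
  have h1 : D.zeta p i = fun z => D.loc p z (D.idx p i) := funext fun z => D.zeta_of_mem i.2 z
  rw [h1]
  exact h

section ArrowTangent

variable {r : D.Joined} {g : Arr D.pair}

/-! The components of a tangent vector of the space of arrows in a chart. -/

theorem mfderiv_arrHomeo_fst (hg : g ∈ (arrHomeo r).source)
    (ξ : TangentSpace 𝓘(ℂ, (Fin n → ℂ) × (Fin n → ℂ)) g) :
    (mfderiv 𝓘(ℂ, (Fin n → ℂ) × (Fin n → ℂ)) 𝓘(ℂ, (Fin n → ℂ) × (Fin n → ℂ)) (arrHomeo r) g ξ :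
      (Fin n → ℂ) × (Fin n → ℂ)).1 =
      mfderiv 𝓘(ℂ, Fin n → ℂ) 𝓘(ℂ, Fin n → ℂ) (D.loc r.1.1) g.1
        (mfderiv 𝓘(ℂ, (Fin n → ℂ) × (Fin n → ℂ)) 𝓘(ℂ, Fin n → ℂ) (fun g : Arr D.pair => g.1) g ξ) :=
  (clm_mfderiv_apply (ContinuousLinearMap.fst ℂ (Fin n → ℂ) (Fin n → ℂ))
    (contMDiffAt_of_mem_maximalAtlas (arrHomeo_mem_maximalAtlas r) hg) ξ).trans
    (mfderiv_comp_apply' (contMDiffAt_loc (mem_arrChart_source.1 hg).1) (contMDiff_source D g) ξ)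

theorem mfderiv_arrHomeo_snd_idx (hg : g ∈ (arrHomeo r).source)
    (ξ : TangentSpace 𝓘(ℂ, (Fin n → ℂ) × (Fin n → ℂ)) g) (i : D.Through r.1.2) :
    (mfderiv 𝓘(ℂ, (Fin n → ℂ) × (Fin n → ℂ)) 𝓘(ℂ, (Fin n → ℂ) × (Fin n → ℂ)) (arrHomeo r) g ξ :
      (Fin n → ℂ) × (Fin n → ℂ)).2 (D.idx r.1.2 i) =
      mfderiv 𝓘(ℂ, (Fin n → ℂ) × (Fin n → ℂ)) 𝓘(ℂ, ℂ) (scl r.1.1 r.1.2 i) g ξ := by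
  have h := clm_mfderiv_apply ((ContinuousLinearMap.proj (R := ℂ) (φ := fun _ : Fin n => ℂ)
    (D.idx r.1.2 i)).comp (ContinuousLinearMap.snd ℂ (Fin n → ℂ) (Fin n → ℂ)))
    (contMDiffAt_of_mem_maximalAtlas (arrHomeo_mem_maximalAtlas r) hg) ξ
  have h1 : (fun g => ((ContinuousLinearMap.proj (R := ℂ) (φ := fun _ : Fin n => ℂ)
      (D.idx r.1.2 i)).comp (ContinuousLinearMap.snd ℂ (Fin n → ℂ) (Fin n → ℂ))) (arrHomeo r g)) =
      scl r.1.1 r.1.2 i := funext fun g => (D.idx_injective r.1.2).extend_apply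
        (fun i : D.Through r.1.2 => scl r.1.1 r.1.2 i g) (D.loc r.1.2 g.2.1) i
  rw [h1] at h
  exact h

theorem mfderiv_arrHomeo_snd_of_notMem (hg : g ∈ (arrHomeo r).source)
    (ξ : TangentSpace 𝓘(ℂ, (Fin n → ℂ) × (Fin n → ℂ)) g) {j : Fin n}
    (hj : ¬ ∃ i, D.idx r.1.2 i = j) :
    (mfderiv 𝓘(ℂ, (Fin n → ℂ) × (Fin n → ℂ)) 𝓘(ℂ, (Fin n → ℂ) × (Fin n → ℂ)) (arrHomeo r) g ξ :
      (Fin n → ℂ) × (Fin n → ℂ)).2 j =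
      (mfderiv 𝓘(ℂ, Fin n → ℂ) 𝓘(ℂ, Fin n → ℂ) (D.loc r.1.2) g.2.1
        (mfderiv 𝓘(ℂ, (Fin n → ℂ) × (Fin n → ℂ)) 𝓘(ℂ, Fin n → ℂ)
          (fun g : Arr D.pair => g.2.1) g ξ) : Fin n → ℂ) j := by
  have h := clm_mfderiv_apply ((ContinuousLinearMap.proj (R := ℂ) (φ := fun _ : Fin n => ℂ)
    j).comp (ContinuousLinearMap.snd ℂ (Fin n → ℂ) (Fin n → ℂ)))
    (contMDiffAt_of_mem_maximalAtlas (arrHomeo_mem_maximalAtlas r) hg) ξ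
  have h1 : (fun g => ((ContinuousLinearMap.proj (R := ℂ) (φ := fun _ : Fin n => ℂ)
      j).comp (ContinuousLinearMap.snd ℂ (Fin n → ℂ) (Fin n → ℂ))) (arrHomeo r g)) =
      fun g => ContinuousLinearMap.proj (R := ℂ) (φ := fun _ : Fin n => ℂ) j (D.loc r.1.2 g.2.1) :=
    funext fun g => Function.extend_apply' (fun i : D.Through r.1.2 => scl r.1.1 r.1.2 i g)
      (D.loc r.1.2 g.2.1) j hj
  rw [h1] at h
  have h2 : ContMDiffAt 𝓘(ℂ, (Fin n → ℂ) × (Fin n → ℂ)) 𝓘(ℂ, Fin n → ℂ) ω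
      (fun g : Arr D.pair => D.loc r.1.2 g.2.1) g :=
    (contMDiffAt_loc (mem_arrChart_source.1 hg).2).comp g (contMDiff_target D g)
  have h3 := clm_mfderiv_apply (ContinuousLinearMap.proj (R := ℂ) (φ := fun _ : Fin n => ℂ) j) h2 ξ
  refine h.trans (h3.symm.trans ?_)
  exact congrFun (mfderiv_comp_apply' (b := fun g : Arr D.pair => g.2.1)
    (contMDiffAt_loc (mem_arrChart_source.1 hg).2) (contMDiff_target D g) ξ) j

end ArrowTangent

/-- The derivative of a function on the arrows along a tangent vector at an identity arrow. -/
def dArr (F : Arr D.pair → ℂ) (y : X)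
    (ξ : TangentSpace 𝓘(ℂ, (Fin n → ℂ) × (Fin n → ℂ)) (idArr D.pair y)) : ℂ :=
  mfderiv 𝓘(ℂ, (Fin n → ℂ) × (Fin n → ℂ)) 𝓘(ℂ, ℂ) F (idArr D.pair y) ξ

/-- If `F` is the quotient of the values of `k` at target and source, then its derivative is the
logarithmic derivative of `k` along the anchor. -/
theorem differential_anchor_of_eq_mul {k : X → ℂ} {F : Arr D.pair → ℂ} (hk : HolAt n k y)
    (hF : ContMDiffAt 𝓘(ℂ, (Fin n → ℂ) × (Fin n → ℂ)) 𝓘(ℂ, ℂ) ω F (idArr D.pair y))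
    (h : ∀ᶠ g : Arr D.pair in 𝓝 (idArr D.pair y), k g.2.1 = F g * k g.1)
    (ξ : AlgebroidFibre (E := Fin n → ℂ) (EG := (Fin n → ℂ) × (Fin n → ℂ)) D.pair y) :
    differential k y (anchor D.pair y ξ) = k y * dArr F y ξ.1 := by
  have ht := HasMFDerivAt.comp (idArr D.pair y) (hk.mdifferentiableAt.hasMFDerivAt)
    ((contMDiff_target D (idArr D.pair y)).mdifferentiableAt (by simp)).hasMFDerivAt
  have hs := HasMFDerivAt.comp (idArr D.pair y) (hk.mdifferentiableAt.hasMFDerivAt)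
    ((contMDiff_source D (idArr D.pair y)).mdifferentiableAt (by simp)).hasMFDerivAt
  have hm := ((hF.mdifferentiableAt (by simp)).hasMFDerivAt.mul hs).congr_of_eventuallyEq
    (f₁ := k ∘ fun g : Arr D.pair => g.2.1) h
  have h1 := DFunLike.congr_fun (hasMFDerivAt_unique ht hm) ξ.1
  have h2 : mfderiv 𝓘(ℂ, (Fin n → ℂ) × (Fin n → ℂ)) 𝓘(ℂ, Fin n → ℂ) (fun g : Arr D.pair => g.1)
    (idArr D.pair y) ξ.1 = 0 := LinearMap.mem_ker.1 ξ.2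
  have h3 : differential k y (mfderiv 𝓘(ℂ, (Fin n → ℂ) × (Fin n → ℂ))
      𝓘(ℂ, Fin n → ℂ) (fun g : Arr D.pair => g.1) (idArr D.pair y) ξ.1) = 0 := by
    rw [h2]
    exact map_zero (mfderiv 𝓘(ℂ, Fin n → ℂ) 𝓘(ℂ, ℂ) k y)
  have h4 : differential k y (anchor D.pair y ξ) =
      F (idArr D.pair y) * differential k y
        (mfderiv 𝓘(ℂ, (Fin n → ℂ) × (Fin n → ℂ))
          𝓘(ℂ, Fin n → ℂ) (fun g : Arr D.pair => g.1) (idArr D.pair y) ξ.1) +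
      k y * dArr F y ξ.1 := h1
  rw [h4, h3, mul_zero, zero_add]

/-- In particular the anchor is tangent to the components of `D`. -/
theorem differential_zeta_anchor (hy : y ∈ D.dom p) (i : D.ι)
    (ξ : AlgebroidFibre (E := Fin n → ℂ) (EG := (Fin n → ℂ) × (Fin n → ℂ)) D.pair y) :
    differential (D.zeta p i) y (anchor D.pair y ξ) = D.zeta p i y * dArr (scl p p i) y ξ.1 := by
  refine differential_anchor_of_eq_mul (D.holAt_zeta hy i)
    (contMDiffAt_scl (g := idArr D.pair y) hy hy i) ?_ ξ
  filter_upwards [eventually_source_mem (g := idArr D.pair y) hy,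
    eventually_target_mem (g := idArr D.pair y) hy] with g h1 h2
  exact zeta_target h1 h2 i

/-- A vector of the Lie algebroid is determined by its anchor and the derivatives of the scales. -/
theorem algebroidFibre_ext (hy : y ∈ D.dom p)
    {ξ η : AlgebroidFibre (E := Fin n → ℂ) (EG := (Fin n → ℂ) × (Fin n → ℂ)) D.pair y}
    (h : anchor D.pair y ξ = anchor D.pair y η)
    (h' : ∀ i : D.Through p, dArr (scl p p i) y ξ.1 = dArr (scl p p i) y η.1) : ξ = η := by
  have hg : idArr D.pair y ∈ (arrHomeo (⟨(p, p), fun _ => Iff.rfl⟩ : D.Joined)).source := ⟨hy, hy⟩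
  refine Subtype.ext (mfderiv_chart_injective (arrHomeo_mem_maximalAtlas _) hg ?_)
  refine Prod.ext ?_ (funext fun j => ?_)
  · rw [mfderiv_arrHomeo_fst hg, mfderiv_arrHomeo_fst hg]
    exact congrArg (mfderiv 𝓘(ℂ, Fin n → ℂ) 𝓘(ℂ, Fin n → ℂ) (D.loc p) y)
      ((LinearMap.mem_ker.1 ξ.2).trans (LinearMap.mem_ker.1 η.2).symm)
  · by_cases hj : ∃ i, D.idx p i = j
    · obtain ⟨i, rfl⟩ := hj
      rw [mfderiv_arrHomeo_snd_idx hg, mfderiv_arrHomeo_snd_idx hg]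
      exact h' i
    · rw [mfderiv_arrHomeo_snd_of_notMem hg _ hj, mfderiv_arrHomeo_snd_of_notMem hg _ hj]
      exact congrFun (congrArg (mfderiv 𝓘(ℂ, Fin n → ℂ) 𝓘(ℂ, Fin n → ℂ) (D.loc p) y) h) j

end SNCDivisor

namespace SNCDivisor

variable {n : ℕ} {X : Type u} [TopologicalSpace X] [ChartedSpace (Fin n → ℂ) X]
  {D : SNCDivisor.{u, v} n X}

/-! ### The anchor of `Pair(X, D)` -/

variable {x : X} {U : Opens X}
  {ξ η : ∀ x, AlgebroidFibre (E := Fin n → ℂ) (EG := (Fin n → ℂ) × (Fin n → ℂ)) D.pair x}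

variable (D) in
/-- Holomorphy at a point of a section of the Lie algebroid of `Pair(X, D)`. -/
abbrev AlgebroidSectionAt
    (ξ : ∀ x, AlgebroidFibre (E := Fin n → ℂ) (EG := (Fin n → ℂ) × (Fin n → ℂ)) D.pair x)
    (x : X) : Prop :=
  ContMDiffAt 𝓘(ℂ, Fin n → ℂ) 𝓘(ℂ, (Fin n → ℂ) × (Fin n → ℂ)).tangent ω
    (fun x => (⟨idArr D.pair x,
      (ξ x : TangentSpace 𝓘(ℂ, (Fin n → ℂ) × (Fin n → ℂ)) (idArr D.pair x))⟩ :
      TangentBundle 𝓘(ℂ, (Fin n → ℂ) × (Fin n → ℂ)) (Arr D.pair))) x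

theorem holAt_dArr {F : Arr D.pair → ℂ} (h : D.AlgebroidSectionAt ξ x)
    (hF : ContMDiffAt 𝓘(ℂ, (Fin n → ℂ) × (Fin n → ℂ)) 𝓘(ℂ, ℂ) ω F (idArr D.pair x)) :
    HolAt n (fun y => dArr F y (ξ y).1) x :=
  contMDiffAt_mfderiv_apply hF h

/-- Two sections with the same anchor are equal: off `D` the anchor is injective. -/
theorem eq_of_anchor_eq (hξ : D.AlgebroidSectionAt ξ x) (hη : D.AlgebroidSectionAt η x)
    (h : ∀ᶠ y in 𝓝 x, anchor D.pair y (ξ y) = anchor D.pair y (η y)) : ξ x = η x := by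
  have hx := D.mem_dom_self x
  refine algebroidFibre_ext hx h.self_of_nhds fun i => ?_
  have hs := contMDiffAt_scl (g := idArr D.pair x) hx hx i
  refine eq_of_eventually_off (D := D) (holAt_dArr hξ hs).continuousAt
    (holAt_dArr hη hs).continuousAt ?_
  filter_upwards [h, (D.dom x).isOpen.mem_nhds hx] with y hy hyd hD
  have h1 := differential_zeta_anchor hyd i (ξ y)
  rw [hy, differential_zeta_anchor hyd i (η y)] at h1
  exact (mul_left_cancel₀ (fun h0 => D.notMem_support.1 hD i ((D.zeta_eq_zero_iff hyd i).1 h0))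
    h1).symm

variable [IsManifold 𝓘(ℂ, Fin n → ℂ) ω X]

theorem contMDiffAt_anchor (h : D.AlgebroidSectionAt ξ x) :
    ContMDiffAt 𝓘(ℂ, Fin n → ℂ) 𝓘(ℂ, Fin n → ℂ).tangent ω
      (fun x => (⟨x, anchor D.pair x (ξ x)⟩ : TangentBundle 𝓘(ℂ, Fin n → ℂ) X)) x :=
  contMDiffAt_mfderiv_section (f := fun g : Arr D.pair => g.2.1) (contMDiff_target D _) h

/-- Logarithmic fields lift locally: the scale along a component of `D` has to grow with the
logarithmic derivative of the coordinate that defines it. -/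
theorem exists_algebroidSection {V : ∀ x : X, TangentSpace 𝓘(ℂ, Fin n → ℂ) x}
    (hV : D.IsLogField U V) {p : X} (hp : p ∈ U) :
    ∃ ξ : ∀ x, AlgebroidFibre (E := Fin n → ℂ) (EG := (Fin n → ℂ) × (Fin n → ℂ)) D.pair x,
      ∀ᶠ y in 𝓝 p, D.AlgebroidSectionAt ξ y ∧ anchor D.pair y (ξ y) = V y := by
  classical
  set r : D.Joined := ⟨(p, p), fun _ => Iff.rfl⟩
  have hpd := D.mem_dom_self p
  choose q hq hqz using fun i : D.Through p => hV.exists_lieDeriv_zeta hp i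
  -- the lift has chart components `0` for the source, the logarithmic derivatives `q i` for the
  -- scales, and the components of `V` for the other coordinates of the target
  set w : X → Fin n → ℂ := fun y => Function.extend (D.idx p) (fun i => q i y)
    (mfderiv 𝓘(ℂ, Fin n → ℂ) 𝓘(ℂ, Fin n → ℂ) (D.loc p) y (V y) : Fin n → ℂ)
  have hsrc : ∀ y, y ∈ D.dom p → idArr D.pair y ∈ (arrHomeo r).source := fun y hy => ⟨hy, hy⟩
  have hloc : ∀ y, y ∈ D.dom p → ∀ v v' : TangentSpace 𝓘(ℂ, Fin n → ℂ) y,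
      (mfderiv 𝓘(ℂ, Fin n → ℂ) 𝓘(ℂ, Fin n → ℂ) (D.loc p) y v : Fin n → ℂ) =
        mfderiv 𝓘(ℂ, Fin n → ℂ) 𝓘(ℂ, Fin n → ℂ) (D.loc p) y v' → v = v' := fun y hy v v' h =>
    mfderiv_chart_injective (D.loc_mem_maximalAtlas p) hy h
  have hex : ∀ y, y ∈ D.dom p →
      ∃ ξ : AlgebroidFibre (E := Fin n → ℂ) (EG := (Fin n → ℂ) × (Fin n → ℂ)) D.pair y,
      (mfderiv 𝓘(ℂ, (Fin n → ℂ) × (Fin n → ℂ)) 𝓘(ℂ, (Fin n → ℂ) × (Fin n → ℂ)) (arrHomeo r)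
        (idArr D.pair y) ξ.1 : (Fin n → ℂ) × (Fin n → ℂ)) = (0, w y) := by
    intro y hy
    obtain ⟨ξ, hξ⟩ := exists_mfderiv_chart_eq (arrHomeo_mem_maximalAtlas r) (hsrc y hy) (0, w y)
    refine ⟨⟨ξ, LinearMap.mem_ker.2 (hloc y hy _ _ ?_)⟩, hξ⟩
    refine (mfderiv_arrHomeo_fst (hsrc y hy) ξ).symm.trans ((congrArg Prod.fst hξ).trans ?_)
    exact (map_zero (mfderiv 𝓘(ℂ, Fin n → ℂ) 𝓘(ℂ, Fin n → ℂ) (D.loc p) y)).symm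
  choose ξ₀ hξ₀ using hex
  set ξ : ∀ x, AlgebroidFibre (E := Fin n → ℂ) (EG := (Fin n → ℂ) × (Fin n → ℂ)) D.pair x :=
    fun y => if hy : y ∈ D.dom p then ξ₀ y hy else 0
  have hξ : ∀ y, y ∈ D.dom p →
      (mfderiv 𝓘(ℂ, (Fin n → ℂ) × (Fin n → ℂ)) 𝓘(ℂ, (Fin n → ℂ) × (Fin n → ℂ)) (arrHomeo r)
        (idArr D.pair y) (ξ y).1 : (Fin n → ℂ) × (Fin n → ℂ)) = (0, w y) := by
    intro y hy
    simp only [ξ, hy, dif_pos]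
    exact hξ₀ y hy
  refine ⟨ξ, ?_⟩
  have hall : ∀ᶠ y in 𝓝 p, ∀ i : D.Through p,
      HolAt n (q i) y ∧ lieDeriv V (D.zeta p i) y = q i y * D.zeta p i y :=
    eventually_all.2 fun i => (D.eventually_holAt (hq i)).and (hqz i)
  filter_upwards [hall, (D.dom p).isOpen.mem_nhds hpd, U.isOpen.mem_nhds hp] with y hy hyd hyU
  refine ⟨contMDiffAt_section_of_chart (arrHomeo_mem_maximalAtlas r) (hsrc y hyd)
    contMDiff_idArr.contMDiffAt ?_, hloc y hyd _ _ (funext fun j => ?_)⟩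
  · have h1 : ContMDiffAt 𝓘(ℂ, Fin n → ℂ) 𝓘(ℂ, (Fin n → ℂ) × (Fin n → ℂ)) ω
        (fun z => ((0, w z) : (Fin n → ℂ) × (Fin n → ℂ))) y := by
      refine ContMDiffAt.prodMk_space contMDiffAt_const (contMDiffAt_pi_space.2 fun j => ?_)
      by_cases hj : ∃ i, D.idx p i = j
      · obtain ⟨i, rfl⟩ := hj
        refine (hy i).1.congr_of_eventuallyEq (Eventually.of_forall fun z => ?_)
        exact (D.idx_injective p).extend_apply (fun i => q i z) _ i
      · have h2 := contMDiffAt_pi_space.1 (contMDiffAt_mfderiv_apply (b := id) (contMDiffAt_loc hyd)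
          (hV.contMDiffAt hyU)) j
        refine h2.congr_of_eventuallyEq (Eventually.of_forall fun z => ?_)
        exact Function.extend_apply' _ _ _ hj
    refine h1.congr_of_eventuallyEq ?_
    filter_upwards [(D.dom p).isOpen.mem_nhds hyd] with z hz
    exact hξ z hz
  · have h3 := congrFun (congrArg Prod.snd (hξ y hyd)) j
    by_cases hj : ∃ i, D.idx p i = j
    · obtain ⟨i, rfl⟩ := hj
      rw [mfderiv_loc_idx hyd i, mfderiv_loc_idx hyd i, differential_zeta_anchor hyd]
      have h4 : dArr (scl p p i) y (ξ y).1 = q i y :=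
        (mfderiv_arrHomeo_snd_idx (hsrc y hyd) (ξ y).1 i).symm.trans
          (h3.trans ((D.idx_injective p).extend_apply (fun i => q i y) _ i))
      rw [h4, mul_comm]
      exact (hy i).2.symm
    · exact (mfderiv_arrHomeo_snd_of_notMem (hsrc y hyd) (ξ y).1 hj).symm.trans
        (h3.trans (Function.extend_apply' (fun i => q i y)
          (mfderiv 𝓘(ℂ, Fin n → ℂ) 𝓘(ℂ, Fin n → ℂ) (D.loc p) y (V y) : Fin n → ℂ) j hj))

variable (D) in
/-- The sheaf of sections of the Lie algebroid is the sheaf of logarithmic vector fields. -/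
theorem integratesLogTangent :
    D.IntegratesLogTangent (EG := (Fin n → ℂ) × (Fin n → ℂ)) where
  anchor_mem U ξ hξ := by
    have hξ' : ∀ x ∈ U, D.AlgebroidSectionAt ξ x := fun x hx =>
      hξ.contMDiffAt (U.isOpen.mem_nhds hx)
    refine ⟨fun x hx => (contMDiffAt_anchor (hξ' x hx)).contMDiffWithinAt, fun x hx i hi => ?_⟩
    have hxd := D.mem_dom_self x
    rw [(D.isDefiningFunction_zeta x i).mem_tangentTo_iff hxd hi, differential_zeta_anchor hxd,
      (D.zeta_eq_zero_iff hxd i).2 hi, zero_mul]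
  anchor_injective U ξ η hξ hη h x hx :=
    eq_of_anchor_eq (hξ.contMDiffAt (U.isOpen.mem_nhds hx))
      (hη.contMDiffAt (U.isOpen.mem_nhds hx)) (by
        filter_upwards [U.isOpen.mem_nhds hx] with y hy
        exact h y hy)
  anchor_surjective U V hV := by
    classical
    -- the local lifts agree where they meet, so their values at the base points form a section
    choose Ξ hΞ using fun p : U => exists_algebroidSection hV p.2
    set ξ : ∀ x, AlgebroidFibre (E := Fin n → ℂ) (EG := (Fin n → ℂ) × (Fin n → ℂ)) D.pair x :=
      fun x => if hx : x ∈ U then Ξ ⟨x, hx⟩ x else 0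
    have hloc : ∀ p : U, ∀ᶠ y in 𝓝 (p : X), ξ y = Ξ p y := by
      intro p
      filter_upwards [(hΞ p).eventually_nhds, U.isOpen.mem_nhds p.2] with y hy hyU
      have h1 : ξ y = Ξ ⟨y, hyU⟩ y := dif_pos hyU
      have h2 := hΞ ⟨y, hyU⟩
      rw [h1]
      refine eq_of_anchor_eq h2.self_of_nhds.1 hy.self_of_nhds.1 ?_
      filter_upwards [h2, hy] with z hz hz'
      rw [hz.2, hz'.2]
    refine ⟨ξ, fun x hx => ContMDiffAt.contMDiffWithinAt ?_, fun x hx => ?_⟩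
    · refine (hΞ ⟨x, hx⟩).self_of_nhds.1.congr_of_eventuallyEq ?_
      filter_upwards [hloc ⟨x, hx⟩] with y hy
      rw [hy]
    · rw [(hloc ⟨x, hx⟩).self_of_nhds]
      exact (hΞ ⟨x, hx⟩).self_of_nhds.2

end SNCDivisor

namespace SNCDivisor

variable {n : ℕ} {X : Type u} [TopologicalSpace X] [ChartedSpace (Fin n → ℂ) X]
  {D : SNCDivisor.{u, v} n X}

/-! ### The action of `Pair(X, D)` -/

variable {x y z p q : X}

/-- Arrows join points on the same components of `D`. -/
def throughEquiv (h : ∀ i, x ∈ D.comp i ↔ y ∈ D.comp i) : D.Through x ≃ D.Through y :=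
  Equiv.subtypeEquivRight h

theorem throughEquiv_symm_apply (h : ∀ i, x ∈ D.comp i ↔ y ∈ D.comp i) (j : D.Through y) :
    (throughEquiv h).symm j = ⟨j.1, (h j).2 j.2⟩ :=
  rfl

/-- The scales of an arrow, with respect to the coordinates at its ends. -/
def sclUnit (g : D.PairHom x y) (i : D.ι) : ℂˣ :=
  Units.mk0 (scl x y i ⟨x, y, g⟩) (scl_ne_zero (D.mem_dom_self x) (D.mem_dom_self y) i)

theorem sclUnit_id (x : X) (i : D.ι) : sclUnit (D.pair.id x) i = 1 :=
  Units.ext (scl_id (D.mem_dom_self x) i)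

theorem sclUnit_comp (f : D.PairHom x y) (g : D.PairHom y z) (i : D.ι) :
    sclUnit (D.pair.comp f g) i = sclUnit g i * sclUnit f i :=
  Units.ext (scl_comp (D.mem_dom_self x) (D.mem_dom_self y) (D.mem_dom_self z) i f g)

/-- The action of an arrow: each coordinate that defines `D` goes to the corresponding coordinate at
the target divided by the scale, and constants are fixed. -/
def act (x y : X) (g : D.PairHom x y) : D.Fib x →* D.Fib y :=
  MonoidHom.mk' (fun v => D.fib y (coef v * ∏ i : D.Through x, sclUnit g i ^ (-ord v i))
    (fun j => ord v ((throughEquiv g.mem_iff).symm j))) fun v w => by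
    refine fib_ext ?_ ?_
    · simp only [coef_fib, coef_mul, ord_mul, Pi.add_apply, neg_add, zpow_add,
        Finset.prod_mul_distrib]
      rw [mul_mul_mul_comm]
    · funext j
      simp

theorem coef_act (g : D.PairHom x y) (v : D.Fib x) :
    coef (act x y g v) = coef v * ∏ i : D.Through x, sclUnit g i ^ (-ord v i) :=
  coef_fib _ _

theorem ord_act (g : D.PairHom x y) (v : D.Fib x) (j : D.Through y) :
    ord (act x y g v) j = ord v ((throughEquiv g.mem_iff).symm j) :=
  congrFun (ord_fib _ _) j

theorem act_id (v : D.Fib x) : act x x (D.pair.id x) v = v := by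
  refine fib_ext ?_ (funext fun j => ord_act _ _ j)
  rw [coef_act]
  simp [sclUnit_id]

theorem act_comp (f : D.PairHom x y) (g : D.PairHom y z) (v : D.Fib x) :
    act x z (D.pair.comp f g) v = act y z g (act x y f v) := by
  refine fib_ext ?_ (funext fun j => ?_)
  · simp only [coef_act, sclUnit_comp, mul_zpow, Finset.prod_mul_distrib]
    rw [mul_assoc, mul_comm (∏ i : D.Through x, sclUnit g i ^ (-ord v i))]
    congr 2
    refine Fintype.prod_equiv (throughEquiv f.mem_iff) _ _ fun i => ?_
    rw [ord_act, Equiv.symm_apply_apply]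
    rfl
  · simp only [ord_act]
    rfl

theorem act_cst (g : D.PairHom x y) (c : ℂ) : act x y g (D.cst x c) = D.cst y c := by
  refine fib_ext ?_ (funext fun j => by rw [ord_act]; simp)
  rw [coef_act]
  simp [cst]

theorem mono_single [DecidableEq (D.Through x)] (i : D.Through x) (y : X) :
    D.mono x (Pi.single i 1) y = D.zeta x i y := by
  rw [mono, Finset.prod_eq_single i]
  · simp
  · intro j _ hj
    simp [hj]
  · simp

/-- The value of a function at a point of `D i`, from its quotient by the coordinate of `D i`. -/
theorem value_eq_of_eq_mul_zeta [DecidableEq (D.Through x)] {h u : X → ℂ} {i : D.Through x}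
    (hu : ContinuousAt u x) (hu0 : u x ≠ 0) (hh : ∀ᶠ y in 𝓝 x, h y = u y * D.zeta x i y) :
    D.value x h = D.fib x (Units.mk0 (u x) hu0) (Pi.single i 1) := by
  have h1 := (((D.isMerUnit_mono x (Pi.single i 1)).isValue (D.mem_dom_self x)).mul_cst (g := h) hu
    hu0 (eventually_off (hh.mono fun y hy _ => by rw [hy, mono_single, mul_comm]))).value_eq
  rw [h1, value_mono_self]
  exact fib_ext (Units.ext (by simp [coef_cst hu0])) (by simp)

/-- Defining functions are units times the coordinates that define `D`, and the values of the units
at source and target cancel against the change of the scale. -/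
theorem act_value_of_isDefiningFunction {i : D.ι} {U W : Opens X} {h k : X → ℂ}
    (hh : D.IsDefiningFunction i U h) (hk : D.IsDefiningFunction i W k) {g : D.PairHom x y} {a : ℂ}
    (hx : x ∈ U) (hy : y ∈ W) (hs : D.IsScale i h k g a) :
    act x y g (D.value x h) = D.value y (fun z => a⁻¹ * k z) := by
  classical
  have ha := hs.ne_zero hh hk hx hy
  by_cases hi : x ∈ D.comp i
  · have hi' := (g.mem_iff i).1 hi
    obtain ⟨q, hq, hq0, hhq⟩ := hh.exists_eq_mul_zeta hx
    obtain ⟨r, hr, hr0, hkr⟩ := hk.exists_eq_mul_zeta hy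
    have hx' := D.mem_dom_self x
    have hy' := D.mem_dom_self y
    have h1 : a = scl x y i ⟨x, y, g⟩ * r y / q x := by
      have h2 := (isScale_scl hx' hy' i g).change (D.isDefiningFunction_zeta x i)
        (D.isDefiningFunction_zeta y i) hx' hy' hq hr hq0 hhq hkr
      exact (hs.scale_eq hh hk hx hy).symm.trans (h2.scale_eq hh hk hx hy)
    have h3 : a⁻¹ * r y ≠ 0 := mul_ne_zero (inv_ne_zero ha) hr0
    rw [value_eq_of_eq_mul_zeta (i := ⟨i, hi⟩) hq.continuousAt hq0 hhq,
      value_eq_of_eq_mul_zeta (i := ⟨i, hi'⟩) (u := fun z => a⁻¹ * r z)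
        (continuousAt_const.mul hr.continuousAt) h3 (hkr.mono fun z hz => by rw [hz, mul_assoc])]
    refine fib_ext (Units.ext ?_) (funext fun j => ?_)
    · rw [coef_act, coef_fib, coef_fib, Finset.prod_eq_single ⟨i, hi⟩]
      · have h4 := scl_ne_zero (g := ⟨x, y, g⟩) hx' hy' i
        simp [sclUnit, h1]
        field_simp
      · intro j _ hj
        simp [hj]
      · simp
    · rw [ord_act, ord_fib, ord_fib]
      obtain ⟨j, hj⟩ := j
      by_cases hij : j = i
      · subst hij
        simp [throughEquiv_symm_apply]
      · simp [throughEquiv_symm_apply, hij]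
  · have hi' := fun h => hi ((g.mem_iff i).2 h)
    have h1 : h x ≠ 0 := fun h0 => hi ((hh.zero_iff x hx).1 h0)
    have h2 : k y ≠ 0 := fun h0 => hi' ((hk.zero_iff y hy).1 h0)
    rw [(isValue_of_continuousAt (hh.holAt hx).continuousAt h1).value_eq, act_cst,
      (isValue_of_continuousAt (u := fun z => a⁻¹ * k z)
        (continuousAt_const.mul (hk.holAt hy).continuousAt)
        (mul_ne_zero (inv_ne_zero ha) h2)).value_eq, hs.off hi, inv_mul_cancel_left₀ ha]

theorem isCanonicalAction :
    D.IsCanonicalAction (F := D.Fib) (fun _ f x => D.value x f) (act (D := D)) where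
  act_const x y g c hc := by rw [value_const hc, value_const hc, act_cst]
  act_defining _ _ _ _ _ hh hk _ _ _ _ hx hy hs :=
    act_value_of_isDefiningFunction hh hk hx hy hs

end SNCDivisor

namespace SNCDivisor

variable {n : ℕ} {X : Type u} [TopologicalSpace X] [ChartedSpace (Fin n → ℂ) X]
  {D : SNCDivisor.{u, v} n X}

/-! ### The `Pair(X, D)`-module -/

section MonomialValue

variable {x y p q : X}

theorem IsValue.pow {f : X → ℂ} {v : D.Fib x} (h : IsValue x f v) (k : ℕ) :
    IsValue x (fun y => f y ^ k) (v ^ k) := by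
  induction k with
  | zero =>
    have h1 := isValue_of_continuousAt (D := D) (x := x) (u := fun _ => (1 : ℂ)) continuousAt_const
      one_ne_zero
    rw [cst_one] at h1
    simpa using h1
  | succ k ih => simpa only [pow_succ] using ih.mul h

theorem IsValue.zpow {f : X → ℂ} {v : D.Fib x} (h : IsValue x f v) (k : ℤ) :
    IsValue x (fun y => f y ^ k) (v ^ k) := by
  cases k with
  | ofNat k => simpa using h.pow k
  | negSucc k => simpa only [zpow_negSucc] using (h.pow (k + 1)).inv

theorem IsValue.prod {ι : Type*} (s : Finset ι) {f : ι → X → ℂ} {v : ι → D.Fib x}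
    (h : ∀ i, IsValue x (f i) (v i)) : IsValue x (fun y => ∏ i ∈ s, f i y) (∏ i ∈ s, v i) := by
  classical
  induction s using Finset.induction_on with
  | empty =>
    have h1 := isValue_of_continuousAt (D := D) (x := x) (u := fun _ => (1 : ℂ)) continuousAt_const
      one_ne_zero
    rw [cst_one] at h1
    simpa using h1
  | insert i s hi ih => simpa only [Finset.prod_insert hi] using (h i).mul ih

theorem IsValue.value_const_mul {f : X → ℂ} {v : D.Fib x} {a : ℂ} (h : IsValue x f v) (ha : a ≠ 0) :
    D.value x (fun y => a * f y) = v * D.cst x a :=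
  (h.mul_cst (g := fun y => a * f y) (u := fun _ => a) continuousAt_const ha
    (Eventually.of_forall fun _ => mul_comm _ _)).value_eq

theorem value_mono (hx : x ∈ D.dom p) (m : D.Through p → ℤ) :
    D.value x (D.mono p m) = ∏ i : D.Through p, D.value x (D.zeta p i) ^ m i :=
  (IsValue.prod Finset.univ fun i : D.Through p =>
    ((D.isDefiningFunction_zeta p i).isMerUnit.isValue hx).zpow (m i)).value_eq

theorem cst_prod_zpow {ι : Type*} [Fintype ι] {c : ι → ℂ} (hc : ∀ i, c i ≠ 0) (k : ι → ℤ) :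
    D.cst x (∏ i, c i ^ k i) = ∏ i, D.cst x (c i) ^ k i := by
  have h := fun i => isValue_of_continuousAt (D := D) (x := x) (u := fun _ => c i)
    continuousAt_const (hc i)
  have h1 := isValue_of_continuousAt (D := D) (x := x) (u := fun _ => ∏ i, c i ^ k i)
    continuousAt_const (Finset.prod_ne_zero_iff.2 fun i _ => zpow_ne_zero _ (hc i))
  exact h1.unique (IsValue.prod Finset.univ fun i => (h i).zpow (k i))

/-- The scale of an arrow along a monomial in the coordinates that define `D`. -/
def sclMono (p q : X) (m : D.Through p → ℤ) (g : Arr D.pair) : ℂ :=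
  ∏ i : D.Through p, scl p q i g ^ m i

theorem sclMono_ne_zero {g : Arr D.pair} (hx : g.1 ∈ D.dom p) (hy : g.2.1 ∈ D.dom q)
    (m : D.Through p → ℤ) : sclMono p q m g ≠ 0 :=
  Finset.prod_ne_zero_iff.2 fun i _ => zpow_ne_zero _ (scl_ne_zero hx hy i)

theorem sclMono_arrInv {g : Arr D.pair} (hx : g.1 ∈ D.dom p) (hy : g.2.1 ∈ D.dom p)
    (m : D.Through p → ℤ) : sclMono p p m (arrInv g) = (sclMono p p m g)⁻¹ := by
  rw [sclMono, sclMono, ← Finset.prod_inv_distrib]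
  exact Finset.prod_congr rfl fun i _ => by rw [scl_arrInv hx hy, inv_zpow]

theorem sclMono_idArr (hx : x ∈ D.dom p) (m : D.Through p → ℤ) :
    sclMono p p m (idArr D.pair x) = 1 :=
  Finset.prod_eq_one fun i _ => by rw [scl_id hx, one_zpow]

theorem mono_target {g : Arr D.pair} (hx : g.1 ∈ D.dom p) (hy : g.2.1 ∈ D.dom p)
    (m : D.Through p → ℤ) : D.mono p m g.2.1 = sclMono p p m g * D.mono p m g.1 := by
  rw [mono, mono, sclMono, ← Finset.prod_mul_distrib]
  exact Finset.prod_congr rfl fun i _ => by rw [zeta_target hx hy, mul_zpow]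

theorem contMDiffAt_sclMono {g : Arr D.pair} (hx : g.1 ∈ D.dom p) (hy : g.2.1 ∈ D.dom q)
    (m : D.Through p → ℤ) :
    ContMDiffAt 𝓘(ℂ, (Fin n → ℂ) × (Fin n → ℂ)) 𝓘(ℂ, ℂ) ω (sclMono p q m) g := by
  refine contMDiffAt_finsetProd fun i _ => ?_
  have h := contMDiffAt_scl hx hy i
  cases m i with
  | ofNat k => simpa using h.pow k
  | negSucc k =>
    simp only [zpow_negSucc]
    exact (h.pow (k + 1)).inv₀ (pow_ne_zero _ (scl_ne_zero hx hy i))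

/-- An arrow takes the value of a monomial at its source to the value at its target of the
corresponding monomial, divided by the scale. -/
theorem act_value_mono (r : ∀ i, p ∈ D.comp i ↔ q ∈ D.comp i) (hx : x ∈ D.dom p)
    (hy : y ∈ D.dom q) (g : D.PairHom x y) (m : D.Through p → ℤ) :
    act x y g (D.value x (D.mono p m)) =
      D.value y (D.mono q (m ∘ (throughEquiv r).symm)) * D.cst y (sclMono p q m ⟨x, y, g⟩)⁻¹ := by
  have hne : ∀ i : D.Through p, scl p q i ⟨x, y, g⟩ ≠ 0 := fun i =>
    scl_ne_zero (g := ⟨x, y, g⟩) hx hy i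
  have h1 : ∀ i : D.Through p, act x y g (D.value x (D.zeta p i)) =
      D.value y (D.zeta q i) * (D.cst y (scl p q i ⟨x, y, g⟩))⁻¹ := by
    intro i
    have hi := act_value_of_isDefiningFunction (D.isDefiningFunction_zeta p i)
      (D.isDefiningFunction_zeta q i) hx hy (isScale_scl hx hy i g)
    rw [hi, ← cst_inv (hne i)]
    exact ((D.isDefiningFunction_zeta q i).isMerUnit.isValue hy).value_const_mul
      (inv_ne_zero (hne i))
  have h2 : D.cst y (sclMono p q m ⟨x, y, g⟩) =
      ∏ i : D.Through p, D.cst y (scl p q i ⟨x, y, g⟩) ^ m i := cst_prod_zpow hne m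
  have h3 : ∏ i : D.Through p, D.value y (D.zeta q i) ^ m i =
      D.value y (D.mono q (m ∘ (throughEquiv r).symm)) := by
    rw [value_mono hy]
    exact Fintype.prod_equiv (throughEquiv r) _ _ fun i => by
      rw [Function.comp_apply, Equiv.symm_apply_apply]; rfl
  rw [cst_inv (sclMono_ne_zero (g := ⟨x, y, g⟩) hx hy m), h2, ← h3, value_mono hx, map_prod,
    ← Finset.prod_inv_distrib, ← Finset.prod_mul_distrib]
  exact Finset.prod_congr rfl fun i _ => by rw [map_zpow, h1, mul_zpow, inv_zpow]

end MonomialValue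

/-- The action is holomorphic: near a point of the space of arrows and values it is multiplication
of monomials by holomorphic functions. -/
theorem isGroupoidModule_act : IsGroupoidModule (EG := (Fin n → ℂ) × (Fin n → ℂ))
    (EM := (Fin n → ℂ) × ℂ) D.pair D.Fib act where
  act_id _ v := act_id v
  act_comp _ _ _ f g v := act_comp f g v
  act_holomorphic := by
    classical
    set a : Arr D.pair × (Σ x, D.Fib x) → Σ x, D.Fib x := fun P =>
      if h : P.1.1 = P.2.1 then
        ⟨P.1.2.1, act P.2.1 P.1.2.1
          (Eq.ndrec (motive := fun z => D.PairHom z P.1.2.1) P.1.2.2 h) P.2.2⟩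
      else P.2
    have ha : ∀ (x y : X) (g : D.pair.Hom x y) (v : D.Fib x),
        a (⟨x, y, g⟩, ⟨x, v⟩) = ⟨y, act x y g v⟩ := fun x y g v => by simp [a]
    refine ⟨a, ha, ?_⟩
    rintro ⟨⟨x, y, g⟩, ⟨x', v⟩⟩ (h : x = x')
    subst h
    have hx := D.mem_dom_self x
    have hy := D.mem_dom_self y
    set m := ord v
    set f := D.mono y (m ∘ (throughEquiv g.mem_iff).symm)
    have hf : D.IsMerUnit (D.dom y) f := D.isMerUnit_mono _ _
    have hq := contMDiffAt_quo (D.isMerUnit_mono x m) (v := ⟨x, v⟩) hx (ordEq_mono_self ⟨x, v⟩)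
    have key : ∀ P : Arr D.pair × (Σ x, D.Fib x), P.1.1 = P.2.1 → P.1.1 ∈ D.dom x →
        P.1.2.1 ∈ D.dom y → OrdEq (D.mono x m) P.2 →
        a P = D.sec f (P.1.2.1, quo (D.mono x m) P.2 * (sclMono x y m P.1)⁻¹) := by
      rintro ⟨⟨x', y', g'⟩, ⟨x'', w⟩⟩ (h : x' = x'') h1 h2 h3
      subst h
      have h4 : w = D.value x' (D.mono x m) * D.cst x' (quo (D.mono x m) ⟨x', w⟩) :=
        eq_mul_cst_of_ord_eq h3
      rw [ha]
      conv_lhs => rw [h4]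
      rw [map_mul, act_cst, act_value_mono g.mem_iff h1 h2, sec, cst_mul (quo_ne_zero _ _)
        (inv_ne_zero (sclMono_ne_zero (g := ⟨x', y', g'⟩) h1 h2 m)), mul_assoc,
        mul_comm (D.cst y' (sclMono x y m ⟨x', y', g'⟩)⁻¹)]
    have hc1 : Tendsto Prod.fst (𝓝[{P : Arr D.pair × (Σ x, D.Fib x) | P.1.1 = P.2.1}]
        ((⟨x, y, g⟩ : Arr D.pair), (⟨x, v⟩ : Σ x, D.Fib x))) (𝓝 ⟨x, y, g⟩) :=
      continuousAt_fst.tendsto.mono_left nhdsWithin_le_nhds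
    have hc2 : Tendsto Prod.snd (𝓝[{P : Arr D.pair × (Σ x, D.Fib x) | P.1.1 = P.2.1}]
        ((⟨x, y, g⟩ : Arr D.pair), (⟨x, v⟩ : Σ x, D.Fib x))) (𝓝 ⟨x, v⟩) :=
      continuousAt_snd.tendsto.mono_left nhdsWithin_le_nhds
    have hp1 : ContMDiffAt (𝓘(ℂ, (Fin n → ℂ) × (Fin n → ℂ)).prod 𝓘(ℂ, (Fin n → ℂ) × ℂ))
        𝓘(ℂ, (Fin n → ℂ) × (Fin n → ℂ)) ω Prod.fst
        ((⟨x, y, g⟩ : Arr D.pair), (⟨x, v⟩ : Σ x, D.Fib x)) := contMDiffAt_fst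
    have hp2 : ContMDiffAt (𝓘(ℂ, (Fin n → ℂ) × (Fin n → ℂ)).prod 𝓘(ℂ, (Fin n → ℂ) × ℂ))
        𝓘(ℂ, (Fin n → ℂ) × ℂ) ω Prod.snd
        ((⟨x, y, g⟩ : Arr D.pair), (⟨x, v⟩ : Σ x, D.Fib x)) := contMDiffAt_snd
    refine contMDiffWithinAt_of_eq_sec hf (b := fun P => P.1.2.1)
      (c := fun P => quo (D.mono x m) P.2 * (sclMono x y m P.1)⁻¹) ?_ ?_ hy
      (mul_ne_zero (quo_ne_zero _ _)
        (inv_ne_zero (sclMono_ne_zero (g := ⟨x, y, g⟩) hx hy m))) ?_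
      (key _ rfl hx hy (ordEq_mono_self ⟨x, v⟩))
    · exact (ContMDiffAt.comp _ (contMDiff_target D).contMDiffAt hp1).contMDiffWithinAt
    · refine (ContMDiffAt.mul ?_ ?_).contMDiffWithinAt
      · exact ContMDiffAt.comp ((⟨x, y, g⟩ : Arr D.pair), (⟨x, v⟩ : Σ x, D.Fib x)) hq.1 hp2
      · have h1 : ContMDiffAt 𝓘(ℂ, (Fin n → ℂ) × (Fin n → ℂ)) 𝓘(ℂ, ℂ) ω
            (fun g' => (sclMono x y m g')⁻¹) (⟨x, y, g⟩ : Arr D.pair) :=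
          (contMDiffAt_sclMono hx hy m).inv₀ (sclMono_ne_zero hx hy m)
        have h2 := ContMDiffAt.comp ((⟨x, y, g⟩ : Arr D.pair), (⟨x, v⟩ : Σ x, D.Fib x)) h1 hp1
        exact h2
    · filter_upwards [hc1.eventually (eventually_source_mem hx),
        hc1.eventually (eventually_target_mem hy), hc2.eventually hq.2,
        self_mem_nhdsWithin] with P h1 h2 h3 h4
      exact key P h4 h1 h2 h3

variable [IsManifold 𝓘(ℂ, Fin n → ℂ) ω X]

/-- The action differentiates to `dlog`: near an identity arrow it multiplies a section by the
quotient of its values at target and source, which extends holomorphically to `D`; so its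
derivative, known off `D`, is the logarithmic derivative along the anchor. -/
theorem integrates_act : D.Integrates (EG := (Fin n → ℂ) × (Fin n → ℂ))
    (EM := (Fin n → ℂ) × ℂ) act D.logModule := by
  intro U V s ξ hV hs hξ hVξ x hx γ hγ0 hγ
  have hxd := D.mem_dom_self x
  obtain ⟨c, hc, hc0, hsc⟩ := exists_section_eq hs hx
  set m := ord (s x)
  -- near `x` the section is `c` times the monomial with exponents `m`
  set 𝒢 : Arr D.pair → ℂ := fun g => c g.2.1 / c g.1 * sclMono x x m g
  have h𝒢 : ∀ g : Arr D.pair, g.1 ∈ D.dom x → g.2.1 ∈ D.dom x → HolAt n c g.1 →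
      HolAt n c g.2.1 → ContMDiffAt 𝓘(ℂ, (Fin n → ℂ) × (Fin n → ℂ)) 𝓘(ℂ, ℂ) ω 𝒢 g := by
    intro g h1 h2 h3 h4
    exact ((ContMDiffAt.comp g h4 (contMDiff_target D g)).div₀
      (ContMDiffAt.comp g h3 (contMDiff_source D g)) (hc0 _)).mul (contMDiffAt_sclMono h1 h2 m)
  have hγ1 : (⟨x, γ 0⟩ : Arr D.pair) = idArr D.pair x := by rw [hγ0]
  have h𝒢x := h𝒢 (idArr D.pair x) hxd hxd hc hc
  -- the derivative of the factor along the curve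
  have hder : HasDerivAt (fun ε => 𝒢 ⟨x, γ ε⟩) (dArr 𝒢 x (ξ x).1) 0 := by
    have h1 := hasDerivAt_comp_curve (f := 𝒢) (γ := fun ε => (⟨x, γ ε⟩ : Arr D.pair))
      (by rw [hγ1]; exact h𝒢x.mdifferentiableAt (by simp)) hγ
    have h2 : ∀ g : Arr D.pair, g = idArr D.pair x →
        (mfderiv 𝓘(ℂ, (Fin n → ℂ) × (Fin n → ℂ)) 𝓘(ℂ, ℂ) 𝒢 g
          (ξ x).1 : ℂ) = dArr 𝒢 x (ξ x).1 := by
      rintro g rfl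
      rfl
    rw [← h2 _ hγ1]
    exact h1
  have hdl : dArr 𝒢 x (ξ x).1 = D.dlogAlong V (coefFun s) x := by
    refine eq_of_eventually_off (D := D)
      (holAt_dArr (hξ.contMDiffAt (U.isOpen.mem_nhds hx)) h𝒢x).continuousAt
      (holAt_dlogAlong hV (isMerUnit_coef hs) hx).continuousAt ?_
    filter_upwards [eventually_eventually_nhds.2 hsc, U.isOpen.mem_nhds hx,
      (D.dom x).isOpen.mem_nhds hxd, D.eventually_holAt hc] with y hy hyU hyd hcy hD
    have h1 : ∀ᶠ z in 𝓝 y, z ∈ D.dom x ∧ coefFun s z = D.mono x m z * c z := by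
      filter_upwards [hy, (D.dom x).isOpen.mem_nhds hyd, eventually_notMem_support hD]
        with z h1 h2 h3
      refine ⟨h2, ?_⟩
      rw [coefFun, h1, value_of_notMem (D.isMerUnit_mono _ _) h2 h3, coef_mul, Units.val_mul,
        coef_cst (hc0 z), coef_cst (D.mono_ne_zero h2 h3 _)]
    have hst : Tendsto (fun g : Arr D.pair => g.1) (𝓝 (idArr D.pair y)) (𝓝 y) :=
      (contMDiff_source D).continuous.continuousAt
    have htt : Tendsto (fun g : Arr D.pair => g.2.1) (𝓝 (idArr D.pair y)) (𝓝 y) :=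
      (contMDiff_target D).continuous.continuousAt
    rw [dlogAlong_of_notMem hV (isMerUnit_coef hs) hyU hD, lieDeriv, ← hVξ y hyU,
      differential_anchor_of_eq_mul ((isMerUnit_coef hs).holAt hyU hD)
        (h𝒢 (idArr D.pair y) hyd hyd hcy hcy) ?_ (ξ y),
      mul_div_cancel_left₀ _ (coef (s y)).ne_zero]
    filter_upwards [hst.eventually h1, htt.eventually h1] with g hg1 hg2
    change coefFun s g.2.1 = 𝒢 g * coefFun s g.1
    rw [hg1.2, hg2.2, mono_target hg1.1 hg2.1]
    have := hc0 g.1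
    simp only [𝒢]
    field_simp
  rw [hdl] at hder
  refine hasVelocity_triv hder ?_ ?_
  · rw [hγ1]
    change c x / c x * sclMono x x m (idArr D.pair x) = 1
    rw [sclMono_idArr hxd, mul_one, div_self (hc0 x)]
  · have key : ∀ z : Σ y, D.pair.Hom x y, s z.1 = D.value z.1 (D.mono x m) * D.cst z.1 (c z.1) →
        z.1 ∈ D.dom x →
        (s x)⁻¹ * act z.1 x (D.pair.inv z.2) (s z.1) = D.cst x (𝒢 ⟨x, z⟩) := by
      rintro ⟨y, g⟩ h2 h3
      replace h2 : s y = D.value y (D.mono x m) * D.cst y (c y) := h2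
      replace h3 : y ∈ D.dom x := h3
      have h4 := act_value_mono (fun i => Iff.rfl) h3 hxd (D.pair.inv g) m
      have h5 : sclMono x x m ⟨y, x, D.pair.inv g⟩ = (sclMono x x m ⟨x, y, g⟩)⁻¹ :=
        sclMono_arrInv (g := ⟨x, y, g⟩) hxd h3 m
      have h6 := sclMono_ne_zero (g := ⟨x, y, g⟩) hxd h3 m
      have h7 : s x = D.value x (D.mono x m) * D.cst x (c x) := hsc.self_of_nhds
      have h8 : m ∘ (throughEquiv fun i : D.ι => (Iff.rfl : x ∈ D.comp i ↔ x ∈ D.comp i)).symm =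
          m := rfl
      rw [h8, h5, inv_inv] at h4
      change (s x)⁻¹ * act y x (D.pair.inv g) (s y) =
        D.cst x (c y / c x * sclMono x x m ⟨x, y, g⟩)
      rw [h2, map_mul, act_cst, h4, h7, div_eq_mul_inv,
        cst_mul (mul_ne_zero (hc0 y) (inv_ne_zero (hc0 x))) h6,
        cst_mul (hc0 y) (inv_ne_zero (hc0 x)), cst_inv (hc0 x)]
      generalize D.value x (D.mono x m) = A
      generalize D.cst x (c x) = B
      generalize D.cst x (c y) = C
      generalize D.cst x (sclMono x x m ⟨x, y, g⟩) = E
      rw [mul_inv]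
      calc A⁻¹ * B⁻¹ * (A * E * C) = (A⁻¹ * A) * (C * B⁻¹ * E) := by ac_rfl
        _ = C * B⁻¹ * E := by rw [inv_mul_cancel, one_mul]
    have h1 : Tendsto (fun ε => (⟨x, γ ε⟩ : Arr D.pair)) (𝓝 0) (𝓝 (idArr D.pair x)) := by
      rw [← hγ1]
      exact hγ.continuousAt
    have htt : Tendsto (fun g : Arr D.pair => g.2.1) (𝓝 (idArr D.pair x)) (𝓝 x) :=
      (contMDiff_target D).continuous.continuousAt
    filter_upwards [(htt.comp h1).eventually hsc,
      (htt.comp h1).eventually ((D.dom x).isOpen.mem_nhds hxd)] with ε h2 h3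
    exact key (γ ε) h2 h3

end SNCDivisor

end LogPair

end

theorem mainTheorem11 {n : ℕ} {X : Type u} [TopologicalSpace X] [T2Space X]
    [ChartedSpace (Fin n → ℂ) X] [IsManifold 𝓘(ℂ, Fin n → ℂ) ω X]
    (D : LogPair.SNCDivisor.{u, v} n X) :
    -- the groupoid `Pair(X, D)` is a holomorphic Lie groupoid integrating `T_X(-log D)`
    ∃ (_ : TopologicalSpace (LogPair.Arr D.pair))
      (_ : ChartedSpace ((Fin n → ℂ) × (Fin n → ℂ)) (LogPair.Arr D.pair))
      (_ : IsManifold 𝓘(ℂ, (Fin n → ℂ) × (Fin n → ℂ)) ω (LogPair.Arr D.pair)),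
      LogPair.IsLieGroupoid (E := Fin n → ℂ) (EG := (Fin n → ℂ) × (Fin n → ℂ)) D.pair ∧
      D.ScalesHolomorphic (EG := (Fin n → ℂ) × (Fin n → ℂ)) ∧
      D.IntegratesLogTangent (EG := (Fin n → ℂ) × (Fin n → ℂ)) ∧
    -- the family of abelian groups, with the sheaf isomorphism `Φ` from `𝒪^*(*D)`
    ∃ (F : X → Type u) (_ : ∀ x, CommGroup (F x)) (_ : TopologicalSpace (Σ x, F x))
      (_ : ChartedSpace ((Fin n → ℂ) × ℂ) (Σ x, F x))
      (_ : IsManifold 𝓘(ℂ, (Fin n → ℂ) × ℂ) ω (Σ x, F x))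
      (Φ : Opens X → (X → ℂ) → ∀ x, F x),
      LogPair.IsFamilyOfAbelianGroups (E := Fin n → ℂ) (EM := (Fin n → ℂ) × ℂ) F ∧
      D.IsSheafIso (EM := (Fin n → ℂ) × ℂ) F Φ ∧
      (∀ x, Nonempty (F x ≃* ℂˣ × Multiplicative ({i // x ∈ D.comp i} → ℤ))) ∧
      (∀ x ∈ D.support, ∀ U ∈ 𝓝 x, ∃ y ∈ U, IsEmpty (F x ≃* F y)) ∧
    -- the trivialization `ℂ_X ≅ 𝔪` of the Lie algebroid of the family, with `exp c = Φ(e^c)`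
    ∃ triv : ∀ x, ℂ ≃ₗ[ℂ] LogPair.LieFibre (E := Fin n → ℂ) (EM := (Fin n → ℂ) × ℂ) F x,
      LogPair.IsLieSection F ⊤ (fun x => triv x 1) ∧
      (∀ (U : Opens X) (g : X → ℂ), LogPair.IsHol (E := Fin n → ℂ) U g →
        ∀ x ∈ U, LogPair.IsExp F (triv x (g x)) (Φ U (fun y => Complex.exp (g y)) x)) ∧
    -- the `T_X(-log D)`-module given by `dlog`, and the canonical `Pair(X, D)`-module
    ∃ (𝓛 : D.LogModule (EM := (Fin n → ℂ) × ℂ) F)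
      (act : ∀ x y : X, D.pair.Hom x y → (F x →* F y)),
      (∀ (U : Opens X) (f : X → ℂ) (V : ∀ x : X, TangentSpace 𝓘(ℂ, Fin n → ℂ) x),
        D.IsMerUnit U f → D.IsLogField U V →
        ∃ h : X → ℂ, D.IsDlog U f V h ∧ ∀ x ∈ U, 𝓛.Lt U V (Φ U f) x = triv x (h x)) ∧
      LogPair.IsGroupoidModule (EG := (Fin n → ℂ) × (Fin n → ℂ)) (EM := (Fin n → ℂ) × ℂ)
        D.pair F act ∧
      D.IsCanonicalAction Φ act ∧
      D.Integrates (EG := (Fin n → ℂ) × (Fin n → ℂ)) act 𝓛 := by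
  refine ⟨inferInstance, inferInstance, inferInstance, D.isLieGroupoid_pair, D.scalesHolomorphic,
    D.integratesLogTangent, D.Fib, inferInstance, inferInstance, inferInstance, inferInstance,
    fun _ f x => D.value x f, D.isFamilyOfAbelianGroups_fib, LogPair.SNCDivisor.isSheafIso_value,
    fun x => ⟨D.fibEquiv x⟩, fun x hx U hU => LogPair.SNCDivisor.exists_isEmpty_mulEquiv hx hU,
    D.triv, ?_, fun U g hg x hx => ?_, D.logModule, LogPair.SNCDivisor.act,
    fun U f V hf hV => ⟨D.dlogAlong V f, LogPair.SNCDivisor.isDlog_dlogAlong hV hf,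
      fun x hx => LogPair.SNCDivisor.logModule_Lt_value hV hf hx⟩,
    LogPair.SNCDivisor.isGroupoidModule_act, LogPair.SNCDivisor.isCanonicalAction,
    LogPair.SNCDivisor.integrates_act⟩
  · refine LogPair.SNCDivisor.isLieSection_iff.2 fun x _ => ?_
    simp only [LinearEquiv.symm_apply_apply]
    exact contMDiffAt_const
  · have h : ContinuousAt (fun y => Complex.exp (g y)) x :=
      Complex.continuous_exp.continuousAt.comp
        (hg.continuousOn.continuousAt (U.isOpen.mem_nhds hx))
    have h1 := (LogPair.SNCDivisor.isValue_of_continuousAt (D := D) h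
      (Complex.exp_ne_zero _)).value_eq
    beta_reduce
    rw [h1]
    exact D.isExp_triv x (g x)
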